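/- A Fell bundle over a discrete group $G$ is a family $\mathcal A=(A_t)_{t\in G}$ of complex Banach spaces with bilinear products $A_s\times A_t\to A_{st}$ and conjugate-linear involutions $A_t\to A_{t^{-1}}$, $a\mapsto a^*$, such that the product is associative, $(ab)^*=b^*a^*$, $a^{**}=a$, $\|ab\|\le\|a\|\,\|b\|$, $\|a^*a\|=\|a\|^2$, and $a^*a\ge 0$ in the C*-algebra $A_e$ for all $a$ in the fibers ($e$ is the unit of $G$). It has the approximation property if there is a net $(a_i)_{i\in I}$ of finitely supported functions $a_i\colon G\to A_e$ such that $\sup_{i}\bigl\|\sum_{r\in G}a_i(r)^*a_i(r)\bigr\|<\infty$ and $\lim_i\sum_{r\in G}a_i(tr)^*\,b\,a_i(r)=b$ in norm for all $t\in G$ and $b\in A_t$. Its full cross-sectional C*-algebra $C^*(\mathcal A)$ is the completion of the convolution *-algebra of finitely supported sections of $\mathcal A$ with respect to its largest C*-seminorm bounded by the $\ell^1$-norm (that is, the enveloping C*-algebra of $\ell^1(\mathcal A)$). A C*-norm on a complex *-algebra is a norm $p$ with $p(xy)\le p(x)p(y)$ and $p(x^*x)=p(x)^2$; a C*-algebra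 $C$ is nuclear if for every C*-algebra $D$ the algebraic tensor product $C\odot D$ admits exactly one C*-norm. C*-algebras need not be unital. (1) Let $\mathcal A$ and $\mathcal B$ be Fell bundles over discrete groups $G$ and $H$, respectively, both with the approximation property. Then the algebraic tensor product $A_e\odot B_e$ of the unit fibers admits exactly one C*-norm if and only if $C^*(\mathcal A)\odot C^*(\mathcal B)$ admits exactly one C*-norm. (2) If $\mathcal A$ is a Fell bundle over a discrete group with the approximation property and its unit fiber $A_e$ is nuclear, then $C^*(\mathcal A)$ is nuclear. -/

import Mathlib

open scoped TensorProduct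

universe u v u₁ v₁ u₂ v₂ w

noncomputable section

/-! ### C*-seminorms and C*-norms on complex *-algebras -/

section CStarNorms

variable {E : Type*} [NonUnitalRing E] [Module ℂ E] [StarRing E]

/-- A C*-seminorm on a complex *-algebra: a submultiplicative seminorm satisfying the
C*-identity. -/
structure IsCStarSeminorm (p : Seminorm ℂ E) : Prop where
  mul_le : ∀ x y, p (x * y) ≤ p x * p y
  star_mul_self : ∀ x, p (star x * x) = p x ^ 2

/-- A C*-norm on a complex *-algebra: a C*-seminorm that vanishes only at `0`. -/
structure IsCStarNorm (p : Seminorm ℂ E) : Prop extends IsCStarSeminorm p where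
  eq_zero : ∀ x, p x = 0 → x = 0

theorem IsCStarSeminorm.le_star {p : Seminorm ℂ E} (hp : IsCStarSeminorm p) (x : E) :
    p x ≤ p (star x) := by
  have h1 := hp.star_mul_self x
  have h2 := hp.mul_le (star x) x
  rcases (apply_nonneg p x).eq_or_lt with h | h
  · rw [← h]; exact apply_nonneg p _
  · exact le_of_mul_le_mul_right (by nlinarith) h

theorem IsCStarSeminorm.map_star {p : Seminorm ℂ E} (hp : IsCStarSeminorm p) (x : E) :
    p (star x) = p x :=
  le_antisymm (by simpa using hp.le_star (star x)) (hp.le_star x)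

end CStarNorms

/-- The algebraic tensor product `A ⊙ B` of two C*-algebras admits exactly one C*-norm. -/
def HasUniqueCStarNorm (A : Type*) (B : Type*) [NonUnitalCStarAlgebra A]
    [NonUnitalCStarAlgebra B] : Prop :=
  ∃! p : Seminorm ℂ (A ⊗[ℂ] B), IsCStarNorm p

/-- A C*-algebra `A` is nuclear if for every C*-algebra `B` (unital or not) the algebraic tensor
product `A ⊙ B` admits exactly one C*-norm. -/
def IsNuclear (A : Type u) [NonUnitalCStarAlgebra A] : Prop :=
  ∀ (B : Type w) [NonUnitalCStarAlgebra B], HasUniqueCStarNorm A B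

/-! ### The C*-algebra obtained from a *-algebra with a C*-seminorm -/

section Completion

open UniformSpace

variable {E : Type u} [NonUnitalRing E] [Module ℂ E] [StarRing E]

/-- A copy of the *-algebra `E`, carrying the C*-seminorm `p` as its norm. -/
def PreCStar {p : Seminorm ℂ E} (_ : IsCStarSeminorm p) : Type u := E

variable {p : Seminorm ℂ E} (hp : IsCStarSeminorm p)

instance : NonUnitalRing (PreCStar hp) := inferInstanceAs (NonUnitalRing E)

instance : Module ℂ (PreCStar hp) := inferInstanceAs (Module ℂ E)

instance : StarRing (PreCStar hp) := inferInstanceAs (StarRing E)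

instance [StarModule ℂ E] : StarModule ℂ (PreCStar hp) := inferInstanceAs (StarModule ℂ E)

instance [IsScalarTower ℂ E E] : IsScalarTower ℂ (PreCStar hp) (PreCStar hp) :=
  inferInstanceAs (IsScalarTower ℂ E E)

instance [SMulCommClass ℂ E E] : SMulCommClass ℂ (PreCStar hp) (PreCStar hp) :=
  inferInstanceAs (SMulCommClass ℂ E E)

/-- The seminorm `p` on the copy of `E`. -/
def PreCStar.seminorm : AddGroupSeminorm (PreCStar hp) := p.toAddGroupSeminorm

instance : SeminormedAddCommGroup (PreCStar hp) :=
  (PreCStar.seminorm hp).toSeminormedAddCommGroup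

instance : NonUnitalSeminormedRing (PreCStar hp) :=
  { (inferInstance : NonUnitalRing (PreCStar hp)),
    (inferInstance : SeminormedAddCommGroup (PreCStar hp)) with
    norm_mul_le := hp.mul_le }

theorem PreCStar.norm_def (x : PreCStar hp) : ‖x‖ = p (show E from x) := rfl

theorem PreCStar.norm_star_mul_self (x : PreCStar hp) : ‖star x * x‖ = ‖x‖ ^ 2 :=
  hp.star_mul_self x

instance : NormedStarGroup (PreCStar hp) := ⟨fun x => (hp.map_star x).le⟩

instance : NormedSpace ℂ (PreCStar hp) where
  norm_smul_le c x := (map_smul_eq_mul p c x).le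

/-- The Hausdorff completion of a *-algebra with respect to a C*-seminorm. -/
def CStarCompletion : Type u := Completion (PreCStar hp)

namespace CStarCompletion

instance : NormedAddCommGroup (CStarCompletion hp) :=
  inferInstanceAs (NormedAddCommGroup (Completion (PreCStar hp)))

instance : NormedSpace ℂ (CStarCompletion hp) :=
  inferInstanceAs (NormedSpace ℂ (Completion (PreCStar hp)))

instance : CompleteSpace (CStarCompletion hp) :=
  inferInstanceAs (CompleteSpace (Completion (PreCStar hp)))

/-- The canonical map of `E` into its completion. -/
def of (x : E) : CStarCompletion hp := ((show PreCStar hp from x : PreCStar hp) : Completion _)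

theorem denseRange_of : DenseRange (of hp) :=
  (Completion.denseRange_coe : DenseRange ((↑) : PreCStar hp → Completion (PreCStar hp)))

theorem norm_of (x : E) : ‖of hp x‖ = p x :=
  Completion.norm_coe (show PreCStar hp from x)

theorem of_add (x y : E) : of hp (x + y) = of hp x + of hp y :=
  Completion.coe_add (α := PreCStar hp) x y

theorem of_zero : of hp 0 = 0 := Completion.coe_zero (α := PreCStar hp)

theorem of_smul (c : ℂ) (x : E) : of hp (c • x) = c • of hp x :=
  Completion.coe_smul (X := PreCStar hp) c x

/-- The product of the completion: the continuous extension of the product of `E`. -/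
instance : Mul (CStarCompletion hp) where
  mul := Function.curry <|
    ((Completion.isDenseInducing_coe (α := PreCStar hp)).prodMap
      (Completion.isDenseInducing_coe (α := PreCStar hp))).extend
      fun q : PreCStar hp × PreCStar hp => ((q.1 * q.2 : PreCStar hp) : Completion (PreCStar hp))

/-- The involution of the completion: the continuous extension of the involution of `E`. -/
instance : Star (CStarCompletion hp) where
  star := Completion.map (star : PreCStar hp → PreCStar hp)

theorem of_mul (x y : E) : of hp (x * y) = of hp x * of hp y :=
  (((Completion.isDenseInducing_coe (α := PreCStar hp)).prodMap
      (Completion.isDenseInducing_coe (α := PreCStar hp))).extend_eq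
      ((Completion.continuous_coe (PreCStar hp)).comp continuous_mul)
      ((show PreCStar hp from x), (show PreCStar hp from y))).symm

theorem of_star (x : E) : of hp (star x) = star (of hp x) :=
  (Completion.map_coe (star_isometry (E := PreCStar hp)).uniformContinuous x).symm

instance : ContinuousMul (CStarCompletion hp) where
  continuous_mul := by
    let m := (AddMonoidHom.mul : PreCStar hp →+ PreCStar hp →+ PreCStar hp).compr₂
      Completion.toCompl
    have hm : Continuous fun q : PreCStar hp × PreCStar hp => m q.1 q.2 :=
      (Completion.continuous_coe (PreCStar hp)).comp continuous_mul
    have di : IsDenseInducing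
        (Completion.toCompl : PreCStar hp → Completion (PreCStar hp)) :=
      Completion.isDenseInducing_coe
    exact (di.extend_Z_bilin di hm :)

instance : ContinuousStar (CStarCompletion hp) where
  continuous_star := Completion.continuous_map

variable {hp} in
theorem induction {P : CStarCompletion hp → Prop} (hc : IsClosed {x | P x})
    (h : ∀ x, P (of hp x)) (x : CStarCompletion hp) : P x :=
  isClosed_property (denseRange_of hp) hc h x

variable {hp} in
theorem induction₂ {P : CStarCompletion hp → CStarCompletion hp → Prop}
    (hc : IsClosed {x : CStarCompletion hp × CStarCompletion hp | P x.1 x.2})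
    (h : ∀ x y, P (of hp x) (of hp y)) (x y : CStarCompletion hp) : P x y :=
  isClosed_property2 (denseRange_of hp) hc h x y

variable {hp} in
theorem induction₃ {P : CStarCompletion hp → CStarCompletion hp → CStarCompletion hp → Prop}
    (hc : IsClosed {x : CStarCompletion hp × CStarCompletion hp × CStarCompletion hp |
      P x.1 x.2.1 x.2.2})
    (h : ∀ x y z, P (of hp x) (of hp y) (of hp z)) (x y z : CStarCompletion hp) : P x y z :=
  isClosed_property3 (denseRange_of hp) hc h x y z

instance : NonUnitalRing (CStarCompletion hp) :=
  { (inferInstance : AddCommGroup (CStarCompletion hp)),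
    (inferInstance : Mul (CStarCompletion hp)) with
    zero_mul := induction (isClosed_eq (by fun_prop) (by fun_prop)) fun x => by
      rw [← of_zero hp, ← of_mul, zero_mul]
    mul_zero := induction (isClosed_eq (by fun_prop) (by fun_prop)) fun x => by
      rw [← of_zero hp, ← of_mul, mul_zero]
    mul_assoc := induction₃ (isClosed_eq (by fun_prop) (by fun_prop)) fun x y z => by
      simp only [← of_mul, mul_assoc]
    left_distrib := induction₃ (isClosed_eq (by fun_prop) (by fun_prop)) fun x y z => by
      simp only [← of_mul, ← of_add, mul_add]
    right_distrib := induction₃ (isClosed_eq (by fun_prop) (by fun_prop)) fun x y z => by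
      simp only [← of_mul, ← of_add, add_mul] }

instance : NonUnitalNormedRing (CStarCompletion hp) :=
  { (inferInstance : NormedAddCommGroup (CStarCompletion hp)),
    (inferInstance : NonUnitalRing (CStarCompletion hp)) with
    norm_mul_le := induction₂ (isClosed_le (by fun_prop) (by fun_prop)) fun x y => by
      simpa only [← of_mul, norm_of] using hp.mul_le x y }

instance : StarRing (CStarCompletion hp) where
  star_involutive := induction (isClosed_eq (by fun_prop) (by fun_prop)) fun x => by
    simp only [← of_star, star_star]
  star_mul := induction₂ (isClosed_eq (by fun_prop) (by fun_prop)) fun x y => by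
    simp only [← of_star, ← of_mul, star_mul]
  star_add := induction₂ (isClosed_eq (by fun_prop) (by fun_prop)) fun x y => by
    simp only [← of_star, ← of_add, star_add]

theorem norm_mul_self_le (x : CStarCompletion hp) : ‖x‖ * ‖x‖ ≤ ‖star x * x‖ := by
  induction x using induction with
  | hc =>
    exact isClosed_le (continuous_norm.mul continuous_norm)
      (continuous_norm.comp (continuous_star.mul continuous_id))
  | h x => rw [← of_star, ← of_mul, norm_of, norm_of, hp.star_mul_self, sq]

instance : CStarRing (CStarCompletion hp) := ⟨norm_mul_self_le hp⟩

theorem smul_mul [IsScalarTower ℂ E E] (c : ℂ) (x y : CStarCompletion hp) :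
    (c • x) * y = c • (x * y) := by
  induction x, y using induction₂ with
  | hc =>
    exact isClosed_eq ((continuous_fst.const_smul c).mul continuous_snd)
      ((continuous_fst.mul continuous_snd).const_smul c)
  | h x y => rw [← of_smul, ← of_mul, ← of_mul, ← of_smul, smul_mul_assoc]

theorem mul_smul [SMulCommClass ℂ E E] (c : ℂ) (x y : CStarCompletion hp) :
    x * (c • y) = c • (x * y) := by
  induction x, y using induction₂ with
  | hc =>
    exact isClosed_eq (continuous_fst.mul (continuous_snd.const_smul c))
      ((continuous_fst.mul continuous_snd).const_smul c)
  | h x y => rw [← of_smul, ← of_mul, ← of_mul, ← of_smul, mul_smul_comm]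

theorem star_smul [StarModule ℂ E] (c : ℂ) (x : CStarCompletion hp) :
    star (c • x) = star c • star x := by
  induction x using induction with
  | hc =>
    exact isClosed_eq (continuous_star.comp (continuous_id.const_smul c))
      (continuous_star.const_smul (star c))
  | h x => rw [← of_smul, ← of_star, ← of_star, ← of_smul, StarModule.star_smul]

/-- The completion of a complex *-algebra with respect to a C*-seminorm is a C*-algebra. -/
instance [IsScalarTower ℂ E E] [SMulCommClass ℂ E E] [StarModule ℂ E] :
    NonUnitalCStarAlgebra (CStarCompletion hp) where
  smul_assoc := smul_mul hp
  smul_comm c x y := (mul_smul hp c x y).symm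
  star_smul := star_smul hp

end CStarCompletion

end Completion

/-! ### Fell bundles over discrete groups -/

/-- A Fell bundle over the discrete group `G`: a family of complex Banach spaces `fiber t`, with
products `fiber s × fiber t → fiber (s * t)` and involutions `fiber t → fiber t⁻¹`.

In order to avoid transports along equalities in `G`, the product is written `mul h a b`, where
`h : s * t = u` says that the fiber over `u` is the one over `s * t`; likewise for `adj`. -/
structure FellBundle (G : Type u) [Group G] where
  /-- The fibers. -/
  fiber : G → Type v
  [normedAddCommGroup : ∀ t, NormedAddCommGroup (fiber t)]
  [normedSpace : ∀ t, NormedSpace ℂ (fiber t)]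
  [completeSpace : ∀ t, CompleteSpace (fiber t)]
  /-- The product. -/
  mul : ∀ {s t u : G}, s * t = u → fiber s → fiber t → fiber u
  /-- The involution. -/
  adj : ∀ {s t : G}, s⁻¹ = t → fiber s → fiber t
  add_mul : ∀ {s t u : G} (h : s * t = u) (a a' : fiber s) (b : fiber t),
    mul h (a + a') b = mul h a b + mul h a' b
  mul_add : ∀ {s t u : G} (h : s * t = u) (a : fiber s) (b b' : fiber t),
    mul h a (b + b') = mul h a b + mul h a b'
  smul_mul : ∀ {s t u : G} (h : s * t = u) (c : ℂ) (a : fiber s) (b : fiber t),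
    mul h (c • a) b = c • mul h a b
  mul_smul : ∀ {s t u : G} (h : s * t = u) (c : ℂ) (a : fiber s) (b : fiber t),
    mul h a (c • b) = c • mul h a b
  mul_assoc : ∀ {r s t rs st rst : G} (h₁ : r * s = rs) (h₂ : rs * t = rst) (h₃ : s * t = st)
    (h₄ : r * st = rst) (a : fiber r) (b : fiber s) (c : fiber t),
    mul h₂ (mul h₁ a b) c = mul h₄ a (mul h₃ b c)
  adj_add : ∀ {s t : G} (h : s⁻¹ = t) (a b : fiber s), adj h (a + b) = adj h a + adj h b
  adj_smul : ∀ {s t : G} (h : s⁻¹ = t) (c : ℂ) (a : fiber s),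
    adj h (c • a) = (starRingEnd ℂ c) • adj h a
  adj_mul : ∀ {s t u s' t' u' : G} (h : s * t = u) (hs : s⁻¹ = s') (ht : t⁻¹ = t')
    (hu : u⁻¹ = u') (h' : t' * s' = u') (a : fiber s) (b : fiber t),
    adj hu (mul h a b) = mul h' (adj ht b) (adj hs a)
  adj_adj : ∀ {s t : G} (h : s⁻¹ = t) (h' : t⁻¹ = s) (a : fiber s), adj h' (adj h a) = a
  norm_mul_le : ∀ {s t u : G} (h : s * t = u) (a : fiber s) (b : fiber t),
    ‖mul h a b‖ ≤ ‖a‖ * ‖b‖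
  norm_adj_mul_self : ∀ {s t : G} (h : s⁻¹ = t) (h' : t * s = 1) (a : fiber s),
    ‖mul h' (adj h a) a‖ = ‖a‖ ^ 2
  /-- `a* a` is a positive element of the C*-algebra `fiber 1`, that is, it equals `c* c` for some
  `c` in `fiber 1`. -/
  adj_mul_self_pos : ∀ {s t : G} (h : s⁻¹ = t) (h' : t * s = 1) (a : fiber s),
    ∃ c : fiber 1, mul h' (adj h a) a = mul (one_mul 1) (adj inv_one c) c

attribute [instance] FellBundle.normedAddCommGroup FellBundle.normedSpace
  FellBundle.completeSpace

namespace FellBundle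

variable {G : Type u} [Group G] (A : FellBundle.{u, v} G)

theorem zero_mul {s t u : G} (h : s * t = u) (b : A.fiber t) : A.mul h 0 b = 0 := by
  simpa using A.smul_mul h 0 0 b

theorem mul_zero {s t u : G} (h : s * t = u) (a : A.fiber s) : A.mul h a 0 = 0 := by
  simpa using A.mul_smul h 0 a 0

theorem adj_zero {s t : G} (h : s⁻¹ = t) : A.adj h (0 : A.fiber s) = 0 := by
  simpa using A.adj_smul h 0 0

/-- The unit fiber of a Fell bundle is a C*-algebra. -/
instance : NonUnitalCStarAlgebra (A.fiber 1) :=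
  { A.normedAddCommGroup 1, A.normedSpace 1, A.completeSpace 1 with
    mul := A.mul (one_mul 1)
    star := A.adj inv_one
    zero_mul := A.zero_mul _
    mul_zero := A.mul_zero _
    mul_assoc := A.mul_assoc _ _ _ _
    left_distrib := A.mul_add _
    right_distrib := A.add_mul _
    norm_mul_le := A.norm_mul_le _
    star_involutive := A.adj_adj _ _
    star_mul := A.adj_mul _ _ _ _ _
    star_add := A.adj_add _
    norm_mul_self_le := fun a => by
      rw [← sq]; exact (A.norm_adj_mul_self inv_one (one_mul 1) a).ge
    smul_assoc := fun c a b => A.smul_mul _ c a b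
    smul_comm := fun c a b => (A.mul_smul _ c a b).symm
    star_smul := A.adj_smul _ }

/-- The approximation property: there is a net `(a i)` of finitely supported functions
`G → fiber 1`, uniformly bounded in the sense that `‖∑ r, (a i r)* (a i r)‖ ≤ M` for all `i`, such
that `∑ r, (a i (t r))* b (a i r)` converges to `b` for all `t` and all `b` in the fiber over `t`.
(The sums may be restricted to the support of `a i`.) -/
def HasApproximationProperty : Prop :=
  ∃ (I : Type (max u v)) (_ : Preorder I) (_ : IsDirectedOrder I) (_ : Nonempty I)
    (a : I → (G →₀ A.fiber 1)),
    (∃ M : ℝ, ∀ i, ‖∑ r ∈ (a i).support, star (a i r) * a i r‖ ≤ M) ∧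
    ∀ (t : G) (b : A.fiber t),
      Filter.Tendsto
        (fun i => ∑ r ∈ (a i).support,
          A.mul (mul_one t) (A.mul (one_mul t) (star (a i (t * r))) b) (a i r))
        Filter.atTop (nhds b)

/-! ### The full cross-sectional C*-algebra -/

open scoped Classical

/-- The finitely supported sections of the bundle. -/
abbrev Sections : Type (max u v) := DirectSum G A.fiber

/-- The section supported at `t` with value `a` there. -/
def delta (t : G) : A.fiber t →ₗ[ℂ] A.Sections := DirectSum.lof ℂ G A.fiber t

/-- The product of the bundle as a bilinear map between fibers. -/
def mulₗ {s t u : G} (h : s * t = u) : A.fiber s →ₗ[ℂ] A.fiber t →ₗ[ℂ] A.fiber u :=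
  LinearMap.mk₂ ℂ (A.mul h) (A.add_mul h) (A.smul_mul h) (A.mul_add h) (A.mul_smul h)

/-- Convolution of sections: the bilinear map extending
`(delta s a, delta t b) ↦ delta (s * t) (a b)`. -/
def conv : A.Sections →ₗ[ℂ] A.Sections →ₗ[ℂ] A.Sections :=
  DirectSum.toModule ℂ G _ fun s => LinearMap.flip <|
    DirectSum.toModule ℂ G _ fun t => LinearMap.flip <|
      (A.mulₗ (rfl : s * t = s * t)).compr₂ (A.delta (s * t))

/-- The involution on sections: the additive map extending `delta t a ↦ delta t⁻¹ a*`. -/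
def sectionStar : A.Sections →+ A.Sections :=
  DirectSum.toAddMonoid fun t =>
    (A.delta t⁻¹).toAddMonoidHom.comp
      (AddMonoidHom.mk' (A.adj (rfl : t⁻¹ = t⁻¹)) (A.adj_add _))

instance : Mul A.Sections := ⟨fun f g => A.conv f g⟩

instance : Star A.Sections := ⟨A.sectionStar⟩

theorem delta_mul_delta {s t u : G} (h : s * t = u) (a : A.fiber s) (b : A.fiber t) :
    A.delta s a * A.delta t b = A.delta u (A.mul h a b) := by
  subst h
  change A.conv (A.delta s a) (A.delta t b) = _
  simp [conv, delta, mulₗ]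

theorem star_delta {s t : G} (h : s⁻¹ = t) (a : A.fiber s) :
    star (A.delta s a) = A.delta t (A.adj h a) := by
  subst h
  change A.sectionStar (DirectSum.of A.fiber s a) = _
  simp [sectionStar]

theorem section_induction {P : A.Sections → Prop} (h0 : P 0) (h1 : ∀ t a, P (A.delta t a))
    (h2 : ∀ f g, P f → P g → P (f + g)) (f : A.Sections) : P f :=
  DirectSum.induction_on f h0 h1 h2

instance : NonUnitalRing A.Sections :=
  { (inferInstance : AddCommGroup A.Sections), (inferInstance : Mul A.Sections) with
    zero_mul := fun f => by change A.conv 0 f = 0; simp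
    mul_zero := fun f => by change A.conv f 0 = 0; simp
    left_distrib := fun f g h => by
      change A.conv f (g + h) = A.conv f g + A.conv f h; simp
    right_distrib := fun f g h => by
      change A.conv (f + g) h = A.conv f h + A.conv g h; simp
    mul_assoc := fun f g h => by
      change A.conv (A.conv f g) h = A.conv f (A.conv g h)
      induction f using A.section_induction with
      | h0 => simp
      | h2 f₁ f₂ h₁ h₂ => simp [h₁, h₂]
      | h1 r a =>
        induction g using A.section_induction with
        | h0 => simp
        | h2 f₁ f₂ h₁ h₂ => simp [h₁, h₂]
        | h1 s b =>
          induction h using A.section_induction with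
          | h0 => simp
          | h2 f₁ f₂ h₁ h₂ => simp [h₁, h₂]
          | h1 t c =>
            change A.delta r a * A.delta s b * A.delta t c
              = A.delta r a * (A.delta s b * A.delta t c)
            rw [A.delta_mul_delta rfl, A.delta_mul_delta rfl, A.delta_mul_delta rfl,
              A.delta_mul_delta (_root_.mul_assoc r s t).symm]
            rw [A.mul_assoc] }

instance : IsScalarTower ℂ A.Sections A.Sections where
  smul_assoc c f g := by
    change A.conv (c • f) g = c • A.conv f g; simp

instance : SMulCommClass ℂ A.Sections A.Sections where
  smul_comm c f g := by
    change c • A.conv f g = A.conv f (c • g); simp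

instance : StarRing A.Sections where
  star_add f g := A.sectionStar.map_add f g
  star_involutive f := by
    induction f using A.section_induction with
    | h0 => exact (congrArg A.sectionStar (map_zero _)).trans (map_zero _)
    | h2 f g hf hg =>
      change A.sectionStar (A.sectionStar (f + g)) = f + g
      rw [map_add, map_add]; exact congrArg₂ (· + ·) hf hg
    | h1 t a => rw [A.star_delta rfl, A.star_delta (inv_inv t), A.adj_adj]
  star_mul f g := by
    have hz : star (0 : A.Sections) = 0 := map_zero A.sectionStar
    have ha : ∀ x y : A.Sections, star (x + y) = star x + star y := map_add A.sectionStar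
    induction f using A.section_induction with
    | h0 => rw [MulZeroClass.zero_mul, hz, MulZeroClass.mul_zero]
    | h2 f₁ f₂ h₁ h₂ => rw [_root_.add_mul, ha, ha, h₁, h₂, _root_.mul_add]
    | h1 s a =>
      induction g using A.section_induction with
      | h0 => rw [MulZeroClass.mul_zero, hz, MulZeroClass.zero_mul]
      | h2 f₁ f₂ h₁ h₂ => rw [_root_.mul_add, ha, ha, h₁, h₂, _root_.add_mul]
      | h1 t b =>
        rw [A.delta_mul_delta rfl, A.star_delta rfl, A.star_delta rfl, A.star_delta rfl,
          A.delta_mul_delta (mul_inv_rev s t).symm, A.adj_mul]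

instance : StarModule ℂ A.Sections where
  star_smul c f := by
    induction f using A.section_induction with
    | h0 => simp
    | h2 f g hf hg => simp only [smul_add, star_add, hf, hg]
    | h1 t a =>
      rw [← map_smul, A.star_delta rfl, A.star_delta rfl, A.adj_smul, map_smul]; rfl

/-- The `ℓ¹`-norm of a finitely supported section. -/
def l1Norm (f : A.Sections) : ℝ := ∑ t ∈ DFinsupp.support f, ‖f t‖

/-- The C*-seminorms on the *-algebra of finitely supported sections that are dominated by the
`ℓ¹`-norm. They are the C*-seminorms of the Banach *-algebra `ℓ¹(A)`. -/
def cstarSeminorms : Set (Seminorm ℂ A.Sections) :=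
  {p | IsCStarSeminorm p ∧ ∀ f, p f ≤ A.l1Norm f}

/-- The universal C*-seminorm: the supremum of the C*-seminorms dominated by the `ℓ¹`-norm. -/
def universalSeminorm : Seminorm ℂ A.Sections := sSup A.cstarSeminorms

theorem bddAbove_cstarSeminorms : BddAbove A.cstarSeminorms := by
  rw [Seminorm.bddAbove_iff]
  refine ⟨A.l1Norm, ?_⟩
  rintro _ ⟨p, hp, rfl⟩
  exact hp.2

theorem zero_mem_cstarSeminorms : (0 : Seminorm ℂ A.Sections) ∈ A.cstarSeminorms :=
  ⟨⟨by simp, by simp⟩, fun f => by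
    exact Finset.sum_nonneg fun t _ => norm_nonneg (f t)⟩

theorem le_universalSeminorm {p : Seminorm ℂ A.Sections} (hp : p ∈ A.cstarSeminorms)
    (f : A.Sections) : p f ≤ A.universalSeminorm f :=
  le_csSup A.bddAbove_cstarSeminorms hp f

theorem universalSeminorm_le {f : A.Sections} {c : ℝ}
    (h : ∀ p ∈ A.cstarSeminorms, p f ≤ c) : A.universalSeminorm f ≤ c := by
  have : Nonempty A.cstarSeminorms := ⟨⟨0, A.zero_mem_cstarSeminorms⟩⟩
  rw [universalSeminorm, Seminorm.sSup_apply A.bddAbove_cstarSeminorms]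
  exact ciSup_le fun p => h p p.2

theorem isCStarSeminorm_universalSeminorm : IsCStarSeminorm A.universalSeminorm where
  mul_le f g := A.universalSeminorm_le fun p hp =>
    (hp.1.mul_le f g).trans <| mul_le_mul (A.le_universalSeminorm hp f)
      (A.le_universalSeminorm hp g) (apply_nonneg p g) (apply_nonneg _ f)
  star_mul_self f := by
    refine le_antisymm (A.universalSeminorm_le fun p hp => ?_) ?_
    · rw [hp.1.star_mul_self]
      exact pow_le_pow_left₀ (apply_nonneg p f) (A.le_universalSeminorm hp f) 2
    · refine (Real.le_sqrt (apply_nonneg _ _) (apply_nonneg _ _)).1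
        (A.universalSeminorm_le fun p hp => Real.le_sqrt_of_sq_le ?_)
      rw [← hp.1.star_mul_self]
      exact A.le_universalSeminorm hp _

/-- The full cross-sectional C*-algebra `C*(A)`: the completion of the *-algebra of finitely
supported sections with respect to the universal C*-seminorm, that is, the enveloping C*-algebra
of `ℓ¹(A)`. -/
abbrev FullCStar : Type (max u v) := CStarCompletion A.isCStarSeminorm_universalSeminorm

end FellBundle

end

/-! Everything reduces to one algebra `D`: uniqueness of the C*-norm passes from `A_e ⊙ D` to `C*(A)
⊙ D` (`hasUniqueCStarNorm_fullCStar`, by the approximation property) and from `C*(A) ⊙ D` to `A_e ⊙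
D` (`hasUniqueCStarNorm_fiber_one`). Taking `D` arbitrary gives nuclearity; applying the transfer in
each tensor factor, with a flip in between, gives the equivalence.

C*-seminorms are built from positive functionals without Hilbert spaces: the seminorm of a set of
functionals is the best constant bounding left multiplication on all their GNS semi-inner products.
All positive functionals give the maximal norm, products of positive functionals the spatial norm.
The spatial norm is the least C*-norm (Takesaki): `IsCStarNorm.norm_sliceRight_le_of_mem` shows, by
excision and purity, that slicing by a pure functional is contractive on selfadjoint elements for
every C*-norm, so product functionals are bounded for every C*-norm.

Going down: `x ↦ x(e)` extends to a conditional expectation `E` of `C*(A)` onto `A_e`, and `E ⊗ id`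
pulls positive functionals that are bounded for a C*-seminorm back to positive functionals, because
the matrices `(a_k* a_l)` over a fiber are positive. Hence each C*-norm on `A_e ⊙ D` lies between
the restrictions of the spatial and the maximal norm of `C*(A) ⊙ D`.

Going up: let `p` be a C*-norm on `C*(A) ⊙ D` and let `x` be a section with coefficients in `D`. As
`x_t* x_t` lies in `A_e ⊙ D`, uniqueness there gives `p(x_t) ≤ min(x)`. For a `p`-contractive
positive `f` and `a : G → A_e` of finite support, the compression `∑ f(y* a(s)* x_{s r⁻¹} a(r) y)`
is a vector functional of a regular representation on `ℓ²(G)` with values in the GNS space of `f`.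
It is therefore bounded for the spatial norm and obeys a Cauchy–Schwarz inequality, and repeated
squaring improves the bound to `‖∑ a(r)* a(r)‖ f(y* y) min(x)`. Along the approximating net the
compressions converge to `f(y* x y)`, so `p ≤ √M · min`; squaring repeatedly once more removes `√M`.
-/

noncomputable section

open scoped ComplexOrder

/-! ### Positive functionals and their GNS seminorms -/

section PositiveFunctionals

variable {E : Type*} [NonUnitalRing E] [Module ℂ E] [StarRing E]

/-- A linear functional on a *-algebra is positive if it is nonnegative on all `x* x`. -/
def IsPosFunctional (f : E →ₗ[ℂ] ℂ) : Prop := ∀ x, 0 ≤ f (star x * x)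

namespace IsPosFunctional

variable {f : E →ₗ[ℂ] ℂ}

theorem re_nonneg (hf : IsPosFunctional f) (x : E) : 0 ≤ (f (star x * x)).re :=
  (Complex.nonneg_iff.1 (hf x)).1

theorem im_eq_zero (hf : IsPosFunctional f) (x : E) : (f (star x * x)).im = 0 :=
  (Complex.nonneg_iff.1 (hf x)).2.symm

theorem ofReal_re (hf : IsPosFunctional f) (x : E) :
    ((f (star x * x)).re : ℂ) = f (star x * x) :=
  Complex.ext rfl (hf.im_eq_zero x).symm

theorem norm_eq_re (hf : IsPosFunctional f) (x : E) :
    ‖f (star x * x)‖ = (f (star x * x)).re := by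
  rw [← hf.ofReal_re, Complex.norm_real, Real.norm_of_nonneg (hf.re_nonneg x), Complex.ofReal_re]

variable [IsScalarTower ℂ E E] [SMulCommClass ℂ E E] [StarModule ℂ E]

theorem conj_apply (hf : IsPosFunctional f) (x y : E) :
    (starRingEnd ℂ) (f (star y * x)) = f (star x * y) := by
  have h1 := hf.im_eq_zero (x + y)
  have h2 := hf.im_eq_zero (x + Complex.I • y)
  have hx := hf.im_eq_zero x
  have hy := hf.im_eq_zero y
  simp only [star_add, star_smul, add_mul, mul_add, map_add, smul_mul_assoc, mul_smul_comm,
    map_smul, smul_eq_mul, Complex.add_im, Complex.mul_im, Complex.mul_re,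
    RCLike.star_def, Complex.conj_I, Complex.neg_re, Complex.neg_im, Complex.I_re, Complex.I_im]
    at h1 h2
  apply Complex.ext
  · simp only [Complex.conj_re]; linarith
  · simp only [Complex.conj_im]; linarith

/-- The semi-inner product `(x, y) ↦ f (x* y)`. -/
abbrev core (hf : IsPosFunctional f) : PreInnerProductSpace.Core ℂ E where
  inner x y := f (star x * y)
  conj_inner_symm x y := hf.conj_apply x y
  re_inner_nonneg x := hf.re_nonneg x
  add_left x y z := by simp [add_mul]
  smul_left x y c := by simp [smul_mul_assoc]

theorem norm_sq_le (hf : IsPosFunctional f) (x y : E) :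
    ‖f (star x * y)‖ ^ 2 ≤ (f (star x * x)).re * (f (star y * y)).re := by
  have h := @InnerProductSpace.Core.inner_mul_inner_self_le ℂ E _ _ _ hf.core x y
  have e : ‖f (star y * x)‖ = ‖f (star x * y)‖ := by
    rw [← hf.conj_apply x y, RCLike.norm_conj]
  change ‖f (star x * y)‖ * ‖f (star y * x)‖ ≤ _ at h
  rw [e, ← sq] at h
  exact h

end IsPosFunctional

/-- The length `f (y* y) ^ (1 / 2)` of `y` in the GNS space of `f`. -/
def gnsLength (f : E →ₗ[ℂ] ℂ) (y : E) : ℝ := √(f (star y * y)).re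

theorem gnsLength_nonneg (f : E →ₗ[ℂ] ℂ) (y : E) : 0 ≤ gnsLength f y := Real.sqrt_nonneg _

theorem IsPosFunctional.gnsLength_sq {f : E →ₗ[ℂ] ℂ} (hf : IsPosFunctional f) (y : E) :
    gnsLength f y ^ 2 = (f (star y * y)).re := Real.sq_sqrt (hf.re_nonneg y)

/-- `C` bounds the operator of left multiplication by `x` in the GNS spaces of the functionals
in `F`. -/
def IsGNSBound (F : Set (E →ₗ[ℂ] ℂ)) (x : E) (C : ℝ) : Prop :=
  0 ≤ C ∧ ∀ f ∈ F, ∀ y, gnsLength f (x * y) ≤ C * gnsLength f y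

/-- The infimum is attained: divide by the length of `y`. Where that length vanishes, any single
bound already forces `x * y` to have length zero. -/
theorem isGNSBound_sInf {F : Set (E →ₗ[ℂ] ℂ)} {x : E} (hb : ∃ C, IsGNSBound F x C) :
    IsGNSBound F x (sInf {C | IsGNSBound F x C}) := by
  refine ⟨le_csInf hb fun C hC => hC.1, fun f hf y => ?_⟩
  rcases (gnsLength_nonneg f y).eq_or_lt with h | h
  · obtain ⟨C, hC⟩ := hb
    simpa [← h] using hC.2 f hf y
  · rw [← div_le_iff₀ h]
    exact le_csInf hb fun C hC => (div_le_iff₀ h).2 (hC.2 f hf y)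

variable [IsScalarTower ℂ E E] [SMulCommClass ℂ E E] [StarModule ℂ E]

theorem IsPosFunctional.norm_le_gnsLength {f : E →ₗ[ℂ] ℂ} (hf : IsPosFunctional f) (x y : E) :
    ‖f (star x * y)‖ ≤ gnsLength f x * gnsLength f y := by
  refine le_of_pow_le_pow_left₀ two_ne_zero
    (mul_nonneg (gnsLength_nonneg _ _) (gnsLength_nonneg _ _)) ?_
  rw [mul_pow, hf.gnsLength_sq, hf.gnsLength_sq]
  exact hf.norm_sq_le x y

theorem gnsLength_smul (f : E →ₗ[ℂ] ℂ) (c : ℂ) (y : E) :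
    gnsLength f (c • y) = ‖c‖ * gnsLength f y := by
  have : f (star (c • y) * (c • y)) = ((‖c‖ ^ 2 : ℝ) : ℂ) * f (star y * y) := by
    simp only [star_smul, smul_mul_assoc, mul_smul_comm, map_smul, smul_eq_mul]
    rw [← mul_assoc, RCLike.star_def, Complex.mul_conj']
    push_cast; ring
  rw [gnsLength, this, Complex.re_ofReal_mul, Real.sqrt_mul (sq_nonneg _),
    Real.sqrt_sq (norm_nonneg _), gnsLength]

theorem IsPosFunctional.gnsLength_add_le {f : E →ₗ[ℂ] ℂ} (hf : IsPosFunctional f) (x y : E) :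
    gnsLength f (x + y) ≤ gnsLength f x + gnsLength f y := by
  refine le_of_pow_le_pow_left₀ two_ne_zero
    (add_nonneg (gnsLength_nonneg _ _) (gnsLength_nonneg _ _)) ?_
  have h1 := (Complex.re_le_norm _).trans (hf.norm_le_gnsLength x y)
  have h2 := (Complex.re_le_norm _).trans (hf.norm_le_gnsLength y x)
  have h3 : (f (star (x + y) * (x + y))).re
      = (f (star x * x)).re + (f (star y * y)).re + (f (star x * y)).re + (f (star y * x)).re := by
    simp only [star_add, add_mul, mul_add, map_add, Complex.add_re]; ring
  rw [hf.gnsLength_sq, h3, ← hf.gnsLength_sq, ← hf.gnsLength_sq]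
  nlinarith

/-- The seminorm of the direct sum of the GNS representations of the functionals in `F`. -/
def gnsSeminorm (F : Set (E →ₗ[ℂ] ℂ)) (hF : ∀ f ∈ F, IsPosFunctional f)
    (hb : ∀ x, ∃ C, IsGNSBound F x C) : Seminorm ℂ E :=
  Seminorm.ofSMulLE (fun x => sInf {C | IsGNSBound F x C})
    (le_antisymm (csInf_le ⟨0, fun C hC => hC.1⟩ ⟨le_rfl, fun f _ y => by
      simp [gnsLength]⟩) (isGNSBound_sInf (hb 0)).1)
    (fun x y => csInf_le ⟨0, fun C hC => hC.1⟩
      ⟨add_nonneg (isGNSBound_sInf (hb x)).1 (isGNSBound_sInf (hb y)).1, fun f hf z => by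
        rw [add_mul, add_mul]
        exact ((hF f hf).gnsLength_add_le _ _).trans
          (add_le_add ((isGNSBound_sInf (hb x)).2 f hf z) ((isGNSBound_sInf (hb y)).2 f hf z))⟩)
    (fun c x => csInf_le ⟨0, fun C hC => hC.1⟩
      ⟨mul_nonneg (norm_nonneg c) (isGNSBound_sInf (hb x)).1, fun f hf z => by
        rw [smul_mul_assoc, gnsLength_smul, mul_assoc]
        exact mul_le_mul_of_nonneg_left ((isGNSBound_sInf (hb x)).2 f hf z) (norm_nonneg c)⟩)

section

variable {F : Set (E →ₗ[ℂ] ℂ)} (hF : ∀ f ∈ F, IsPosFunctional f)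
  (hb : ∀ x, ∃ C, IsGNSBound F x C)

theorem isGNSBound_gnsSeminorm (x : E) : IsGNSBound F x (gnsSeminorm F hF hb x) :=
  isGNSBound_sInf (hb x)

theorem gnsSeminorm_le {x : E} {C : ℝ} (h : IsGNSBound F x C) : gnsSeminorm F hF hb x ≤ C :=
  csInf_le ⟨0, fun _ hC => hC.1⟩ h

theorem gnsLength_mul_le {f : E →ₗ[ℂ] ℂ} (hf : f ∈ F) (x y : E) :
    gnsLength f (x * y) ≤ gnsSeminorm F hF hb x * gnsLength f y :=
  (isGNSBound_gnsSeminorm hF hb x).2 f hf y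

/-- Bounds compose, hence submultiplicativity. Writing `f((xy)* (xy)) = f(y* (x* x y))`,
Cauchy–Schwarz gives `p(x)² ≤ p(x* x)`. The two together give `p(x) ≤ p(x*)`, whence the reverse
inequality. -/
theorem isCStarSeminorm_gnsSeminorm : IsCStarSeminorm (gnsSeminorm F hF hb) := by
  have hmul : ∀ x y, gnsSeminorm F hF hb (x * y)
      ≤ gnsSeminorm F hF hb x * gnsSeminorm F hF hb y := fun x y =>
    gnsSeminorm_le hF hb ⟨mul_nonneg (apply_nonneg _ _) (apply_nonneg _ _), fun f hf z => by
      rw [mul_assoc, mul_assoc]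
      exact (gnsLength_mul_le hF hb hf x (y * z)).trans
        (mul_le_mul_of_nonneg_left (gnsLength_mul_le hF hb hf y z) (apply_nonneg _ _))⟩
  have hsq : ∀ x, gnsSeminorm F hF hb x ^ 2 ≤ gnsSeminorm F hF hb (star x * x) := fun x => by
    rw [← Real.le_sqrt (apply_nonneg _ _) (apply_nonneg _ _)]
    refine gnsSeminorm_le hF hb ⟨Real.sqrt_nonneg _, fun f hf y => ?_⟩
    refine le_of_pow_le_pow_left₀ two_ne_zero
      (mul_nonneg (Real.sqrt_nonneg _) (gnsLength_nonneg _ _)) ?_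
    rw [mul_pow, Real.sq_sqrt (apply_nonneg _ _), (hF f hf).gnsLength_sq]
    have e : star (x * y) * (x * y) = star y * (star x * x * y) := by
      simp only [star_mul, mul_assoc]
    rw [e]
    refine (Complex.re_le_norm _).trans (((hF f hf).norm_le_gnsLength _ _).trans ?_)
    have := gnsLength_mul_le hF hb hf (star x * x) y
    nlinarith [gnsLength_nonneg f y]
  have hle : ∀ x, gnsSeminorm F hF hb x ≤ gnsSeminorm F hF hb (star x) := fun x => by
    rcases (apply_nonneg (gnsSeminorm F hF hb) x).eq_or_lt with h | h
    · rw [← h]; exact apply_nonneg _ _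
    · exact le_of_mul_le_mul_right (by nlinarith [hsq x, hmul (star x) x]) h
  refine ⟨hmul, fun x => le_antisymm ?_ (hsq x)⟩
  have := hle (star x)
  rw [star_star] at this
  rw [sq]
  exact (hmul _ _).trans (mul_le_mul_of_nonneg_right this (apply_nonneg _ _))

end

end PositiveFunctionals

/-! ### Removing constants from estimates by C*-seminorms -/

section PowerTrick

/-- If `a > b > 0`, the powers of `a / b` would be unbounded, yet those with exponent `2 ^ n` are at
most `K`. -/
theorem le_of_pow_two_pow_le {a b K : ℝ} (hb : 0 ≤ b)
    (h : ∀ n : ℕ, a ^ 2 ^ n ≤ K * b ^ 2 ^ n) : a ≤ b := by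
  by_contra! hab
  rcases hb.eq_or_lt with h0 | h0
  · subst h0
    have h1 := h 0
    simp only [pow_zero, pow_one, mul_zero] at h1
    linarith
  · have h1 : 1 < a / b := (one_lt_div h0).2 hab
    obtain ⟨n, hn⟩ := pow_unbounded_of_one_lt K h1
    have h2 : (a / b) ^ n ≤ (a / b) ^ 2 ^ n :=
      pow_le_pow_right₀ h1.le (Nat.lt_two_pow_self).le
    have h3 : (a / b) ^ 2 ^ n ≤ K := by
      rw [div_pow, div_le_iff₀ (pow_pos h0 _)]
      exact h n
    linarith

variable {E : Type*} [NonUnitalRing E] [Module ℂ E] [StarRing E]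

/-- The sequence `z, z* z, (z* z)* (z* z), …`. -/
def starSquare (z : E) : ℕ → E
  | 0 => z
  | n + 1 => star (starSquare z n) * starSquare z n

theorem IsCStarSeminorm.starSquare {q : Seminorm ℂ E} (hq : IsCStarSeminorm q) (z : E) (n : ℕ) :
    q (starSquare z n) = q z ^ 2 ^ n := by
  induction n with
  | zero => simp [_root_.starSquare]
  | succ n ih => rw [_root_.starSquare, hq.star_mul_self, ih, ← pow_mul, pow_succ]

/-- A function satisfying the inequality of Cauchy and Schwarz that is bounded with respect to a
C*-seminorm satisfies the bound with the constant `c`. -/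
theorem IsCStarSeminorm.norm_le_of_norm_sq_le {q : Seminorm ℂ E} (hq : IsCStarSeminorm q)
    {g : E → ℂ} {c K : ℝ} (hc : 0 ≤ c) (h : ∀ z, ‖g z‖ ^ 2 ≤ c * ‖g (star z * z)‖)
    (hK : ∀ z, ‖g z‖ ≤ K * q z) (z : E) : ‖g z‖ ≤ c * q z := by
  rcases hc.eq_or_lt with h0 | h0
  · subst h0
    have := h z
    rw [zero_mul] at this ⊢
    exact (pow_eq_zero_iff two_ne_zero).1 (le_antisymm this (sq_nonneg _)) |>.le
  -- Along iterated star-squares the hypothesis `h` squares `‖g‖ / c` at each step, while `q`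
  -- squares exactly; the crude constant `K` then disappears on taking roots.
  · have key : ∀ n : ℕ, (‖g z‖ / c) ^ 2 ^ n ≤ ‖g (_root_.starSquare z n)‖ / c := by
      intro n
      induction n with
      | zero => simp [_root_.starSquare]
      | succ n ih =>
        rw [pow_succ, pow_mul]
        refine (pow_le_pow_left₀ (by positivity) ih 2).trans ?_
        rw [div_pow, div_le_div_iff₀ (by positivity) h0]
        have := h (_root_.starSquare z n)
        rw [_root_.starSquare]
        nlinarith
    have h2 : ‖g z‖ / c ≤ q z := by
      refine le_of_pow_two_pow_le (K := K / c) (apply_nonneg _ _) fun n => ?_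
      refine (key n).trans ?_
      rw [← hq.starSquare, div_mul_eq_mul_div]
      gcongr
      exact hK _
    rw [div_le_iff₀ h0] at h2
    linarith

/-- Comparable C*-seminorms can be compared with the constant `1`. -/
theorem IsCStarSeminorm.le_of_le_mul {p q : Seminorm ℂ E} (hp : IsCStarSeminorm p)
    (hq : IsCStarSeminorm q) {K : ℝ} (h : ∀ z, p z ≤ K * q z) (z : E) : p z ≤ q z :=
  le_of_pow_two_pow_le (apply_nonneg _ _) fun n => by
    rw [← hp.starSquare, ← hq.starSquare]; exact h _

end PowerTrick

/-! ### Positive functionals on C*-algebras -/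

section CStarFunctionals

open Filter Topology

variable {A : Type*} [NonUnitalCStarAlgebra A]

/-- For a contraction `a` the element `h = 1 - (1 - a* a) ^ (1 / 2)` satisfies
`(1 - h) ^ 2 = 1 - a* a`. -/
theorem exists_add_sub_mul_self_eq {a : A} (ha : ‖a‖ ≤ 1) :
    ∃ h : A, star h = h ∧ h + h - h * h = star a * a := by
  let _ := CStarAlgebra.spectralOrder A
  have := CStarAlgebra.spectralOrderedRing A
  have h0 : 0 ≤ star a * a := star_mul_self_nonneg a
  have hsa : IsSelfAdjoint (star a * a) := .star_mul_self a
  have hn : ‖star a * a‖ ≤ 1 := by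
    rw [CStarRing.norm_star_mul_self]; nlinarith [norm_nonneg a]
  let k : ℝ → ℝ := fun t => 1 - √(1 - t)
  have hk : Continuous k := by fun_prop
  have hk0 : k 0 = 0 := by simp [k]
  refine ⟨cfcₙ k (star a * a), (cfcₙ_predicate k (star a * a)).star_eq, ?_⟩
  rw [← cfcₙ_add .., ← cfcₙ_mul .., ← cfcₙ_sub ..]
  conv_rhs => rw [← cfcₙ_id' ℝ (star a * a)]
  refine cfcₙ_congr fun t ht => ?_
  have ht1 : t ≤ 1 := (le_abs_self t).trans
    ((NonUnitalIsometricContinuousFunctionalCalculus.norm_quasispectrum_le (star a * a) ht).trans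
      hn)
  have : √(1 - t) ^ 2 = 1 - t := Real.sq_sqrt (by linarith)
  simp only [k]
  linarith

theorem LinearIsometry.exists_extension {X Y : Type*} [NormedAddCommGroup X] [NormedSpace ℂ X]
    [NormedAddCommGroup Y] [NormedSpace ℂ Y] (T : X →ₗᵢ[ℂ] Y) (f : X →L[ℂ] ℂ) :
    ∃ g : Y →L[ℂ] ℂ, (∀ x, g (T x) = f x) ∧ ‖g‖ ≤ ‖f‖ := by
  obtain ⟨g, hg, hn⟩ := exists_extension_norm_eq (LinearMap.range T.toLinearMap)
    (f.comp (T.equivRange.symm : LinearMap.range T.toLinearMap →L[ℂ] X))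
  refine ⟨g, fun x => ?_, ?_⟩
  · have := hg (T.equivRange x)
    simpa using this
  · rw [hn]
    refine ContinuousLinearMap.opNorm_le_bound _ (norm_nonneg f) fun y => ?_
    simpa using f.le_opNorm (T.equivRange.symm y)

/-! ### Functionals on unital C*-algebras. -/

section Unital

variable {B : Type*} [CStarAlgebra B]

/-- For `z ≥ 0` the estimate `‖‖z‖ - z‖ ≤ ‖z‖` gives `Re F(z) ≥ 0`. The imaginary part vanishes
because `z + it` has norm squared at most `‖z‖² + t²` for all real `t`. -/
theorem isPosFunctional_of_map_one [Nontrivial B] {F : B →L[ℂ] ℂ} (hF : ‖F‖ ≤ 1) (h1 : F 1 = 1) :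
    IsPosFunctional (F : B →ₗ[ℂ] ℂ) := by
  intro x
  let _ := CStarAlgebra.spectralOrder B
  have := CStarAlgebra.spectralOrderedRing B
  have hz : 0 ≤ star x * x := star_mul_self_nonneg x
  have hsa : IsSelfAdjoint (star x * x) := .star_mul_self x
  generalize star x * x = z at hz hsa ⊢
  have hFle : ∀ y, ‖F y‖ ≤ ‖y‖ := fun y => by
    simpa using F.le_of_opNorm_le hF y
  have e1 : ∀ r : ℝ, (algebraMap ℝ B r) = (r : ℂ) • (1 : B) := fun r => by
    rw [Algebra.algebraMap_eq_smul_one]; simp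
  have hN : ‖algebraMap ℝ B ‖z‖ - z‖ ≤ ‖z‖ := by
    rw [CStarAlgebra.norm_le_iff_le_algebraMap _ (norm_nonneg z)
      (sub_nonneg.2 hsa.le_algebraMap_norm_self)]
    exact sub_le_self _ hz
  have h2 := (hFle _).trans hN
  rw [map_sub, e1, map_smul, h1, smul_eq_mul, mul_one] at h2
  have hre : 0 ≤ (F z).re := by
    have := (Complex.abs_re_le_norm _).trans h2
    rw [Complex.sub_re, Complex.ofReal_re] at this
    linarith [(abs_le.1 this).2]
  have him : ∀ t : ℝ, ((F z).im + t) ^ 2 ≤ ‖z‖ ^ 2 + t ^ 2 := by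
    intro t
    let y : B := z + (t * Complex.I) • (1 : B)
    have hy : star y * y = z * z + ((t ^ 2 : ℝ) : ℂ) • (1 : B) := by
      have e2 : star y = z - (t * Complex.I) • (1 : B) := by
        simp [y, hsa.star_eq, star_smul, sub_eq_add_neg]
      rw [e2]
      simp only [y, sub_mul, mul_add, smul_mul_assoc, mul_smul_comm, one_mul, mul_one, smul_sub,
        smul_smul]
      have e3 : (t * Complex.I) * (t * Complex.I) = -((t ^ 2 : ℝ) : ℂ) := by
        push_cast; ring_nf; simp
      rw [e3]
      module
    have h3 : ‖y‖ ^ 2 ≤ ‖z‖ ^ 2 + t ^ 2 := by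
      rw [sq, ← CStarRing.norm_star_mul_self, hy]
      refine (norm_add_le _ _).trans (add_le_add ((norm_mul_le _ _).trans (sq _).ge) ?_)
      rw [norm_smul, norm_one, mul_one, Complex.norm_real, Real.norm_of_nonneg (sq_nonneg t)]
    have h4 : (F y).im = (F z).im + t := by
      simp [y, h1]
    have h5 := (Complex.abs_im_le_norm _).trans (hFle y)
    rw [h4] at h5
    rw [← sq_abs]
    exact (pow_le_pow_left₀ (abs_nonneg _) h5 2).trans h3
  have him0 : (F z).im = 0 := by
    by_contra h
    -- This `t` makes the cross term `2 t Im F(z)` equal to `‖z‖² + 1`, which exceeds the allowed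
    -- `‖z‖²`.
    have h6 := him ((‖z‖ ^ 2 + 1) / (2 * (F z).im))
    have e4 : ((F z).im + (‖z‖ ^ 2 + 1) / (2 * (F z).im)) ^ 2
        = (F z).im ^ 2 + (‖z‖ ^ 2 + 1) + ((‖z‖ ^ 2 + 1) / (2 * (F z).im)) ^ 2 := by
      field_simp; ring
    rw [e4] at h6
    nlinarith [sq_nonneg (F z).im]
  exact Complex.nonneg_iff.2 ⟨hre, him0.symm⟩

/-- Since `‖a‖` is a spectral value, `a + ‖a‖` has norm `2‖a‖`. A contractive functional that norms
this sum has to attain the largest possible value at `a` and at `1` separately. -/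
theorem exists_map_one_of_norm_mem_spectrum [Nontrivial B] {a : B} (ha : ‖a‖ ∈ spectrum ℝ a) :
    ∃ F : B →L[ℂ] ℂ, ‖F‖ ≤ 1 ∧ F 1 = 1 ∧ F a = ‖a‖ := by
  rcases eq_or_ne a 0 with rfl | h0
  · obtain ⟨F, hF, h1⟩ := exists_dual_vector'' ℂ (1 : B)
    exact ⟨F, hF, by simpa using h1, by simp⟩
  · have hpos : 0 < ‖a‖ := norm_pos_iff.2 h0
    have h2 : ‖a + algebraMap ℝ B ‖a‖‖ = 2 * ‖a‖ := by
      refine le_antisymm ((norm_add_le _ _).trans ?_) ?_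
      · rw [norm_algebraMap']; simp; linarith
      · have : ‖a‖ + ‖a‖ ∈ spectrum ℝ (a + algebraMap ℝ B ‖a‖) := by
          rw [add_comm a]; exact spectrum.add_mem_add_iff.2 ha
        have := spectrum.norm_le_norm_of_mem this
        rw [Real.norm_of_nonneg (by positivity)] at this
        linarith
    obtain ⟨F, hF, hx⟩ := exists_dual_vector'' ℂ (a + algebraMap ℝ B ‖a‖)
    have hFle : ∀ y, ‖F y‖ ≤ ‖y‖ := fun y => by simpa using F.le_of_opNorm_le hF y
    have e1 : algebraMap ℝ B ‖a‖ = (‖a‖ : ℂ) • (1 : B) := by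
      rw [Algebra.algebraMap_eq_smul_one]; simp
    rw [h2, map_add, e1, map_smul, smul_eq_mul] at hx
    have ha1 := hFle a
    have h11 := hFle 1
    rw [norm_one] at h11
    have key : ∀ (z : ℂ) (r : ℝ), ‖z‖ ≤ r → r ≤ z.re → z = r := by
      intro z r hz hr
      have h3 : z.re = r := le_antisymm ((Complex.re_le_norm z).trans hz) hr
      have h4 : z.re ^ 2 + z.im ^ 2 = ‖z‖ ^ 2 := by
        rw [← Complex.normSq_eq_norm_sq, Complex.normSq_apply]; ring
      have h5 : z.im = 0 := by
        have : ‖z‖ ^ 2 ≤ r ^ 2 := pow_le_pow_left₀ (norm_nonneg z) hz 2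
        rw [h3] at h4
        exact pow_eq_zero_iff two_ne_zero |>.1 (le_antisymm (by linarith) (sq_nonneg _))
      exact Complex.ext (by simpa using h3) (by simpa using h5)
    have hre : (F a).re + ‖a‖ * (F 1).re = 2 * ‖a‖ := by
      have := congrArg Complex.re hx
      rw [Complex.add_re, Complex.re_ofReal_mul] at this
      exact this
    have b1 := (Complex.re_le_norm _).trans ha1
    have b2 := (Complex.re_le_norm _).trans h11
    refine ⟨F, hF, ?_, key _ _ ha1 ?_⟩
    · have := key (F 1) 1 h11 (by
        by_contra! h
        nlinarith)
      simpa using this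
    · nlinarith

end Unital

theorem isPosFunctional_comp_inr {F : Unitization ℂ A →L[ℂ] ℂ}
    (hF : IsPosFunctional (F : Unitization ℂ A →ₗ[ℂ] ℂ)) {f : A →L[ℂ] ℂ}
    (h : ∀ a : A, f a = F a) : IsPosFunctional (f : A →ₗ[ℂ] ℂ) := fun x => by
  have := hF (x : Unitization ℂ A)
  simp only [ContinuousLinearMap.coe_coe] at this ⊢
  rw [h, Unitization.inr_mul, Unitization.inr_star]
  exact this

/-- The embedding of a C*-algebra in its unitization, as a linear isometry. -/
def inrIsometry (A : Type*) [NonUnitalCStarAlgebra A] : A →ₗᵢ[ℂ] Unitization ℂ A where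
  toFun a := a
  map_add' := by simp
  map_smul' := by simp
  norm_map' a := Unitization.norm_inr a

/-- A contractive functional which almost attains the value `1` at elements `k* k` of the unit
ball is positive. -/
theorem isPosFunctional_of_norm_le_one {F : A →L[ℂ] ℂ} (hF : ‖F‖ ≤ 1)
    (h : ∀ ε > 0, ∃ k : A, ‖k‖ ≤ 1 ∧ ‖F (star k * k) - 1‖ ≤ ε) :
    IsPosFunctional (F : A →ₗ[ℂ] ℂ) := by
  obtain ⟨g, hg, hn⟩ := (inrIsometry A).exists_extension F
  have hg' : ∀ a : A, g a = F a := hg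
  refine isPosFunctional_comp_inr (isPosFunctional_of_map_one (hn.trans hF) ?_)
    fun a => (hg' a).symm
  have hgle : ∀ y, ‖g y‖ ≤ ‖y‖ := fun y => by simpa using g.le_of_opNorm_le (hn.trans hF) y
  -- For `0 ≤ z ≤ 1` the element `2z - 1` is a contraction. As `F(k* k)` approaches `1`, this yields
  -- `|2 - g(1)| ≤ 1`; together with `|g(1)| ≤ 1` it forces `g(1) = 1`.
  have h2 : ∀ k : A, ‖k‖ ≤ 1 → ‖2 * F (star k * k) - g 1‖ ≤ 1 := by
    intro k hk
    let _ := CStarAlgebra.spectralOrder (Unitization ℂ A)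
    have := CStarAlgebra.spectralOrderedRing (Unitization ℂ A)
    have hz : 0 ≤ ((star k * k : A) : Unitization ℂ A) := by
      rw [Unitization.inr_mul, Unitization.inr_star]; exact star_mul_self_nonneg _
    have hz1 : ((star k * k : A) : Unitization ℂ A) ≤ 1 := by
      rw [← CStarAlgebra.norm_le_one_iff_of_nonneg _ hz, Unitization.norm_inr,
        CStarRing.norm_star_mul_self]
      nlinarith [norm_nonneg k]
    rw [← hg', two_mul, ← map_add, ← map_sub]
    refine (hgle _).trans ?_
    generalize ((star k * k : A) : Unitization ℂ A) = z at hz hz1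
    have : z + z - 1 ∈ Set.Icc (-algebraMap ℝ _ 1) (algebraMap ℝ (Unitization ℂ A) 1) := by
      rw [map_one]
      refine ⟨?_, ?_⟩
      · rw [neg_le_sub_iff_le_add]
        have := add_nonneg hz hz
        simpa using this
      · rw [sub_le_iff_le_add]; exact add_le_add hz1 hz1
    have hsa : IsSelfAdjoint (z + z - 1) :=
      ((IsSelfAdjoint.of_nonneg hz).add (.of_nonneg hz)).sub (.one _)
    rw [Set.mem_Icc] at this
    rw [map_one] at this
    rcases CStarAlgebra.norm_or_neg_norm_mem_spectrum hsa with h6 | h6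
    · have := (le_algebraMap_iff_spectrum_le (r := (1 : ℝ)) (a := z + z - 1) hsa).1
        (by simpa using this.2) _ h6
      exact this
    · have := (algebraMap_le_iff_le_spectrum (r := (-1 : ℝ)) (a := z + z - 1) hsa).1
        (by simpa using this.1) _ h6
      linarith
  have hg1 : ‖g 1‖ ≤ 1 := by simpa using hgle 1
  have h3 : ∀ ε > 0, ‖2 - g 1‖ ≤ 1 + 2 * ε := by
    intro ε hε
    obtain ⟨k, hk, hk'⟩ := h ε hε
    have e : 2 - g 1 = (2 * F (star k * k) - g 1) - 2 * (F (star k * k) - 1) := by ring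
    rw [e]
    refine (norm_sub_le _ _).trans (add_le_add (h2 k hk) ?_)
    rw [norm_mul]; simpa using hk'
  have h4 : ‖2 - g 1‖ ≤ 1 := le_of_forall_pos_le_add fun ε hε => by
    have := h3 (ε / 2) (by positivity); linarith
  have hre1 := (Complex.abs_re_le_norm _).trans hg1
  have hre2 := (Complex.abs_re_le_norm _).trans h4
  rw [Complex.sub_re] at hre2
  have hr : (g 1).re = 1 := by
    have e2 : (2 : ℂ).re = 2 := rfl
    rw [e2] at hre2
    linarith [abs_le.1 hre1, abs_le.1 hre2]
  have hi : (g 1).im = 0 := by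
    have h6 : (g 1).re ^ 2 + (g 1).im ^ 2 = ‖g 1‖ ^ 2 := by
      rw [← Complex.normSq_eq_norm_sq, Complex.normSq_apply]; ring
    rw [hr] at h6
    have : ‖g 1‖ ^ 2 ≤ 1 := pow_le_one₀ (norm_nonneg _) hg1
    exact pow_eq_zero_iff two_ne_zero |>.1 (le_antisymm (by linarith) (sq_nonneg _))
  exact Complex.ext (by simpa using hr) (by simpa using hi)

/-- A selfadjoint element or its negative is normed by a positive functional. -/
theorem exists_isPosFunctional_norming {b : A} (hb : IsSelfAdjoint b) :
    ∃ f : A →L[ℂ] ℂ, IsPosFunctional (f : A →ₗ[ℂ] ℂ) ∧ ‖f‖ ≤ 1 ∧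
      (f b = ‖b‖ ∨ f (-b) = ‖b‖) := by
  have key : ∀ c : A, ‖(c : Unitization ℂ A)‖ ∈ spectrum ℝ (c : Unitization ℂ A) →
      ∃ f : A →L[ℂ] ℂ, IsPosFunctional (f : A →ₗ[ℂ] ℂ) ∧ ‖f‖ ≤ 1 ∧ f c = ‖c‖ := by
    intro c hc
    obtain ⟨F, hF, h1, hFc⟩ := exists_map_one_of_norm_mem_spectrum hc
    refine ⟨F.comp (inrIsometry A).toContinuousLinearMap,
      isPosFunctional_comp_inr (isPosFunctional_of_map_one hF h1) fun a => rfl, ?_, ?_⟩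
    · refine ContinuousLinearMap.opNorm_le_bound _ zero_le_one fun a => ?_
      refine (F.le_of_opNorm_le hF _).trans ?_
      simp
    · rw [← Unitization.norm_inr (𝕜 := ℂ) c, ← hFc]; rfl
  have hsa : IsSelfAdjoint (b : Unitization ℂ A) := by
    rw [IsSelfAdjoint, ← Unitization.inr_star, hb.star_eq]
  rcases CStarAlgebra.norm_or_neg_norm_mem_spectrum hsa with h | h
  · obtain ⟨f, h1, h2, h3⟩ := key b h
    exact ⟨f, h1, h2, Or.inl h3⟩
  · obtain ⟨f, h1, h2, h3⟩ := key (-b) (by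
      rw [Unitization.inr_neg, norm_neg, ← spectrum.neg_eq, Set.mem_neg]; exact h)
    exact ⟨f, h1, h2, Or.inr (by rw [h3, norm_neg])⟩

/-- If the norming functional were attached to `-a* a` instead, positivity would make both `f(a* a)`
and `-f(a* a)` nonnegative, so that both sides are zero. -/
theorem exists_isPosFunctional_star_mul_self (a : A) :
    ∃ f : A →L[ℂ] ℂ, IsPosFunctional (f : A →ₗ[ℂ] ℂ) ∧ ‖f‖ ≤ 1 ∧
      f (star a * a) = (‖a‖ ^ 2 : ℝ) := by
  obtain ⟨f, h1, h2, h3⟩ := exists_isPosFunctional_norming (IsSelfAdjoint.star_mul_self a)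
  have e : ‖star a * a‖ = ‖a‖ ^ 2 := by rw [CStarRing.norm_star_mul_self, sq]
  rw [e] at h3
  refine ⟨f, h1, h2, h3.elim id fun h => ?_⟩
  have h4 := h1 a
  simp only [ContinuousLinearMap.coe_coe] at h4
  have h5 : (0 : ℂ) ≤ f (-(star a * a)) := by
    rw [h, Complex.zero_le_real]; positivity
  rw [map_neg] at h5 h
  have h6 : f (star a * a) = 0 := le_antisymm (neg_nonneg.1 h5) h4
  rw [h6, neg_zero] at h
  rw [h6, h]

end CStarFunctionals

/-! ### Pure functionals -/

section PureFunctionals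

open Filter Topology

variable {A : Type*} [NonUnitalCStarAlgebra A]

theorem IsPosFunctional.nonneg_of_nonneg [PartialOrder A] [StarOrderedRing A] {f : A →ₗ[ℂ] ℂ}
    (hf : IsPosFunctional f) {a : A} (ha : 0 ≤ a) : 0 ≤ f a := by
  obtain ⟨b, rfl⟩ := CStarAlgebra.nonneg_iff_eq_star_mul_self.1 ha
  exact hf b

/-- Monotonicity reduces this to a supremum over positive contractions. If that supremum were at
most `s < ‖f‖`, then `|f(ua)|² ≤ f(u²) f(a* a) ≤ s ‖f‖ ‖a‖²` would give `‖f‖² ≤ s ‖f‖`. The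
consequence needed is additivity of the norm on positive functionals. -/
theorem IsPosFunctional.tendsto_re [PartialOrder A] [StarOrderedRing A] {f : A →L[ℂ] ℂ}
    (hf : IsPosFunctional (f : A →ₗ[ℂ] ℂ)) :
    Tendsto (fun u => (f u).re) (CStarAlgebra.approximateUnit A) (𝓝 ‖f‖) := by
  have hl := CStarAlgebra.increasingApproximateUnit A
  have mono : ∀ {a b : A}, a ≤ b → (f a).re ≤ (f b).re := fun {a b} h => by
    have := hf.nonneg_of_nonneg (sub_nonneg.2 h)
    simp only [ContinuousLinearMap.coe_coe, map_sub] at this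
    have := (Complex.nonneg_iff.1 this).1
    rw [Complex.sub_re] at this
    linarith
  have hub : ∀ᶠ u in CStarAlgebra.approximateUnit A, (f u).re ≤ ‖f‖ := by
    filter_upwards [hl.eventually_norm] with u hu
    exact (Complex.re_le_norm _).trans ((f.le_opNorm u).trans
      (mul_le_of_le_one_right (norm_nonneg f) hu))
  have hlb : ∀ s < ‖f‖, ∀ᶠ u in CStarAlgebra.approximateUnit A, s < (f u).re := by
    intro s hs
    have hex : ∃ h : A, 0 ≤ h ∧ ‖h‖ < 1 ∧ s < (f h).re := by
      by_contra! hcon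
      rcases lt_or_ge s 0 with hs0 | hs0
      · exact absurd (hcon 0 le_rfl (by simp)) (by simpa using hs0)
      have hpos : 0 < ‖f‖ := hs0.trans_lt hs
      have hcon' : ∀ u : A, 0 ≤ u → ‖u‖ ≤ 1 → (f u).re ≤ s := by
        intro u hu hu1
        have ht : Tendsto (fun r : ℝ => (f (r • u)).re) (𝓝[<] 1) (𝓝 (f ((1 : ℝ) • u)).re) := by
          refine Tendsto.mono_left (Continuous.tendsto ?_ 1) nhdsWithin_le_nhds
          fun_prop
        rw [one_smul] at ht
        refine le_of_tendsto ht ?_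
        have : Set.Ioo (0 : ℝ) 1 ∈ 𝓝[<] (1 : ℝ) := Ioo_mem_nhdsLT one_pos
        filter_upwards [this] with r hr
        refine hcon _ (smul_nonneg hr.1.le hu) ?_
        rw [norm_smul, Real.norm_of_nonneg hr.1.le]
        nlinarith [hr.2, hr.1, norm_nonneg u]
      have hbound : ‖f‖ ≤ √(s * ‖f‖) := by
        refine ContinuousLinearMap.opNorm_le_bound _ (Real.sqrt_nonneg _) fun a => ?_
        have ht : Tendsto (fun u => ‖f (u * a)‖) (CStarAlgebra.approximateUnit A) (𝓝 ‖f a‖) :=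
          ((f.continuous.tendsto a).comp (hl.tendsto_mul_right a)).norm
        have := hl.neBot
        refine le_of_tendsto ht ?_
        filter_upwards [hl.eventually_norm, hl.eventually_nonneg] with u hu hu0
        have husa : star u = u := IsSelfAdjoint.of_nonneg hu0
        have h1 := hf.norm_sq_le u a
        simp only [ContinuousLinearMap.coe_coe] at h1
        have h2 : (f (star u * u)).re ≤ s := hcon' _ (star_mul_self_nonneg u) (by
          rw [CStarRing.norm_star_mul_self]; nlinarith [norm_nonneg u])
        have h3 : (f (star a * a)).re ≤ ‖f‖ * ‖a‖ ^ 2 := by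
          refine (Complex.re_le_norm _).trans ((f.le_opNorm _).trans ?_)
          rw [CStarRing.norm_star_mul_self, sq]
        rw [husa] at h1
        rw [husa] at h2
        have h4 : 0 ≤ (f (star a * a)).re := hf.re_nonneg a
        refine le_of_pow_le_pow_left₀ two_ne_zero
          (mul_nonneg (Real.sqrt_nonneg _) (norm_nonneg a)) ?_
        rw [mul_pow, Real.sq_sqrt (by positivity)]
        refine h1.trans ((mul_le_mul_of_nonneg_right h2 h4).trans ?_)
        rw [mul_assoc]
        exact mul_le_mul_of_nonneg_left h3 hs0
      have := Real.le_sqrt' hpos |>.1 hbound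
      nlinarith
    obtain ⟨h, h0, h1, h2⟩ := hex
    have := (CStarAlgebra.hasBasis_approximateUnit A).mem_of_mem (i := h) ⟨h0, h1⟩
    filter_upwards [this] with u hu
    exact h2.trans_le (mono hu.1)
  rw [tendsto_order]
  refine ⟨hlb, fun s hs => ?_⟩
  filter_upwards [hub] with u hu
  exact hu.trans_lt hs

theorem IsPosFunctional.norm_add {f g : A →L[ℂ] ℂ} (hf : IsPosFunctional (f : A →ₗ[ℂ] ℂ))
    (hg : IsPosFunctional (g : A →ₗ[ℂ] ℂ)) : ‖f + g‖ = ‖f‖ + ‖g‖ := by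
  let _ := CStarAlgebra.spectralOrder A
  have := CStarAlgebra.spectralOrderedRing A
  have hfg : IsPosFunctional ((f + g : A →L[ℂ] ℂ) : A →ₗ[ℂ] ℂ) := fun x => by
    simpa using add_nonneg (hf x) (hg x)
  have := (CStarAlgebra.increasingApproximateUnit A).neBot
  refine tendsto_nhds_unique hfg.tendsto_re ?_
  simpa using hf.tendsto_re.add hg.tendsto_re

/-- A positive functional almost attains its norm at elements `k* k` of the unit ball. -/
theorem IsPosFunctional.exists_norm_sub_le {f : A →L[ℂ] ℂ}
    (hf : IsPosFunctional (f : A →ₗ[ℂ] ℂ)) {ε : ℝ} (hε : 0 < ε) :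
    ∃ k : A, ‖k‖ ≤ 1 ∧ ‖f (star k * k) - ‖f‖‖ ≤ ε := by
  let _ := CStarAlgebra.spectralOrder A
  have := CStarAlgebra.spectralOrderedRing A
  have hl := CStarAlgebra.increasingApproximateUnit A
  have := hl.neBot
  have h1 := hf.tendsto_re.eventually (Metric.ball_mem_nhds _ hε)
  obtain ⟨u, hu, hu0, hu1⟩ := (h1.and (hl.eventually_nonneg.and hl.eventually_norm)).exists
  obtain ⟨k, rfl⟩ := CStarAlgebra.nonneg_iff_eq_star_mul_self.1 hu0
  rw [CStarRing.norm_star_mul_self] at hu1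
  refine ⟨k, by nlinarith [norm_nonneg k], ?_⟩
  have e : f (star k * k) = ((f (star k * k)).re : ℂ) := (hf.ofReal_re k).symm
  rw [e, ← Complex.ofReal_sub, Complex.norm_real]
  exact (Metric.mem_ball.1 hu).le

/-- A pure functional: a positive functional of norm `1` that dominates only its multiples. -/
structure IsPureFunctional (f : A →L[ℂ] ℂ) : Prop where
  pos : IsPosFunctional (f : A →ₗ[ℂ] ℂ)
  norm_eq_one : ‖f‖ = 1
  eq_smul : ∀ g : A →L[ℂ] ℂ, IsPosFunctional (g : A →ₗ[ℂ] ℂ) →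
    IsPosFunctional ((f - g : A →L[ℂ] ℂ) : A →ₗ[ℂ] ℂ) → ∃ c : ℂ, g = c • f

/-- If `0 ≤ g ≤ f`, the norms of `g` and `f - g` add up to `1` and their values at `b` add up to
`‖b‖`. When both are nonzero, their normalizations therefore lie in the same face, and `f` is a
convex combination of them. -/
theorem isPureFunctional_of_mem_extremePoints {b : A} (hb : b ≠ 0)
    {f : A →L[ℂ] ℂ} (hpos : IsPosFunctional (f : A →ₗ[ℂ] ℂ)) (hn : ‖f‖ ≤ 1) (hfb : f b = ‖b‖)
    (hext : ∀ g₁ g₂ : A →L[ℂ] ℂ, IsPosFunctional (g₁ : A →ₗ[ℂ] ℂ) →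
      IsPosFunctional (g₂ : A →ₗ[ℂ] ℂ) → ‖g₁‖ ≤ 1 → ‖g₂‖ ≤ 1 → g₁ b = ‖b‖ → g₂ b = ‖b‖ →
      ∀ t : ℝ, 0 < t → t < 1 → t • g₁ + (1 - t) • g₂ = f → g₁ = f) :
    IsPureFunctional f := by
  have hb0 : 0 < ‖b‖ := norm_pos_iff.2 hb
  have hn1 : ‖f‖ = 1 := by
    refine le_antisymm hn ?_
    have := f.le_opNorm b
    rw [hfb, Complex.norm_real, norm_norm] at this
    exact le_of_mul_le_mul_right (by linarith) hb0
  refine ⟨hpos, hn1, fun g hg hfg => ?_⟩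
  have hadd := hg.norm_add hfg
  rw [add_sub_cancel, hn1] at hadd
  rcases (norm_nonneg g).eq_or_lt with h0 | h0
  · exact ⟨0, by ext x; simp [norm_eq_zero.1 h0.symm]⟩
  rcases (norm_nonneg (f - g)).eq_or_lt with h1 | h1
  · exact ⟨1, by rw [one_smul]; exact (sub_eq_zero.1 (norm_eq_zero.1 h1.symm)).symm⟩
  have smul_pos : ∀ (k : A →L[ℂ] ℂ) (r : ℝ), 0 ≤ r → IsPosFunctional (k : A →ₗ[ℂ] ℂ) →
      IsPosFunctional ((r • k : A →L[ℂ] ℂ) : A →ₗ[ℂ] ℂ) := fun k r hr hk x => by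
    have := mul_nonneg (Complex.zero_le_real.2 hr) (hk x)
    simpa using this
  have hgb : (g b).re ≤ ‖g‖ * ‖b‖ := (Complex.re_le_norm _).trans (g.le_opNorm b)
  have hfgb : ((f - g) b).re ≤ ‖f - g‖ * ‖b‖ := (Complex.re_le_norm _).trans ((f - g).le_opNorm b)
  have hsum : (g b).re + ((f - g) b).re = ‖b‖ := by
    rw [← Complex.add_re, ← add_apply, add_sub_cancel, hfb, Complex.ofReal_re]
  have key : ∀ k : A →L[ℂ] ℂ, ‖k‖ * ‖b‖ ≤ (k b).re → k b = ((‖k‖ * ‖b‖ : ℝ) : ℂ) := by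
    intro k hk
    have h3 := k.le_opNorm b
    have h4 : (k b).re = ‖k‖ * ‖b‖ := le_antisymm ((Complex.re_le_norm _).trans h3) hk
    have h5 : (k b).re ^ 2 + (k b).im ^ 2 = ‖k b‖ ^ 2 := by
      rw [← Complex.normSq_eq_norm_sq, Complex.normSq_apply]; ring
    have h6 := pow_le_pow_left₀ (norm_nonneg _) h3 2
    rw [h4] at h5
    have : (k b).im = 0 :=
      pow_eq_zero_iff two_ne_zero |>.1 (le_antisymm (by linarith) (sq_nonneg _))
    exact Complex.ext (by simpa using h4) (by simpa using this)
  -- The upper bounds for `g b` and `(f - g) b` add up to exactly `‖b‖`, so neither can be strict.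
  have e1 : ‖f - g‖ = 1 - ‖g‖ := by linarith
  have kg := key g (by rw [e1] at hfgb; nlinarith)
  have kfg := key (f - g) (by rw [e1]; nlinarith)
  have hres := hext (‖g‖⁻¹ • g) (‖f - g‖⁻¹ • (f - g)) (smul_pos _ _ (by positivity) hg)
    (smul_pos _ _ (by positivity) hfg)
    (by rw [norm_smul, norm_inv, norm_norm, inv_mul_cancel₀ h0.ne'])
    (by rw [norm_smul, norm_inv, norm_norm, inv_mul_cancel₀ h1.ne'])
    (by
      rw [smul_apply, kg, Complex.real_smul, ← Complex.ofReal_mul,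
        inv_mul_cancel_left₀ h0.ne'])
    (by
      rw [smul_apply, kfg, Complex.real_smul, ← Complex.ofReal_mul,
        inv_mul_cancel_left₀ h1.ne'])
    ‖g‖ h0 (by linarith)
    (by rw [← e1, smul_inv_smul₀ h0.ne', smul_inv_smul₀ h1.ne', add_sub_cancel])
  refine ⟨(‖g‖ : ℂ), ?_⟩
  rw [← hres]
  ext x
  simp [h0.ne']

/-- Local convexity is what the existence of extreme points of weak-* compact sets requires. -/
instance : LocallyConvexSpace ℝ (WeakDual ℂ A) := by
  let T : WeakDual ℂ A →ₗ[ℝ] (A → ℂ) :=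
    { toFun := fun f x => f x
      map_add' := fun _ _ => rfl
      map_smul' := fun _ _ => rfl }
  exact Topology.IsInducing.locallyConvexSpace (f := T) ⟨rfl⟩

/-- Every nonzero selfadjoint element is normed, up to sign, by a pure functional. -/
theorem exists_isPureFunctional {b : A} (hb : IsSelfAdjoint b) (h0 : b ≠ 0) :
    ∃ f : A →L[ℂ] ℂ, IsPureFunctional f ∧ ‖f b‖ = ‖b‖ := by
  have key : ∀ c : A, c ≠ 0 → (∃ f : A →L[ℂ] ℂ, IsPosFunctional (f : A →ₗ[ℂ] ℂ) ∧ ‖f‖ ≤ 1 ∧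
      f c = ‖c‖) → ∃ f : A →L[ℂ] ℂ, IsPureFunctional f ∧ f c = ‖c‖ := by
    rintro c hc ⟨f₀, hf₀, hn₀, hc₀⟩
    let K : Set (WeakDual ℂ A) := (WeakDual.toStrongDual ⁻¹' Metric.closedBall 0 1) ∩
      ((⋂ x : A, {f | 0 ≤ f (star x * x)}) ∩ {f | f c = ‖c‖})
    have hK : IsCompact K := by
      refine (WeakDual.isCompact_closedBall 0 1).inter_right (IsClosed.inter ?_ ?_)
      · exact isClosed_iInter fun x => isClosed_le continuous_const (WeakDual.eval_continuous _)
      · exact isClosed_eq (WeakDual.eval_continuous _) continuous_const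
    have memK : ∀ f : A →L[ℂ] ℂ, (StrongDual.toWeakDual f ∈ K) ↔
        ‖f‖ ≤ 1 ∧ IsPosFunctional (f : A →ₗ[ℂ] ℂ) ∧ f c = ‖c‖ := by
      intro f
      simp only [K, Set.mem_inter_iff, Set.mem_preimage, Metric.mem_closedBall, Set.mem_iInter,
        Set.mem_ofPred_eq, dist_zero_right]
      rfl
    -- `K` is weak-* compact by Banach–Alaoglu and nonempty by `f₀`, so Krein–Milman supplies an
    -- extreme point.
    obtain ⟨f, hfK, hfext⟩ := hK.extremePoints_nonempty ⟨_, (memK f₀).2 ⟨hn₀, hf₀, hc₀⟩⟩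
    obtain ⟨h1, h2, h3⟩ := (memK (WeakDual.toStrongDual f)).1 hfK
    refine ⟨WeakDual.toStrongDual f, isPureFunctional_of_mem_extremePoints hc h2 h1 h3 ?_, h3⟩
    intro g₁ g₂ p₁ p₂ n₁ n₂ c₁ c₂ t t0 t1 hsum
    have := hfext ((memK g₁).2 ⟨n₁, p₁, c₁⟩) ((memK g₂).2 ⟨n₂, p₂, c₂⟩)
      ⟨t, 1 - t, t0, by linarith, by ring, hsum⟩
    exact this
  obtain ⟨f, h1, h2, h3⟩ := exists_isPosFunctional_norming hb
  rcases h3 with h3 | h3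
  · obtain ⟨g, hg, hgb⟩ := key b h0 ⟨f, h1, h2, h3⟩
    exact ⟨g, hg, by rw [hgb, Complex.norm_real, norm_norm]⟩
  · obtain ⟨g, hg, hgb⟩ := key (-b) (neg_ne_zero.2 h0) ⟨f, h1, h2, by rw [h3, norm_neg]⟩
    refine ⟨g, hg, ?_⟩
    rw [← norm_neg, ← map_neg, hgb, Complex.norm_real, norm_norm, norm_neg]

end PureFunctionals

/-! ### Actions of C*-algebras by left multipliers -/

section LeftActions

variable {A : Type*} [NonUnitalCStarAlgebra A]
  {E : Type*} [NonUnitalRing E] [Module ℂ E] [StarRing E]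

/-- An action of `A` on the *-algebra `E` by left multipliers. -/
structure IsLeftAction (L : A →ₗ[ℂ] E →ₗ[ℂ] E) : Prop where
  mul : ∀ c c' x, L (c * c') x = L c (L c' x)
  star_mul : ∀ c x y, star (L c x) * y = star x * L (star c) y

/-- Formally `w = (1 - c* c)^(1/2) x`. With `1 - h` as the square root, `w = x - h x` makes sense
without a unit. -/
theorem IsLeftAction.exists_star_mul_self_eq {L : A →ₗ[ℂ] E →ₗ[ℂ] E} (hL : IsLeftAction L)
    {c : A} (hc : ‖c‖ ≤ 1) (x : E) :
    ∃ w, star x * x = star (L c x) * L c x + star w * w := by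
  obtain ⟨h, hs, hh⟩ := exists_add_sub_mul_self_eq hc
  refine ⟨x - L h x, ?_⟩
  have e1 : star (L c x) * L c x = star x * L (star c * c) x := by
    rw [hL.star_mul, hL.mul]
  have e2 : star (L h x) * x = star x * L h x := by rw [hL.star_mul, hs]
  have e3 : star (L h x) * L h x = star x * L (h * h) x := by rw [hL.star_mul, hs, hL.mul]
  rw [e1, ← hh, star_sub, sub_mul, mul_sub, mul_sub, e2, e3, map_sub, map_add]
  simp only [LinearMap.sub_apply, LinearMap.add_apply, mul_sub, mul_add]
  abel

variable [IsScalarTower ℂ E E] [SMulCommClass ℂ E E] [StarModule ℂ E]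

/-- In the completion `y* y ≤ x* x`, and the norm of a C*-algebra is monotone on positive elements.
-/
theorem IsCStarSeminorm.le_of_star_mul_self_eq {q : Seminorm ℂ E} (hq : IsCStarSeminorm q)
    {x y w : E} (h : star x * x = star y * y + star w * w) : q y ≤ q x := by
  let _ := CStarAlgebra.spectralOrder (CStarCompletion hq)
  have := CStarAlgebra.spectralOrderedRing (CStarCompletion hq)
  open CStarCompletion in
  have h1 : star (of hq y) * of hq y ≤ star (of hq x) * of hq x := by
    rw [← of_star, ← of_mul, ← of_star, ← of_mul, h, of_add, of_mul _ (star w), of_star]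
    exact le_add_of_nonneg_right (star_mul_self_nonneg _)
  have h2 := CStarAlgebra.norm_le_norm_of_nonneg_of_le (star_mul_self_nonneg _) h1
  rw [CStarRing.norm_star_mul_self, CStarRing.norm_star_mul_self, CStarCompletion.norm_of,
    CStarCompletion.norm_of, ← sq, ← sq] at h2
  exact le_of_pow_le_pow_left₀ two_ne_zero (apply_nonneg _ _) h2

theorem exists_smul_eq_norm_le_one (c : A) : ∃ c' : A, ‖c'‖ ≤ 1 ∧ c = (‖c‖ : ℂ) • c' := by
  rcases eq_or_ne c 0 with rfl | h
  · exact ⟨0, by simp, by simp⟩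
  · have h' : ‖c‖ ≠ 0 := norm_ne_zero_iff.2 h
    refine ⟨(‖c‖⁻¹ : ℂ) • c, ?_, ?_⟩
    · rw [norm_smul]; simp [h']
    · rw [smul_smul, mul_inv_cancel₀ (by exact_mod_cast h'), one_smul]

/-- Every C*-seminorm is thus automatically controlled by the norm of an acting C*-algebra. For
tensor products this makes all C*-seminorms subcross. -/
theorem IsLeftAction.seminorm_le {L : A →ₗ[ℂ] E →ₗ[ℂ] E} (hL : IsLeftAction L)
    {q : Seminorm ℂ E} (hq : IsCStarSeminorm q) (c : A) (x : E) : q (L c x) ≤ ‖c‖ * q x := by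
  obtain ⟨c', hc', e⟩ := exists_smul_eq_norm_le_one c
  obtain ⟨w, hw⟩ := hL.exists_star_mul_self_eq hc' x
  have e2 : L c x = (‖c‖ : ℂ) • L c' x := by
    rw [← LinearMap.smul_apply, ← map_smul, ← e]
  rw [e2, map_smul_eq_mul, Complex.norm_real, norm_norm]
  exact mul_le_mul_of_nonneg_left (hq.le_of_star_mul_self_eq hw) (norm_nonneg c)

theorem IsLeftAction.gnsLength_le {L : A →ₗ[ℂ] E →ₗ[ℂ] E} (hL : IsLeftAction L)
    {f : E →ₗ[ℂ] ℂ} (hf : IsPosFunctional f) (c : A) (x : E) :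
    gnsLength f (L c x) ≤ ‖c‖ * gnsLength f x := by
  obtain ⟨c', hc', e⟩ := exists_smul_eq_norm_le_one c
  obtain ⟨w, hw⟩ := hL.exists_star_mul_self_eq hc' x
  have e2 : L c x = (‖c‖ : ℂ) • L c' x := by
    rw [← LinearMap.smul_apply, ← map_smul, ← e]
  rw [e2, gnsLength_smul, Complex.norm_real, norm_norm]
  refine mul_le_mul_of_nonneg_left (Real.sqrt_le_sqrt ?_) (norm_nonneg c)
  rw [hw, map_add, Complex.add_re]
  linarith [hf.re_nonneg w]

end LeftActions

/-- Positive functionals that are contractive for a C*-seminorm determine it. -/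
theorem IsCStarSeminorm.exists_isPosFunctional {E : Type*} [NonUnitalRing E] [Module ℂ E]
    [StarRing E] [IsScalarTower ℂ E E] [SMulCommClass ℂ E E] [StarModule ℂ E]
    {q : Seminorm ℂ E} (hq : IsCStarSeminorm q) (x : E) :
    ∃ f : E →ₗ[ℂ] ℂ, IsPosFunctional f ∧ (∀ z, ‖f z‖ ≤ q z) ∧ f (star x * x) = (q x ^ 2 : ℝ) := by
  obtain ⟨f, h1, h2, h3⟩ := exists_isPosFunctional_star_mul_self (CStarCompletion.of hq x)
  let T : E →ₗ[ℂ] CStarCompletion hq :=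
    { toFun := CStarCompletion.of hq
      map_add' := CStarCompletion.of_add hq
      map_smul' := CStarCompletion.of_smul hq }
  refine ⟨(f : CStarCompletion hq →ₗ[ℂ] ℂ) ∘ₗ T, fun z => ?_, fun z => ?_, ?_⟩
  · have := h1 (CStarCompletion.of hq z)
    rw [← CStarCompletion.of_star, ← CStarCompletion.of_mul] at this
    exact this
  · refine (f.le_of_opNorm_le h2 _).trans ?_
    rw [one_mul]; exact (CStarCompletion.norm_of hq z).le
  · rw [← CStarCompletion.of_star, ← CStarCompletion.of_mul, CStarCompletion.norm_of] at h3
    exact h3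

/-! ### Positive functionals and C*-norms on algebraic tensor products -/

section Tensor

section StarAlgebra

variable {E₁ E₂ : Type*} [NonUnitalRing E₁] [Module ℂ E₁] [NonUnitalRing E₂] [Module ℂ E₂]

/-- The product `a ⊗ b ↦ φ a * ψ b` of two functionals. -/
def prodFunctional (φ : E₁ →ₗ[ℂ] ℂ) (ψ : E₂ →ₗ[ℂ] ℂ) : E₁ ⊗[ℂ] E₂ →ₗ[ℂ] ℂ :=
  LinearMap.mul' ℂ ℂ ∘ₗ TensorProduct.map φ ψ

@[simp]
theorem prodFunctional_tmul (φ : E₁ →ₗ[ℂ] ℂ) (ψ : E₂ →ₗ[ℂ] ℂ) (a : E₁) (b : E₂) :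
    prodFunctional φ ψ (a ⊗ₜ b) = φ a * ψ b := by
  simp [prodFunctional]

variable [StarRing E₁] [IsScalarTower ℂ E₁ E₁] [SMulCommClass ℂ E₁ E₁] [StarModule ℂ E₁]
  [StarRing E₂]
  [IsScalarTower ℂ E₂ E₂] [SMulCommClass ℂ E₂ E₂] [StarModule ℂ E₂]

/-- The Gram matrix of the `b i` is positive semidefinite, hence of the form `Q* Q`. -/
theorem IsPosFunctional.exists_matrix {ψ : E₂ →ₗ[ℂ] ℂ} (hψ : IsPosFunctional ψ) {k : ℕ}
    (b : Fin k → E₂) :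
    ∃ Q : Matrix (Fin k) (Fin k) ℂ, ∀ i j, ψ (star (b i) * b j) = ∑ m, star (Q m i) * Q m j := by
  let M : Matrix (Fin k) (Fin k) ℂ := fun i j => ψ (star (b i) * b j)
  have hM : M.PosSemidef := by
    refine ⟨?_, fun x => ?_⟩
    · ext i j
      exact hψ.conj_apply (b i) (b j)
    · have h := hψ (x.sum fun i c => c • b i)
      convert h using 1
      simp only [Finsupp.sum, star_sum, Finset.sum_mul, Finset.mul_sum, map_sum, star_smul,
        smul_mul_assoc, mul_smul_comm, map_smul, smul_eq_mul, M]
      rw [Finset.sum_comm]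
      refine Finset.sum_congr rfl fun i _ => Finset.sum_congr rfl fun j _ => ?_
      ring
  obtain ⟨Q, hQ⟩ : ∃ Q : Matrix (Fin k) (Fin k) ℂ, M = star Q * Q := by
    open scoped MatrixOrder in
    obtain ⟨X, hX, -, h⟩ := CFC.exists_sqrt_of_isSelfAdjoint_of_quasispectrumRestricts
      hM.isHermitian (QuasispectrumRestricts.nnreal_of_nonneg hM.nonneg)
    exact ⟨X, by rw [hX.star_eq, h]⟩
  refine ⟨Q, fun i j => ?_⟩
  have := congrFun (congrFun hQ i) j
  simpa [Matrix.mul_apply] using this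

/-- Factoring the Gram matrix of the second legs turns the value at `x* x` into a sum of values of
`φ` at squares of linear combinations of the first legs. -/
theorem IsPosFunctional.prodFunctional {φ : E₁ →ₗ[ℂ] ℂ} {ψ : E₂ →ₗ[ℂ] ℂ}
    (hφ : IsPosFunctional φ) (hψ : IsPosFunctional ψ) :
    IsPosFunctional (prodFunctional φ ψ) := by
  intro x
  obtain ⟨k, a, b, rfl⟩ := x.exists_sum_tmul_eq
  obtain ⟨Q, hQ⟩ := hψ.exists_matrix b
  have e : _root_.prodFunctional φ ψ (star (∑ j, a j ⊗ₜ[ℂ] b j) * ∑ j, a j ⊗ₜ[ℂ] b j)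
      = ∑ m, φ (star (∑ i, Q m i • a i) * ∑ i, Q m i • a i) := by
    simp only [star_sum, Finset.sum_mul, Finset.mul_sum, map_sum, star_smul,
      smul_mul_assoc, mul_smul_comm, map_smul, smul_eq_mul, TensorProduct.star_tmul,
      Algebra.TensorProduct.tmul_mul_tmul, prodFunctional_tmul, hQ]
    rw [Finset.sum_comm]
    conv_rhs => rw [Finset.sum_comm]; enter [2, i]; rw [Finset.sum_comm]
    rw [Finset.sum_comm]
    refine Finset.sum_congr rfl fun i _ => Finset.sum_congr rfl fun j _ =>
      Finset.sum_congr rfl fun m _ => ?_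
    ring
  rw [e]
  exact Finset.sum_nonneg fun m _ => hφ _

end StarAlgebra

/-! ### Tensor products of C*-algebras: the maximal and the spatial norm. -/

variable {A B : Type*} [NonUnitalCStarAlgebra A] [NonUnitalCStarAlgebra B]

variable (A B) in
/-- The action of `A` on `A ⊗ B` by left multiplication with `a ⊗ 1`. -/
def leftMul : A →ₗ[ℂ] A ⊗[ℂ] B →ₗ[ℂ] A ⊗[ℂ] B :=
  (LinearMap.rTensorHom B) ∘ₗ LinearMap.mul ℂ A

variable (A B) in
/-- The action of `B` on `A ⊗ B` by left multiplication with `1 ⊗ b`. -/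
def leftMul' : B →ₗ[ℂ] A ⊗[ℂ] B →ₗ[ℂ] A ⊗[ℂ] B :=
  (LinearMap.lTensorHom A) ∘ₗ LinearMap.mul ℂ B

@[simp]
theorem leftMul_tmul (c a : A) (b : B) : leftMul A B c (a ⊗ₜ b) = (c * a) ⊗ₜ b := rfl

@[simp]
theorem leftMul'_tmul (d : B) (a : A) (b : B) : leftMul' A B d (a ⊗ₜ b) = a ⊗ₜ (d * b) := rfl

theorem isLeftAction_leftMul : IsLeftAction (leftMul A B) where
  mul c c' x := by
    induction x with
    | zero => simp
    | add x y hx hy => simp only [map_add, hx, hy]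
    | tmul a b => simp [mul_assoc]
  star_mul c x y := by
    induction x with
    | zero => simp
    | add x x' hx hx' => simp only [map_add, star_add, add_mul, hx, hx']
    | tmul a b =>
      induction y with
      | zero => simp
      | add y y' hy hy' => simp only [map_add, mul_add, hy, hy']
      | tmul a' b' => simp [mul_assoc]

theorem isLeftAction_leftMul' : IsLeftAction (leftMul' A B) where
  mul c c' x := by
    induction x with
    | zero => simp
    | add x y hx hy => simp only [map_add, hx, hy]
    | tmul a b => simp [mul_assoc]
  star_mul c x y := by
    induction x with
    | zero => simp
    | add x x' hx hx' => simp only [map_add, star_add, add_mul, hx, hx']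
    | tmul a b =>
      induction y with
      | zero => simp
      | add y y' hy hy' => simp only [map_add, mul_add, hy, hy']
      | tmul a' b' => simp [mul_assoc]

theorem tmul_mul_eq (a : A) (b : B) (x : A ⊗[ℂ] B) :
    (a ⊗ₜ b) * x = leftMul A B a (leftMul' A B b x) := by
  induction x with
  | zero => simp
  | add x y hx hy => simp only [map_add, mul_add, hx, hy]
  | tmul a' b' => simp

theorem IsCStarSeminorm.tmul_mul_le {q : Seminorm ℂ (A ⊗[ℂ] B)} (hq : IsCStarSeminorm q)
    (a : A) (b : B) (x : A ⊗[ℂ] B) : q ((a ⊗ₜ b) * x) ≤ ‖a‖ * ‖b‖ * q x := by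
  rw [tmul_mul_eq, mul_assoc]
  exact (isLeftAction_leftMul.seminorm_le hq a _).trans
    (mul_le_mul_of_nonneg_left (isLeftAction_leftMul'.seminorm_le hq b x) (norm_nonneg a))

theorem IsCStarSeminorm.tmul_le {q : Seminorm ℂ (A ⊗[ℂ] B)} (hq : IsCStarSeminorm q)
    (a : A) (b : B) : q (a ⊗ₜ b) ≤ ‖a‖ * ‖b‖ := by
  -- There is no unit to multiply, so the tensor is tested against its own adjoint; by the
  -- C*-identity one factor cancels.
  have h1 := hq.tmul_mul_le a b (star (a ⊗ₜ b))
  have h2 := hq.star_mul_self (star (a ⊗ₜ b))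
  rw [star_star, hq.map_star] at h2
  rw [h2, hq.map_star, sq] at h1
  rcases (apply_nonneg q (a ⊗ₜ[ℂ] b)).eq_or_lt with h | h
  · rw [← h]; positivity
  · exact le_of_mul_le_mul_right h1 h

theorem IsPosFunctional.gnsLength_tmul_mul_le {f : A ⊗[ℂ] B →ₗ[ℂ] ℂ} (hf : IsPosFunctional f)
    (a : A) (b : B) (x : A ⊗[ℂ] B) :
    gnsLength f ((a ⊗ₜ b) * x) ≤ ‖a‖ * ‖b‖ * gnsLength f x := by
  rw [tmul_mul_eq, mul_assoc]
  exact (isLeftAction_leftMul.gnsLength_le hf a _).trans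
    (mul_le_mul_of_nonneg_left (isLeftAction_leftMul'.gnsLength_le hf b x) (norm_nonneg a))

/-- This makes the defining infima meaningful for arbitrary families of positive functionals,
without assuming continuity: the bound for elementary tensors does not depend on the functional. -/
theorem exists_isGNSBound {F : Set (A ⊗[ℂ] B →ₗ[ℂ] ℂ)} (hF : ∀ f ∈ F, IsPosFunctional f)
    (x : A ⊗[ℂ] B) : ∃ C, IsGNSBound F x C := by
  induction x with
  | zero => exact ⟨0, le_rfl, fun f _ y => by simp [gnsLength]⟩
  | tmul a b =>
    exact ⟨‖a‖ * ‖b‖, by positivity, fun f hf y => (hF f hf).gnsLength_tmul_mul_le a b y⟩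
  | add x y hx hy =>
    obtain ⟨C, hC⟩ := hx
    obtain ⟨D, hD⟩ := hy
    refine ⟨C + D, add_nonneg hC.1 hD.1, fun f hf z => ?_⟩
    rw [add_mul, add_mul]
    exact ((hF f hf).gnsLength_add_le _ _).trans (add_le_add (hC.2 f hf z) (hD.2 f hf z))

variable (A B) in
/-- The largest C*-norm on `A ⊗ B`, defined by all positive functionals. -/
def maxNorm : Seminorm ℂ (A ⊗[ℂ] B) :=
  gnsSeminorm {f | IsPosFunctional f} (fun _ h => h) (exists_isGNSBound fun _ h => h)

variable (A B) in
/-- The products of positive functionals. -/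
def prodFunctionals : Set (A ⊗[ℂ] B →ₗ[ℂ] ℂ) :=
  {f | ∃ (φ : A →L[ℂ] ℂ) (ψ : B →L[ℂ] ℂ), IsPosFunctional (φ : A →ₗ[ℂ] ℂ) ∧
    IsPosFunctional (ψ : B →ₗ[ℂ] ℂ) ∧ f = prodFunctional (φ : A →ₗ[ℂ] ℂ) (ψ : B →ₗ[ℂ] ℂ)}

theorem isPosFunctional_of_mem_prodFunctionals {f : A ⊗[ℂ] B →ₗ[ℂ] ℂ}
    (hf : f ∈ prodFunctionals A B) : IsPosFunctional f := by
  obtain ⟨φ, ψ, hφ, hψ, rfl⟩ := hf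
  exact hφ.prodFunctional hψ

variable (A B) in
/-- The spatial C*-norm on `A ⊗ B`, defined by the products of positive functionals. -/
def minNorm : Seminorm ℂ (A ⊗[ℂ] B) :=
  gnsSeminorm (prodFunctionals A B) (fun _ => isPosFunctional_of_mem_prodFunctionals)
    (exists_isGNSBound fun _ => isPosFunctional_of_mem_prodFunctionals)

theorem isCStarSeminorm_maxNorm : IsCStarSeminorm (maxNorm A B) := isCStarSeminorm_gnsSeminorm _ _

theorem isCStarSeminorm_minNorm : IsCStarSeminorm (minNorm A B) := isCStarSeminorm_gnsSeminorm _ _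

theorem minNorm_le_maxNorm (x : A ⊗[ℂ] B) : minNorm A B x ≤ maxNorm A B x :=
  gnsSeminorm_le _ _ ⟨apply_nonneg _ _, fun _ hf y =>
    gnsLength_mul_le _ _ (isPosFunctional_of_mem_prodFunctionals hf) x y⟩

theorem eq_zero_of_forall_isPosFunctional {a : A}
    (h : ∀ φ : A →L[ℂ] ℂ, IsPosFunctional (φ : A →ₗ[ℂ] ℂ) → ∀ c d, φ (star c * (a * d)) = 0) :
    a = 0 := by
  obtain ⟨φ, h1, h2, h3⟩ := exists_isPosFunctional_star_mul_self (a * star a)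
  -- With `c = a a*` and `d = a*` the tested value is `φ((a a*)* (a a*))`, which equals `‖a a*‖²`.
  have h4 := h φ h1 (a * star a) (star a)
  rw [h3] at h4
  have h5 : ‖a * star a‖ ^ 2 = 0 := by exact_mod_cast h4
  rw [CStarRing.norm_self_mul_star] at h5
  simpa using h5

/-- Product functionals separate points: the slices of `x` by functionals of the second leg vanish
in `A`. Expanding `x` over a linear basis of `A`, its coefficients in `B` are then killed by all
positive functionals as well. -/
theorem eq_zero_of_forall_prodFunctional {x : A ⊗[ℂ] B}
    (h : ∀ f ∈ prodFunctionals A B, ∀ c d c' d', f (star (c ⊗ₜ d) * (x * (c' ⊗ₜ d'))) = 0) :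
    x = 0 := by
  classical
  have hs : ∀ ψ : B →L[ℂ] ℂ, IsPosFunctional (ψ : B →ₗ[ℂ] ℂ) → ∀ d d',
      TensorProduct.rid ℂ A (TensorProduct.map LinearMap.id ((ψ : B →ₗ[ℂ] ℂ) ∘ₗ
        LinearMap.mulLeft ℂ (star d) ∘ₗ LinearMap.mulRight ℂ d') x) = 0 := by
    intro ψ hψ d d'
    refine eq_zero_of_forall_isPosFunctional fun φ hφ c c' => ?_
    rw [← h _ ⟨φ, ψ, hφ, hψ, rfl⟩ c d c' d']
    clear h
    induction x with
    | zero => simp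
    | add x y hx hy => simp only [map_add, add_mul, mul_add, hx, hy]
    | tmul a b => simp [smul_mul_assoc, mul_smul_comm, mul_comm]
  let ℬ := Module.Basis.ofVectorSpace ℂ A
  have key : ∀ i, TensorProduct.equivFinsuppOfBasisLeft ℬ x i = 0 := by
    intro i
    refine eq_zero_of_forall_isPosFunctional fun ψ hψ d d' => ?_
    have h1 : ∀ y : A ⊗[ℂ] B, ψ (star d * (TensorProduct.equivFinsuppOfBasisLeft ℬ y i * d'))
        = ℬ.repr (TensorProduct.rid ℂ A (TensorProduct.map LinearMap.id ((ψ : B →ₗ[ℂ] ℂ) ∘ₗ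
        LinearMap.mulLeft ℂ (star d) ∘ₗ LinearMap.mulRight ℂ d') y)) i := by
      intro y
      induction y with
      | zero => simp
      | add x y hx hy => simp only [map_add, Finsupp.add_apply, add_mul, mul_add, hx, hy]
      | tmul a b => simp [smul_mul_assoc, mul_smul_comm, mul_comm]
    rw [h1, hs ψ hψ]
    simp
  have : TensorProduct.equivFinsuppOfBasisLeft ℬ x = 0 := Finsupp.ext key
  simpa using this

/-- A null vector acts as zero in every product GNS space, so all its matrix coefficients between
elementary tensors vanish. -/
theorem isCStarNorm_minNorm : IsCStarNorm (minNorm A B) where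
  toIsCStarSeminorm := isCStarSeminorm_minNorm
  eq_zero x hx := by
    refine eq_zero_of_forall_prodFunctional fun f hf c d c' d' => ?_
    have h1 := (isPosFunctional_of_mem_prodFunctionals hf).norm_le_gnsLength (c ⊗ₜ d)
      (x * (c' ⊗ₜ d'))
    have h2 : gnsLength f (x * (c' ⊗ₜ d')) ≤ minNorm A B x * gnsLength f (c' ⊗ₜ d') :=
      gnsLength_mul_le _ _ hf _ _
    rw [hx, zero_mul] at h2
    rw [le_antisymm h2 (gnsLength_nonneg _ _), mul_zero] at h1
    exact norm_le_zero_iff.1 h1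

theorem isCStarNorm_maxNorm : IsCStarNorm (maxNorm A B) where
  toIsCStarSeminorm := isCStarSeminorm_maxNorm
  eq_zero x hx := isCStarNorm_minNorm.eq_zero x
    (le_antisymm ((minNorm_le_maxNorm x).trans hx.le) (apply_nonneg _ _))

end Tensor

/-! ### Minimality of the spatial norm -/

section Minimality

open Filter Topology

variable {A B : Type*} [NonUnitalCStarAlgebra A] [NonUnitalCStarAlgebra B]

/-- The norm of a C*-algebra is its only C*-norm. -/
theorem IsCStarNorm.eq_norm {r : Seminorm ℂ B} (hr : IsCStarNorm r) (b : B) : r b = ‖b‖ := by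
  let T : B →⋆ₙₐ[ℂ] CStarCompletion hr.toIsCStarSeminorm :=
    { toFun := CStarCompletion.of _
      map_smul' := CStarCompletion.of_smul _
      map_zero' := CStarCompletion.of_zero _
      map_add' := CStarCompletion.of_add _
      map_mul' := CStarCompletion.of_mul _
      map_star' := CStarCompletion.of_star _ }
  have hT : Function.Injective T := by
    rw [injective_iff_map_eq_zero]
    intro b hb
    refine hr.eq_zero b ?_
    rw [← CStarCompletion.norm_of hr.toIsCStarSeminorm b]
    exact norm_eq_zero.2 hb
  rw [← NonUnitalStarAlgHom.norm_map T hT b]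
  exact (CStarCompletion.norm_of _ b).symm

theorem eq_zero_of_tmul_eq_zero {a : A} (ha : a ≠ 0) {b : B} (h : a ⊗ₜ[ℂ] b = 0) : b = 0 := by
  obtain ⟨g, -, hg⟩ := exists_dual_vector'' ℂ a
  have h1 := congrArg (TensorProduct.lid ℂ B ∘ TensorProduct.map (g : A →ₗ[ℂ] ℂ) LinearMap.id) h
  simpa [hg, ha] using h1

theorem starSquare_mul_eq {e c : A} (he : star e = e) (hc : e * c = c) (n : ℕ) :
    star (starSquare e n) = starSquare e n ∧ starSquare e n * c = c := by
  induction n with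
  | zero => exact ⟨he, hc⟩
  | succ n ih =>
    refine ⟨by simp [starSquare], ?_⟩
    rw [starSquare, ih.1, mul_assoc, ih.2, ih.2]

theorem norm_starSquare_le {e : A} (he : ‖e‖ ≤ 1) (n : ℕ) : ‖starSquare e n‖ ≤ 1 := by
  induction n with
  | zero => exact he
  | succ n ih =>
    rw [starSquare, CStarRing.norm_star_mul_self]
    nlinarith [norm_nonneg (starSquare e n)]

/-- If `e` is a selfadjoint contraction acting as a unit on some `c ≠ 0`, then `b ↦ e ⊗ b` is
isometric for every C*-norm. -/
theorem IsCStarNorm.tmul_eq_norm {q : Seminorm ℂ (A ⊗[ℂ] B)} (hq : IsCStarNorm q) {e c : A}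
    (he : star e = e) (hn : ‖e‖ ≤ 1) (hc0 : c ≠ 0) (hc : e * c = c) (b : B) :
    q (e ⊗ₜ b) = ‖b‖ := by
  have hq' := hq.toIsCStarSeminorm
  let s : ℕ → B → ℝ := fun n b => q (starSquare e n ⊗ₜ b)
  have hanti : ∀ b, Antitone fun n => s n b := fun b => antitone_nat_of_succ_le fun n => by
    have h1 : starSquare e (n + 1) ⊗ₜ[ℂ] b
        = leftMul A B (star (starSquare e n)) (starSquare e n ⊗ₜ b) := rfl
    refine (congrArg q h1).le.trans ((isLeftAction_leftMul.seminorm_le hq' _ _).trans ?_)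
    rw [norm_star]
    exact mul_le_of_le_one_left (apply_nonneg _ _) (norm_starSquare_le hn n)
  have hlim : ∀ b, Tendsto (fun n => s n b) atTop (𝓝 (⨅ n, s n b)) := fun b =>
    tendsto_atTop_ciInf (hanti b) ⟨0, by rintro _ ⟨n, rfl⟩; exact apply_nonneg _ _⟩
  -- `q(e ⊗ ·)` need not be multiplicative, but squaring `e` doubles the exponent; in the decreasing
  -- limit over `e ^ 2 ^ n` both C*-axioms hold. The limit is then the norm of `B`, and it bounds
  -- `q(e ⊗ b)` from below.
  let r : Seminorm ℂ B := Seminorm.of (fun b => ⨅ n, s n b)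
    (fun b b' => le_of_tendsto_of_tendsto' (hlim _) ((hlim b).add (hlim b')) fun n => by
      simp only [s, TensorProduct.tmul_add]; exact map_add_le_add _ _ _)
    (fun k b => tendsto_nhds_unique (hlim _) (((hlim b).const_mul ‖k‖).congr fun n => by
      simp only [s, TensorProduct.tmul_smul, map_smul_eq_mul]))
  have hr : ∀ b, Tendsto (fun n => s n b) atTop (𝓝 (r b)) := hlim
  have hr' : ∀ b, Tendsto (fun n => s (n + 1) b) atTop (𝓝 (r b)) := fun b =>
    (tendsto_add_atTop_iff_nat 1).2 (hr b)
  have hsq : ∀ n, starSquare e (n + 1) = starSquare e n * starSquare e n := fun n => by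
    rw [starSquare, (starSquare_mul_eq he hc n).1]
  have hrn : IsCStarNorm r := by
    refine ⟨⟨fun x y => ?_, fun x => ?_⟩, fun x hx => ?_⟩
    · refine le_of_tendsto_of_tendsto' (hr' _) ((hr x).mul (hr y)) fun n => ?_
      simp only [s, hsq, ← Algebra.TensorProduct.tmul_mul_tmul]
      exact hq.mul_le _ _
    · refine tendsto_nhds_unique (hr' _) (((hr x).pow 2).congr fun n => ?_)
      simp only [s]
      rw [← hq.star_mul_self, TensorProduct.star_tmul, Algebra.TensorProduct.tmul_mul_tmul]
      rfl
    · by_contra hx0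
      -- The vector `c`, fixed by all powers of `e`, prevents the limit from degenerating.
      have h1 : ∀ n, q (c ⊗ₜ (x * star x)) ≤ s n x * q (c ⊗ₜ star x) := fun n => by
        have e1 : c ⊗ₜ[ℂ] (x * star x) = (starSquare e n ⊗ₜ x) * (c ⊗ₜ star x) := by
          rw [Algebra.TensorProduct.tmul_mul_tmul, (starSquare_mul_eq he hc n).2]
        rw [e1]
        exact hq.mul_le _ _
      have h2 := ge_of_tendsto' ((hr x).mul_const (q (c ⊗ₜ star x))) h1
      rw [hx, zero_mul] at h2
      have h3 := hq.eq_zero _ (le_antisymm h2 (apply_nonneg _ _))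
      exact hx0 ((CStarRing.mul_star_self_eq_zero_iff x).1 (eq_zero_of_tmul_eq_zero hc0 h3))
  refine le_antisymm ((hq'.tmul_le e b).trans (mul_le_of_le_one_left (norm_nonneg b) hn)) ?_
  rw [← hrn.eq_norm b]
  exact ciInf_le (f := fun n => s n b) ⟨0, by rintro _ ⟨n, rfl⟩; exact apply_nonneg _ _⟩ 0

/-- `g` is a cutoff concentrated near and above `l`; `k` is supported where `g = 1` and provides the
element on which the functional calculus of `g` acts as a unit. -/
theorem exists_bump {l ε : ℝ} (hl : 0 < l) (hε : 0 < ε) :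
    ∃ g k : ℝ → ℝ, Continuous g ∧ Continuous k ∧ g 0 = 0 ∧ k 0 = 0 ∧ (∀ t, 0 ≤ g t ∧ g t ≤ 1) ∧
      (∀ t, g t * k t = k t) ∧ 0 < k l ∧ ∀ t ≤ l, g t * g t * (l - t) ≤ ε := by
  -- `δ < l` ensures `g 0 = 0`, as the nonunital calculus demands; `δ ≤ ε` gives the final estimate,
  -- because `g` vanishes below `l - δ`.
  obtain ⟨δ, hδ, hδε, hδa⟩ : ∃ δ > 0, δ ≤ ε ∧ δ < l :=
    ⟨min ε (l / 2), by positivity, min_le_left _ _, (min_le_right _ _).trans_lt (by linarith)⟩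
  let g : ℝ → ℝ := fun t => max 0 (min 1 ((t - (l - δ)) / (δ / 2)))
  let k : ℝ → ℝ := fun t => max 0 (t - (l - δ / 2))
  have hg0 : ∀ t ≤ l - δ, g t = 0 := fun t ht => by
    refine max_eq_left ((min_le_right _ _).trans ?_)
    exact div_nonpos_of_nonpos_of_nonneg (by linarith) (by linarith)
  have hg1 : ∀ t, 0 ≤ g t ∧ g t ≤ 1 := fun t =>
    ⟨le_max_left _ _, max_le zero_le_one (min_le_left _ _)⟩
  refine ⟨g, k, by fun_prop, by fun_prop, hg0 0 (by linarith), max_eq_left (by linarith), hg1,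
    fun t => ?_, lt_max_of_lt_right (by linarith), fun t ht => ?_⟩
  · rcases le_total t (l - δ / 2) with h | h
    · have : k t = 0 := max_eq_left (by linarith)
      rw [this, mul_zero]
    · have : g t = 1 := by
        have h1 : 1 ≤ (t - (l - δ)) / (δ / 2) := by
          rw [le_div_iff₀ (by positivity)]; linarith
        simp only [g, min_eq_left h1]
        exact max_eq_right zero_le_one
      rw [this, one_mul]
  · rcases le_total t (l - δ) with h | h
    · rw [hg0 t h, zero_mul, zero_mul]; exact hε.le
    · have : g t * g t ≤ 1 := by nlinarith [hg1 t]
      nlinarith [mul_self_nonneg (g t)]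

/-- Excision of the largest spectral value of a selfadjoint element. -/
theorem exists_excision {a : A} (ha : IsSelfAdjoint a) (h0 : a ≠ 0)
    (hs : ‖a‖ ∈ quasispectrum ℝ a) {ε : ℝ} (hε : 0 < ε) :
    ∃ e c : A, star e = e ∧ ‖e‖ ≤ 1 ∧ c ≠ 0 ∧ e * c = c ∧
      ‖e * a * e - (‖a‖ : ℂ) • (e * e)‖ ≤ ε := by
  obtain ⟨g, k, hg, hk, hg0, hk0, hg1, hgk, hkl, hgl⟩ := exists_bump (norm_pos_iff.2 h0) hε
  refine ⟨cfcₙ g a, cfcₙ k a, (cfcₙ_predicate g a).star_eq, ?_, ?_, ?_, ?_⟩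
  · refine norm_cfcₙ_le fun t _ => ?_
    rw [Real.norm_of_nonneg (hg1 t).1]
    exact (hg1 t).2
  -- `k` is nonzero at the spectral value `‖a‖`, so `k(a) ≠ 0`.
  · intro h
    have h1 := norm_apply_le_norm_cfcₙ k a hs hk.continuousOn hk0 ha
    rw [h, norm_zero] at h1
    exact hkl.ne' (norm_le_zero_iff.1 h1)
  · rw [← cfcₙ_mul g k a hg.continuousOn hg0 hk.continuousOn hk0]
    exact cfcₙ_congr fun t _ => hgk t
  · have hgg : ContinuousOn (fun t => g t * g t) (quasispectrum ℝ a) := (hg.mul hg).continuousOn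
    have hgt : ContinuousOn (fun t => g t * t) (quasispectrum ℝ a) :=
      (hg.mul continuous_id).continuousOn
    have hgtg : ContinuousOn (fun t => g t * t * g t) (quasispectrum ℝ a) :=
      hgt.mul hg.continuousOn
    have e1 : cfcₙ g a * a * cfcₙ g a - (‖a‖ : ℂ) • (cfcₙ g a * cfcₙ g a)
        = cfcₙ (fun t => g t * t * g t - ‖a‖ • (g t * g t)) a := by
      have e2 : (‖a‖ : ℂ) • (cfcₙ g a * cfcₙ g a) = ‖a‖ • (cfcₙ g a * cfcₙ g a) := by simp
      rw [e2, cfcₙ_sub (fun t => g t * t * g t) (fun t => ‖a‖ • (g t * g t)) a hgtg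
          (by simp [hg0]) (hgg.const_smul ‖a‖) (by simp [hg0]),
        cfcₙ_mul (fun t => g t * t) g a hgt (by simp) hg.continuousOn hg0,
        cfcₙ_mul g (fun t => t) a hg.continuousOn hg0 continuousOn_id rfl, cfcₙ_id' ℝ a ha,
        cfcₙ_smul ‖a‖ (fun t => g t * g t) a hgg (by simp [hg0]),
        cfcₙ_mul g g a hg.continuousOn hg0 hg.continuousOn hg0]
    rw [e1]
    refine norm_cfcₙ_le fun t ht => ?_
    have ht1 : t ≤ ‖a‖ := (le_abs_self t).trans
      (NonUnitalIsometricContinuousFunctionalCalculus.norm_quasispectrum_le a ht)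
    have e3 : g t * t * g t - ‖a‖ • (g t * g t) = -((g t * g t) * (‖a‖ - t)) := by
      simp only [smul_eq_mul]; ring
    rw [e3, norm_neg, Real.norm_of_nonneg (mul_nonneg (mul_self_nonneg _) (by linarith))]
    exact hgl t ht1

/-- Hermitian symmetry of `f(x* y)` is used with `x` or `y` running through an approximate unit, in
place of `1`. -/
theorem IsPosFunctional.map_star {f : A →L[ℂ] ℂ} (hf : IsPosFunctional (f : A →ₗ[ℂ] ℂ)) (a : A) :
    f (star a) = (starRingEnd ℂ) (f a) := by
  let _ := CStarAlgebra.spectralOrder A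
  have := CStarAlgebra.spectralOrderedRing A
  have hl := CStarAlgebra.increasingApproximateUnit A
  have := hl.neBot
  have h1 := (f.continuous.tendsto _).comp (hl.tendsto_mul_left (star a))
  have h2 := (Complex.continuous_conj.tendsto _).comp
    ((f.continuous.tendsto _).comp (hl.tendsto_mul_right a))
  refine tendsto_nhds_unique h1 (h2.congr' ?_)
  filter_upwards [hl.eventually_star_eq] with u hu
  have := hf.conj_apply a u
  rw [hu] at this
  exact this

/-! ### Slice maps and their contractivity for pure functionals. -/

variable (A) in
/-- The slice map `a ⊗ b ↦ ψ b • a`. -/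
def sliceRight (ψ : B →ₗ[ℂ] ℂ) : A ⊗[ℂ] B →ₗ[ℂ] A :=
  (TensorProduct.rid ℂ A).toLinearMap ∘ₗ TensorProduct.map LinearMap.id ψ

variable (B) in
/-- The slice map `a ⊗ b ↦ φ a • b`. -/
def sliceLeft (φ : A →ₗ[ℂ] ℂ) : A ⊗[ℂ] B →ₗ[ℂ] B :=
  (TensorProduct.lid ℂ B).toLinearMap ∘ₗ TensorProduct.map φ LinearMap.id

@[simp]
theorem sliceRight_tmul (ψ : B →ₗ[ℂ] ℂ) (a : A) (b : B) :
    sliceRight A ψ (a ⊗ₜ b) = ψ b • a := by simp [sliceRight]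

@[simp]
theorem sliceLeft_tmul (φ : A →ₗ[ℂ] ℂ) (a : A) (b : B) :
    sliceLeft B φ (a ⊗ₜ b) = φ a • b := by simp [sliceLeft]

theorem sliceRight_star {ψ : B →L[ℂ] ℂ} (hψ : IsPosFunctional (ψ : B →ₗ[ℂ] ℂ)) (x : A ⊗[ℂ] B) :
    sliceRight A (ψ : B →ₗ[ℂ] ℂ) (star x) = star (sliceRight A (ψ : B →ₗ[ℂ] ℂ) x) := by
  induction x with
  | zero => simp
  | add x y hx hy => simp only [star_add, map_add, hx, hy]
  | tmul a b => simp [hψ.map_star, star_smul]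

theorem sliceLeft_star {φ : A →L[ℂ] ℂ} (hφ : IsPosFunctional (φ : A →ₗ[ℂ] ℂ)) (x : A ⊗[ℂ] B) :
    sliceLeft B (φ : A →ₗ[ℂ] ℂ) (star x) = star (sliceLeft B (φ : A →ₗ[ℂ] ℂ) x) := by
  induction x with
  | zero => simp
  | add x y hx hy => simp only [star_add, map_add, hx, hy]
  | tmul a b => simp [hφ.map_star, star_smul]

/-- A positive functional that restricts to a pure functional on `e² ⊗ B` is a product functional
on `e A e ⊗ B`. -/
theorem exists_eq_smul_of_isPureFunctional {ψ : B →L[ℂ] ℂ} (hψ : IsPureFunctional ψ)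
    {q : Seminorm ℂ (A ⊗[ℂ] B)} (hq : IsCStarSeminorm q) {G : A ⊗[ℂ] B →ₗ[ℂ] ℂ}
    (hG : IsPosFunctional G) (hGq : ∀ z, ‖G z‖ ≤ q z) {e : A} (he : star e = e)
    (hGe : ∀ b, G ((e * e) ⊗ₜ b) = ψ b) (c : A) : ∃ ω : ℂ, ∀ b, G ((e * c * e) ⊗ₜ b) = ω * ψ b := by
  let _ := CStarAlgebra.spectralOrder A
  have := CStarAlgebra.spectralOrderedRing A
  let S : Submodule ℂ A :=
    { carrier := {c | ∃ ω : ℂ, ∀ b, G ((e * c * e) ⊗ₜ b) = ω * ψ b}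
      add_mem' := by
        rintro c c' ⟨ω, hω⟩ ⟨ω', hω'⟩
        refine ⟨ω + ω', fun b => ?_⟩
        rw [mul_add, add_mul, TensorProduct.add_tmul, map_add, hω, hω', add_mul]
      zero_mem' := ⟨0, fun b => by simp⟩
      smul_mem' := by
        rintro k c ⟨ω, hω⟩
        refine ⟨k * ω, fun b => ?_⟩
        rw [mul_smul_comm, smul_mul_assoc, ← TensorProduct.smul_tmul', map_smul, hω, smul_eq_mul,
          mul_assoc] }
  suffices S = ⊤ from (this ▸ Submodule.mem_top : c ∈ S)
  -- It suffices to treat `c = d* d` with `d` a contraction, since such elements span `A`.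
  rw [eq_top_iff, ← CStarAlgebra.span_nonneg_inter_unitClosedBall, Submodule.span_le]
  rintro c ⟨hc0, hc1⟩
  obtain ⟨d, rfl⟩ := CStarAlgebra.nonneg_iff_eq_star_mul_self.1 (show 0 ≤ c by simpa using hc0)
  have hd : ‖d‖ ≤ 1 := by
    rw [mem_closedBall_zero_iff, CStarRing.norm_star_mul_self] at hc1
    nlinarith [norm_nonneg d]
  obtain ⟨h, hs, hh⟩ := exists_add_sub_mul_self_eq hd
  let χ : B →L[ℂ] ℂ := LinearMap.mkContinuous
    (G ∘ₗ TensorProduct.mk ℂ A B (e * (star d * d) * e)) ‖e * (star d * d) * e‖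
    fun b => (hGq _).trans (hq.tmul_le _ _)
  have hχ : ∀ b, χ b = G ((e * (star d * d) * e) ⊗ₜ b) := fun b => rfl
  -- `χ` is dominated by `ψ`: `e (1 - d* d) e` is the square of `(1 - h) e`. Purity then makes `χ` a
  -- multiple of `ψ`.
  obtain ⟨ω, hω⟩ := hψ.eq_smul χ
    (fun b => by
      have := hG ((d * e) ⊗ₜ b)
      rw [TensorProduct.star_tmul, Algebra.TensorProduct.tmul_mul_tmul, star_mul, he] at this
      rw [ContinuousLinearMap.coe_coe, hχ]
      simpa only [mul_assoc] using this)
    (fun b => by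
      have := hG ((e - h * e) ⊗ₜ b)
      rw [TensorProduct.star_tmul, Algebra.TensorProduct.tmul_mul_tmul, star_sub, star_mul, he,
        hs] at this
      have e1 : (e - e * h) * (e - h * e) = e * e - e * (star d * d) * e := by
        rw [← hh]; noncomm_ring
      rw [e1, TensorProduct.sub_tmul, map_sub, hGe] at this
      exact this)
  refine ⟨ω, fun b => ?_⟩
  rw [← hχ, hω]; rfl

/-- Let `a` be the slice and let `e` excise its spectral value `‖a‖`. The functional `e² ⊗ b ↦ ψ b`
extends to a contractive positive functional `G`, which by purity has product form on `e A e ⊗ B`.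
Thus `G` sends `(e ⊗ 1) x (e ⊗ 1)` to its value at `e a e ⊗ b₀`, which is nearly `‖a‖`, while
contractivity bounds it by `q x`. -/
theorem IsCStarNorm.norm_sliceRight_le_of_mem {q : Seminorm ℂ (A ⊗[ℂ] B)} (hq : IsCStarNorm q)
    {ψ : B →L[ℂ] ℂ} (hψ : IsPureFunctional ψ) {x : A ⊗[ℂ] B} (hx : star x = x)
    (hs : ‖sliceRight A (ψ : B →ₗ[ℂ] ℂ) x‖ ∈ quasispectrum ℝ (sliceRight A (ψ : B →ₗ[ℂ] ℂ) x)) :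
    ‖sliceRight A (ψ : B →ₗ[ℂ] ℂ) x‖ ≤ q x := by
  have hq' := hq.toIsCStarSeminorm
  have hsa : IsSelfAdjoint (sliceRight A (ψ : B →ₗ[ℂ] ℂ) x) := by
    rw [IsSelfAdjoint, ← sliceRight_star hψ.pos, hx]
  set a := sliceRight A (ψ : B →ₗ[ℂ] ℂ) x with ha
  rcases eq_or_ne a 0 with h0 | h0
  · rw [h0, norm_zero]; exact apply_nonneg _ _
  obtain ⟨b₀, hb₀⟩ : ∃ b₀, ψ b₀ = 1 := by
    have : ψ ≠ 0 := fun h => by simpa [h] using hψ.norm_eq_one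
    obtain ⟨b, hb⟩ : ∃ b, ψ b ≠ 0 := by
      by_contra! h
      exact this (ContinuousLinearMap.ext h)
    exact ⟨(ψ b)⁻¹ • b, by rw [map_smul, smul_eq_mul, inv_mul_cancel₀ hb]⟩
  have key : ∀ ε > 0, ‖a‖ ≤ q x + ε * ‖b₀‖ := by
    intro ε hε
    obtain ⟨e, c, he, hn, hc0, hec, hex⟩ := exists_excision hsa h0 hs hε
    let T : B →ₗᵢ[ℂ] CStarCompletion hq' :=
      { toFun := fun b => CStarCompletion.of hq' ((e * e) ⊗ₜ b)
        map_add' := fun b b' => by rw [TensorProduct.tmul_add, CStarCompletion.of_add]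
        map_smul' := fun k b => by
          rw [TensorProduct.tmul_smul, CStarCompletion.of_smul]; rfl
        norm_map' := fun b => by
          refine (CStarCompletion.norm_of hq' _).trans
            (hq.tmul_eq_norm (c := c) (by rw [star_mul, he]) ?_ hc0 ?_ b)
          · exact (norm_mul_le _ _).trans (mul_le_one₀ hn (norm_nonneg _) hn)
          · rw [mul_assoc, hec, hec] }
    obtain ⟨F, hF, hFn⟩ := T.exists_extension ψ
    rw [hψ.norm_eq_one] at hFn
    have hFpos : IsPosFunctional (F : CStarCompletion hq' →ₗ[ℂ] ℂ) := by
      -- The test elements are `e ⊗ k`: their squares are `e² ⊗ k* k`, on which `F` takes the values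
      -- `ψ(k* k)`, close to `‖ψ‖ = 1`.
      refine isPosFunctional_of_norm_le_one hFn fun η hη => ?_
      obtain ⟨k, hk, hk'⟩ := hψ.pos.exists_norm_sub_le hη
      refine ⟨CStarCompletion.of hq' (e ⊗ₜ k), ?_, ?_⟩
      · rw [CStarCompletion.norm_of]
        exact (hq'.tmul_le _ _).trans (mul_le_one₀ hn (norm_nonneg _) hk)
      · rw [← CStarCompletion.of_star, ← CStarCompletion.of_mul, TensorProduct.star_tmul,
          Algebra.TensorProduct.tmul_mul_tmul, he]
        have := hF (star k * k)
        simp only [T, LinearIsometry.coe_mk, LinearMap.coe_mk, AddHom.coe_mk] at this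
        rw [this]
        simpa [hψ.norm_eq_one] using hk'
    let O : A ⊗[ℂ] B →ₗ[ℂ] CStarCompletion hq' :=
      { toFun := CStarCompletion.of hq'
        map_add' := CStarCompletion.of_add hq'
        map_smul' := CStarCompletion.of_smul hq' }
    let G : A ⊗[ℂ] B →ₗ[ℂ] ℂ := (F : CStarCompletion hq' →ₗ[ℂ] ℂ) ∘ₗ O
    have hGe : ∀ b, G ((e * e) ⊗ₜ b) = ψ b := hF
    have hG : IsPosFunctional G := fun z => by
      have := hFpos (CStarCompletion.of hq' z)
      rw [← CStarCompletion.of_star, ← CStarCompletion.of_mul] at this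
      exact this
    have hGq : ∀ z, ‖G z‖ ≤ q z := fun z => by
      refine (F.le_of_opNorm_le hFn _).trans ?_
      rw [one_mul]; exact (CStarCompletion.norm_of hq' z).le
    -- The argument on the left is `(e ⊗ 1) z (e ⊗ 1)`, with right multiplication expressed through
    -- the involution; `b₀` replaces the missing unit of `B`.
    have hGW : ∀ z : A ⊗[ℂ] B, G (leftMul A B e (star (leftMul A B e (star z))))
        = G ((e * sliceRight A (ψ : B →ₗ[ℂ] ℂ) z * e) ⊗ₜ b₀) := by
      intro z
      induction z with
      | zero => simp
      | add x y hx hy =>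
        simp only [star_add, map_add, hx, hy, mul_add, add_mul, TensorProduct.add_tmul]
      | tmul c b =>
        obtain ⟨ω, hω⟩ := exists_eq_smul_of_isPureFunctional hψ hq' hG hGq he hGe c
        simp only [TensorProduct.star_tmul, leftMul_tmul, star_mul, star_star, he,
          sliceRight_tmul, mul_smul_comm, smul_mul_assoc, ← TensorProduct.smul_tmul', map_smul]
        rw [← mul_assoc, hω, hω, hb₀, smul_eq_mul]
        simp [mul_comm]
    have h1 : ‖G ((e * a * e) ⊗ₜ b₀)‖ ≤ q x := by
      rw [ha, ← hGW x]
      refine (hGq _).trans ((isLeftAction_leftMul.seminorm_le hq' _ _).trans ?_)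
      refine (mul_le_of_le_one_left (apply_nonneg _ _) hn).trans ?_
      rw [hq'.map_star, hx]
      exact (isLeftAction_leftMul.seminorm_le hq' _ _).trans
        (mul_le_of_le_one_left (apply_nonneg _ _) hn)
    have h2 : ‖G ((e * a * e - (‖a‖ : ℂ) • (e * e)) ⊗ₜ b₀)‖ ≤ ε * ‖b₀‖ :=
      (hGq _).trans ((hq'.tmul_le _ _).trans (mul_le_mul_of_nonneg_right hex (norm_nonneg _)))
    rw [TensorProduct.sub_tmul, map_sub, ← TensorProduct.smul_tmul', map_smul, hGe, hb₀,
      smul_eq_mul, mul_one] at h2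
    have h3 : ‖(‖a‖ : ℂ)‖ = ‖a‖ := by rw [Complex.norm_real, norm_norm]
    calc ‖a‖ = ‖G ((e * a * e) ⊗ₜ b₀) - (G ((e * a * e) ⊗ₜ b₀) - (‖a‖ : ℂ))‖ := by
          rw [sub_sub_cancel, h3]
      _ ≤ q x + ε * ‖b₀‖ := (norm_sub_le _ _).trans (add_le_add h1 h2)
  have hlim : Tendsto (fun ε : ℝ => q x + ε * ‖b₀‖) (𝓝[>] 0) (𝓝 (q x + 0 * ‖b₀‖)) :=
    Tendsto.mono_left (Continuous.tendsto (by fun_prop) 0) nhdsWithin_le_nhds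
  rw [zero_mul, add_zero] at hlim
  exact ge_of_tendsto hlim (by filter_upwards [self_mem_nhdsWithin] with ε hε using key ε hε)

theorem IsCStarNorm.norm_sliceRight_le {q : Seminorm ℂ (A ⊗[ℂ] B)} (hq : IsCStarNorm q)
    {ψ : B →L[ℂ] ℂ} (hψ : IsPureFunctional ψ) {x : A ⊗[ℂ] B} (hx : star x = x) :
    ‖sliceRight A (ψ : B →ₗ[ℂ] ℂ) x‖ ≤ q x := by
  have hsa : IsSelfAdjoint (sliceRight A (ψ : B →ₗ[ℂ] ℂ) x) := by
    rw [IsSelfAdjoint, ← sliceRight_star hψ.pos, hx]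
  have hsa' : IsSelfAdjoint (sliceRight A (ψ : B →ₗ[ℂ] ℂ) x : Unitization ℂ A) := by
    rw [IsSelfAdjoint, ← Unitization.inr_star, hsa.star_eq]
  rcases CStarAlgebra.norm_or_neg_norm_mem_spectrum hsa' with h | h
  · rw [Unitization.norm_inr, ← Unitization.quasispectrum_eq_spectrum_inr' ℝ ℂ] at h
    exact hq.norm_sliceRight_le_of_mem hψ hx h
  · have h1 := hq.norm_sliceRight_le_of_mem hψ (x := -x) (by rw [star_neg, hx]) (by
      rw [map_neg, norm_neg, Unitization.quasispectrum_eq_spectrum_inr' ℝ ℂ, Unitization.inr_neg,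
        ← spectrum.neg_eq, Set.mem_neg, ← Unitization.norm_inr (𝕜 := ℂ)]
      exact h)
    rwa [map_neg, norm_neg, map_neg_eq_map] at h1

/-- The product of a positive and a bounded functional is bounded with respect to every C*-norm. -/
theorem IsCStarNorm.exists_norm_prodFunctional_le {q : Seminorm ℂ (A ⊗[ℂ] B)}
    (hq : IsCStarNorm q) {φ : A →L[ℂ] ℂ} (hφ : IsPosFunctional (φ : A →ₗ[ℂ] ℂ)) (ψ : B →L[ℂ] ℂ) :
    ∃ K : ℝ, 0 ≤ K ∧ ∀ x, ‖prodFunctional (φ : A →ₗ[ℂ] ℂ) (ψ : B →ₗ[ℂ] ℂ) x‖ ≤ K * q x := by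
  have hsa : ∀ x : A ⊗[ℂ] B, star x = x →
      ‖prodFunctional (φ : A →ₗ[ℂ] ℂ) (ψ : B →ₗ[ℂ] ℂ) x‖ ≤ ‖ψ‖ * (‖φ‖ * q x) := by
    intro x hx
    have e1 : ∀ (φ : A →ₗ[ℂ] ℂ) (ψ : B →ₗ[ℂ] ℂ) (x : A ⊗[ℂ] B),
        prodFunctional φ ψ x = ψ (sliceLeft B φ x) := fun φ ψ x => by
      induction x with
      | zero => simp
      | add x y hx hy => simp only [map_add, hx, hy]
      | tmul a b => simp
    have e2 : ∀ (φ : A →ₗ[ℂ] ℂ) (ψ : B →ₗ[ℂ] ℂ) (x : A ⊗[ℂ] B),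
        prodFunctional φ ψ x = φ (sliceRight A ψ x) := fun φ ψ x => by
      induction x with
      | zero => simp
      | add x y hx hy => simp only [map_add, hx, hy]
      | tmul a b => simp [mul_comm]
    rw [e1]
    refine (ψ.le_opNorm _).trans (mul_le_mul_of_nonneg_left ?_ (norm_nonneg ψ))
    rcases eq_or_ne (sliceLeft B (φ : A →ₗ[ℂ] ℂ) x) 0 with h0 | h0
    · rw [h0, norm_zero]; exact mul_nonneg (norm_nonneg _) (apply_nonneg _ _)
    -- Exchange the slices: a pure `χ` norms the slice by `φ`, and the resulting number is `φ` of
    -- the slice by `χ`, to which the contractivity estimate applies.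
    · obtain ⟨χ, hχ, hχn⟩ := exists_isPureFunctional
        (b := sliceLeft B (φ : A →ₗ[ℂ] ℂ) x) (by rw [IsSelfAdjoint, ← sliceLeft_star hφ, hx]) h0
      rw [← hχn]
      have e3 : χ (sliceLeft B (φ : A →ₗ[ℂ] ℂ) x) = φ (sliceRight A (χ : B →ₗ[ℂ] ℂ) x) :=
        (e1 _ (χ : B →ₗ[ℂ] ℂ) x).symm.trans (e2 _ _ x)
      rw [e3]
      exact (φ.le_opNorm _).trans
        (mul_le_mul_of_nonneg_left (hq.norm_sliceRight_le hχ hx) (norm_nonneg φ))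
  refine ⟨2 * (‖ψ‖ * ‖φ‖), by positivity, fun x => ?_⟩
  have h1 := hsa ((1 / 2 : ℂ) • (x + star x)) (by
    rw [star_smul, star_add, star_star, add_comm]; simp)
  have h2 := hsa ((Complex.I / 2 : ℂ) • (x - star x)) (by
    rw [star_smul, star_sub, star_star, ← neg_sub x, smul_neg, ← neg_smul]
    congr 1
    simp [neg_div])
  have hb1 : q ((1 / 2 : ℂ) • (x + star x)) ≤ q x := by
    rw [map_smul_eq_mul]
    have := map_add_le_add q x (star x)
    rw [hq.map_star] at this
    have e : ‖(1 / 2 : ℂ)‖ = 1 / 2 := by simp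
    rw [e]; linarith
  have hb2 : q ((Complex.I / 2 : ℂ) • (x - star x)) ≤ q x := by
    rw [map_smul_eq_mul]
    have := map_sub_le_add q x (star x)
    rw [hq.map_star] at this
    have e : ‖(Complex.I / 2 : ℂ)‖ = 1 / 2 := by simp
    rw [e]; linarith
  have e : x = (1 / 2 : ℂ) • (x + star x) - Complex.I • ((Complex.I / 2 : ℂ) • (x - star x)) := by
    rw [smul_smul]
    have : Complex.I * (Complex.I / 2) = -(1 / 2) := by
      rw [← mul_div_assoc, Complex.I_mul_I]; ring
    rw [this]
    module
  have h3 := mul_nonneg (norm_nonneg ψ) (norm_nonneg φ)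
  conv_lhs => rw [e]
  rw [map_sub, map_smul _ Complex.I, smul_eq_mul]
  refine (norm_sub_le _ _).trans ?_
  rw [norm_mul, Complex.norm_I, one_mul]
  nlinarith

end Minimality

/-! ### Homomorphisms and C*-norms -/

section Homs

section StarAlgebra

variable {E R : Type*} [NonUnitalRing E] [Module ℂ E] [StarRing E] [NonUnitalRing R] [Module ℂ R]
  [StarRing R]

theorem IsCStarSeminorm.comp {p : Seminorm ℂ R} (hp : IsCStarSeminorm p) (θ : E →⋆ₙₐ[ℂ] R) :
    IsCStarSeminorm (p.comp (θ : E →ₗ[ℂ] R)) where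
  mul_le x y := by
    change p (θ (x * y)) ≤ p (θ x) * p (θ y)
    rw [map_mul]; exact hp.mul_le _ _
  star_mul_self x := by
    change p (θ (star x * x)) = p (θ x) ^ 2
    rw [map_mul, StarHomClass.map_star]; exact hp.star_mul_self _

theorem IsCStarNorm.comp {p : Seminorm ℂ R} (hp : IsCStarNorm p) {θ : E →⋆ₙₐ[ℂ] R}
    (hθ : Function.Injective θ) : IsCStarNorm (p.comp (θ : E →ₗ[ℂ] R)) where
  toIsCStarSeminorm := hp.toIsCStarSeminorm.comp θ
  eq_zero x hx := hθ ((hp.eq_zero (θ x) hx).trans (map_zero θ).symm)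

variable [IsScalarTower ℂ R R] [SMulCommClass ℂ R R] [StarModule ℂ R]

/-- A bound with respect to a C*-seminorm, with an arbitrary constant, gives a bound for the GNS
representation. -/
theorem IsPosFunctional.gnsLength_map_mul_le {f : R →ₗ[ℂ] ℂ} (hf : IsPosFunctional f)
    (θ : E →⋆ₙₐ[ℂ] R) {q : Seminorm ℂ E} (hq : IsCStarSeminorm q) (y : R)
    (hK : ∃ K : ℝ, ∀ z, gnsLength f (θ z * y) ≤ K * q z) (x : E) :
    gnsLength f (θ x * y) ≤ q x * gnsLength f y := by
  obtain ⟨K, hK⟩ := hK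
  have e1 : ∀ z, star y * (θ (star z * z) * y) = star (θ z * y) * (θ z * y) := fun z => by
    rw [map_mul, StarHomClass.map_star, star_mul]; simp only [mul_assoc]
  have h1 := hq.norm_le_of_norm_sq_le (g := fun z => f (star y * (θ z * y)))
    (c := gnsLength f y ^ 2) (K := gnsLength f y * K) (sq_nonneg _)
    (fun z => by
      rw [e1, hf.norm_eq_re, ← hf.gnsLength_sq, ← mul_pow]
      exact pow_le_pow_left₀ (norm_nonneg _) (hf.norm_le_gnsLength _ _) 2)
    (fun z => (hf.norm_le_gnsLength _ _).trans (by
      rw [mul_assoc]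
      exact mul_le_mul_of_nonneg_left (hK z) (gnsLength_nonneg _ _))) (star x * x)
  simp only [e1] at h1
  rw [hf.norm_eq_re, ← hf.gnsLength_sq, hq.star_mul_self, ← mul_pow] at h1
  rw [mul_comm]
  exact le_of_pow_le_pow_left₀ two_ne_zero
    (mul_nonneg (gnsLength_nonneg _ _) (apply_nonneg _ _)) h1

end StarAlgebra

section TensorMap

variable {E R D : Type*} [NonUnitalRing E] [Module ℂ E] [StarRing E] [IsScalarTower ℂ E E]
  [SMulCommClass ℂ E E] [StarModule ℂ E] [NonUnitalRing R] [Module ℂ R] [StarRing R]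
  [IsScalarTower ℂ R R] [SMulCommClass ℂ R R] [StarModule ℂ R] [NonUnitalRing D] [Module ℂ D]
  [StarRing D] [IsScalarTower ℂ D D] [SMulCommClass ℂ D D] [StarModule ℂ D]

variable (D) in
/-- The homomorphism `θ ⊗ id`. -/
def tensorMap (θ : E →⋆ₙₐ[ℂ] R) : E ⊗[ℂ] D →⋆ₙₐ[ℂ] R ⊗[ℂ] D where
  toFun := TensorProduct.map (θ : E →ₗ[ℂ] R) LinearMap.id
  map_smul' := map_smul _
  map_zero' := map_zero _
  map_add' := map_add _
  map_mul' x y := by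
    induction x with
    | zero => simp
    | add x x' hx hx' => simp only [map_add, add_mul, hx, hx']
    | tmul a b =>
      induction y with
      | zero => simp
      | add y y' hy hy' => simp only [map_add, mul_add, hy, hy']
      | tmul a' b' => simp
  map_star' x := by
    induction x with
    | zero => simp
    | add x x' hx hx' => simp only [map_add, star_add, hx, hx']
    | tmul a b => simp [map_star]

@[simp]
theorem tensorMap_tmul (θ : E →⋆ₙₐ[ℂ] R) (a : E) (d : D) :
    tensorMap D θ (a ⊗ₜ d) = θ a ⊗ₜ d := rfl

variable (E D) in
/-- The flip `a ⊗ b ↦ b ⊗ a`. -/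
def tensorSwap : E ⊗[ℂ] D →⋆ₙₐ[ℂ] D ⊗[ℂ] E where
  toFun := TensorProduct.comm ℂ E D
  map_smul' := map_smul _
  map_zero' := map_zero _
  map_add' := map_add _
  map_mul' x y := by
    induction x with
    | zero => simp
    | add x x' hx hx' => simp only [map_add, add_mul, hx, hx']
    | tmul a b =>
      induction y with
      | zero => simp
      | add y y' hy hy' => simp only [map_add, mul_add, hy, hy']
      | tmul a' b' => simp
  map_star' x := by
    induction x with
    | zero => simp
    | add x x' hx hx' => simp only [map_add, star_add, hx, hx']
    | tmul a b => simp

theorem tensorSwap_injective : Function.Injective (tensorSwap E D) :=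
  (TensorProduct.comm ℂ E D).injective

theorem tensorSwap_tensorSwap (x : E ⊗[ℂ] D) : tensorSwap D E (tensorSwap E D x) = x :=
  (TensorProduct.comm ℂ E D).symm_apply_apply x

end TensorMap

theorem HasUniqueCStarNorm.symm {A B : Type*} [NonUnitalCStarAlgebra A] [NonUnitalCStarAlgebra B]
    (h : HasUniqueCStarNorm A B) : HasUniqueCStarNorm B A := by
  obtain ⟨p, hp, hu⟩ := h
  refine ⟨p.comp (tensorSwap B A : B ⊗[ℂ] A →ₗ[ℂ] A ⊗[ℂ] B), hp.comp tensorSwap_injective,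
    fun q hq => ?_⟩
  have h1 := hu _ (hq.comp (tensorSwap_injective (E := A) (D := B)))
  ext x
  change q x = p (tensorSwap B A x)
  rw [← h1]
  change q x = q (tensorSwap A B (tensorSwap B A x))
  rw [tensorSwap_tensorSwap]

/-- A C*-norm on `A ⊗ D` dominates the restriction of the spatial norm of `C ⊗ D`. -/
theorem IsCStarNorm.minNorm_map_le {A C D : Type*} [NonUnitalCStarAlgebra A]
    [NonUnitalCStarAlgebra C] [NonUnitalCStarAlgebra D] (ι : A →⋆ₙₐ[ℂ] C)
    {q : Seminorm ℂ (A ⊗[ℂ] D)} (hq : IsCStarNorm q) (x : A ⊗[ℂ] D) :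
    minNorm C D (tensorMap D ι x) ≤ q x := by
  refine gnsSeminorm_le _ _ ⟨apply_nonneg _ _, fun f hfm y => ?_⟩
  have hf := isPosFunctional_of_mem_prodFunctionals hfm
  obtain ⟨φ, ψ, hφ, hψ, rfl⟩ := hfm
  -- The constant may now depend on `y`, so it is enough to bound the action on elementary tensors
  -- `c ⊗ d`.
  refine hf.gnsLength_map_mul_le _ hq.toIsCStarSeminorm y ?_ x
  induction y with
  | zero => exact ⟨0, fun z => by simp [gnsLength]⟩
  | add y y' hy hy' =>
    obtain ⟨K, hK⟩ := hy
    obtain ⟨K', hK'⟩ := hy'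
    refine ⟨K + K', fun z => ?_⟩
    rw [mul_add, add_mul]
    exact (hf.gnsLength_add_le _ _).trans (add_le_add (hK z) (hK' z))
  | tmul c d =>
    have hι : ∃ K : ℝ, ∀ a, ‖ι a‖ ≤ K * ‖a‖ := ⟨1, fun a => by
      rw [one_mul]; exact NonUnitalStarAlgHom.norm_apply_le ι a⟩
    obtain ⟨k, hk⟩ := hι
    -- The vector state at `c ⊗ d`, pulled back along `ι`, is again a product: `φ(c* ι(·) c)` times
    -- `ψ(d* · d)`.
    let φ' : A →L[ℂ] ℂ := LinearMap.mkContinuous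
      ((φ : C →ₗ[ℂ] ℂ) ∘ₗ LinearMap.mulLeft ℂ (star c) ∘ₗ LinearMap.mulRight ℂ c ∘ₗ
        (ι : A →ₗ[ℂ] C)) (‖φ‖ * (‖star c‖ * (k * ‖c‖))) (fun a => by
        change ‖φ (star c * (ι a * c))‖ ≤ _
        refine (φ.le_opNorm _).trans ?_
        rw [mul_assoc]
        refine mul_le_mul_of_nonneg_left ((norm_mul_le _ _).trans ?_) (norm_nonneg _)
        rw [mul_assoc]
        refine mul_le_mul_of_nonneg_left ((norm_mul_le _ _).trans ?_) (norm_nonneg _)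
        rw [mul_right_comm]
        exact mul_le_mul_of_nonneg_right (hk a) (norm_nonneg _))
    let ψ' : D →L[ℂ] ℂ := LinearMap.mkContinuous
      ((ψ : D →ₗ[ℂ] ℂ) ∘ₗ LinearMap.mulLeft ℂ (star d) ∘ₗ LinearMap.mulRight ℂ d)
        (‖ψ‖ * (‖star d‖ * ‖d‖)) (fun a => by
        change ‖ψ (star d * (a * d))‖ ≤ _
        refine (ψ.le_opNorm _).trans ?_
        rw [mul_assoc]
        refine mul_le_mul_of_nonneg_left ((norm_mul_le _ _).trans ?_) (norm_nonneg _)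
        rw [mul_assoc, mul_comm ‖d‖]
        exact mul_le_mul_of_nonneg_left (norm_mul_le _ _) (norm_nonneg _))
    have hφ' : IsPosFunctional (φ' : A →ₗ[ℂ] ℂ) := fun a => by
      change 0 ≤ φ (star c * (ι (star a * a) * c))
      have := hφ (ι a * c)
      rw [map_mul ι, StarHomClass.map_star ι]
      simpa only [star_mul, mul_assoc, ContinuousLinearMap.coe_coe] using this
    obtain ⟨K, hK0, hK⟩ := hq.exists_norm_prodFunctional_le hφ' ψ'
    refine ⟨√K, fun z => ?_⟩
    refine le_of_pow_le_pow_left₀ two_ne_zero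
      (mul_nonneg (Real.sqrt_nonneg _) (apply_nonneg _ _)) ?_
    rw [mul_pow, Real.sq_sqrt hK0, hf.gnsLength_sq, ← hq.star_mul_self]
    refine (Complex.re_le_norm _).trans (le_trans (le_of_eq (congrArg _ ?_)) (hK (star z * z)))
    have e1 : star (tensorMap D ι z * c ⊗ₜ d) * (tensorMap D ι z * c ⊗ₜ d)
        = star (c ⊗ₜ d) * (tensorMap D ι (star z * z) * c ⊗ₜ d) := by
      rw [map_mul, StarHomClass.map_star, star_mul]; simp only [mul_assoc]
    rw [e1]
    generalize star z * z = w
    induction w with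
    | zero => simp
    | add x y hx hy => simp only [map_add, mul_add, add_mul, hx, hy]
    | tmul a b => simp; rfl

theorem IsCStarNorm.minNorm_le {A D : Type*} [NonUnitalCStarAlgebra A]
    [NonUnitalCStarAlgebra D] {q : Seminorm ℂ (A ⊗[ℂ] D)} (hq : IsCStarNorm q) (x : A ⊗[ℂ] D) :
    minNorm A D x ≤ q x := by
  have h := hq.minNorm_map_le (NonUnitalStarAlgHom.id ℂ A) x
  have e : tensorMap D (NonUnitalStarAlgHom.id ℂ A) x = x := by
    induction x with
    | zero => simp
    | add x y hx hy =>
      rw [map_add, hx, hy]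
      all_goals exact hq.minNorm_map_le _ _
    | tmul a b => rfl
  rwa [e] at h

end Homs

/-! ### Sections of Fell bundles and the conditional expectation -/

namespace FellBundle

open scoped Classical
open Filter Topology

variable {G : Type u} [Group G] (A : FellBundle.{u, v} G)

/-- The value of a section at `t`, as a linear map. -/
def value (t : G) : A.Sections →ₗ[ℂ] A.fiber t := DirectSum.component ℂ G A.fiber t

theorem value_delta_self (t : G) (a : A.fiber t) : A.value t (A.delta t a) = a := by
  simp [value, delta, DirectSum.component.lof_self]

theorem value_delta_of_ne {s t : G} (h : s ≠ t) (a : A.fiber s) : A.value t (A.delta s a) = 0 := by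
  simp [value, delta, DirectSum.component.of, h]

/-- The restriction of a section to the point `t`. -/
def piece (t : G) : A.Sections →ₗ[ℂ] A.Sections := A.delta t ∘ₗ A.value t

theorem piece_delta_self (t : G) (a : A.fiber t) : A.piece t (A.delta t a) = A.delta t a := by
  simp [piece, value_delta_self]

theorem piece_delta_of_ne {s t : G} (h : s ≠ t) (a : A.fiber s) : A.piece t (A.delta s a) = 0 := by
  simp [piece, value_delta_of_ne _ h]

theorem value_piece_self (t : G) (x : A.Sections) : A.value t (A.piece t x) = A.value t x := by
  simp [piece, value_delta_self]

theorem piece_star_delta_mul (t w : G) (a : A.fiber t) (y : A.Sections) :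
    A.piece w (star (A.delta t a) * y) = star (A.delta t a) * A.piece (t * w) y := by
  induction y using A.section_induction with
  | h0 => simp
  | h2 y y' hy hy' => simp only [_root_.mul_add, map_add, hy, hy']
  | h1 v b =>
    rw [A.star_delta rfl, A.delta_mul_delta rfl]
    by_cases h : v = t * w
    · subst h
      have e : t⁻¹ * (t * w) = w := by group
      rw [piece_delta_self, A.delta_mul_delta rfl]
      generalize A.mul rfl (A.adj rfl a) b = c
      revert c
      rw [e]
      exact A.piece_delta_self w
    · rw [A.piece_delta_of_ne h, MulZeroClass.mul_zero, A.piece_delta_of_ne]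
      rintro rfl
      exact h (by group)

theorem exists_eq_sum_piece (x : A.Sections) :
    ∃ T : Finset G, (∀ t, t ∉ T → A.piece t x = 0) ∧ ∀ T', T ⊆ T' → x = ∑ t ∈ T', A.piece t x := by
  induction x using A.section_induction with
  | h0 => exact ⟨∅, fun t _ => map_zero _, fun T' _ => by simp⟩
  | h1 s a =>
    refine ⟨{s}, fun t ht => A.piece_delta_of_ne (fun h => ht (by simp [h])) a, fun T' hT' => ?_⟩
    rw [Finset.sum_eq_single_of_mem s (hT' (Finset.mem_singleton_self s)), piece_delta_self]
    intro t _ hts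
    exact A.piece_delta_of_ne (Ne.symm hts) a
  | h2 x y hx hy =>
    obtain ⟨T, hT0, hT⟩ := hx
    obtain ⟨T₂, hT₂0, hT₂⟩ := hy
    refine ⟨T ∪ T₂, fun t ht => ?_, fun T' hT' => ?_⟩
    · rw [Finset.notMem_union] at ht
      rw [map_add, hT0 t ht.1, hT₂0 t ht.2, add_zero]
    · simp only [map_add, Finset.sum_add_distrib]
      rw [← hT T' (Finset.union_subset_left hT'), ← hT₂ T' (Finset.union_subset_right hT')]

/-- The product `x_s* x_t` lives over `s⁻¹ t`, so only diagonal terms reach the unit fiber. -/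
theorem value_one_star_mul_self (x : A.Sections) : ∃ T : Finset G, (∀ t, t ∉ T → A.piece t x = 0) ∧
    A.value 1 (star x * x) = ∑ t ∈ T, A.value 1 (star (A.piece t x) * A.piece t x) := by
  obtain ⟨T, hT0, hT⟩ := A.exists_eq_sum_piece x
  refine ⟨T, hT0, ?_⟩
  have h1 : ∀ t, A.value 1 (star (A.piece t x) * x)
      = A.value 1 (star (A.piece t x) * A.piece t x) := fun t => by
    rw [← A.value_piece_self, piece, LinearMap.comp_apply]
    have := A.piece_star_delta_mul t 1 (A.value t x) x
    rw [mul_one] at this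
    have h2 := congrArg (A.value 1) this
    rw [value_piece_self] at h2
    rw [value_delta_self]
    exact h2
  conv_lhs => rw [hT T subset_rfl]
  rw [star_sum, Finset.sum_mul, map_sum]
  refine Finset.sum_congr rfl fun t _ => ?_
  rw [← hT T subset_rfl, h1]

/-- The embedding of the unit fiber in the algebra of sections. -/
def unitHom : A.fiber 1 →⋆ₙₐ[ℂ] A.Sections where
  toFun := A.delta 1
  map_smul' := map_smul _
  map_zero' := map_zero _
  map_add' := map_add _
  map_mul' a b := (A.delta_mul_delta (one_mul 1) a b).symm
  map_star' a := (A.star_delta inv_one a).symm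

theorem unitHom_apply (a : A.fiber 1) : A.unitHom a = A.delta 1 a := rfl

theorem star_delta_mul_self (t : G) (a : A.fiber t) : ∃ c : A.fiber 1, ‖c‖ = ‖a‖ ∧
    star (A.delta t a) * A.delta t a = A.unitHom (star c * c) := by
  obtain ⟨c, hc⟩ := A.adj_mul_self_pos rfl (inv_mul_cancel t) a
  refine ⟨c, ?_, ?_⟩
  · have h1 := A.norm_adj_mul_self rfl (inv_mul_cancel t) a
    have h2 := A.norm_adj_mul_self inv_one (one_mul 1) c
    rw [hc, h2] at h1
    exact (pow_left_inj₀ (norm_nonneg _) (norm_nonneg _) two_ne_zero).1 h1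
  · rw [A.star_delta rfl, A.delta_mul_delta (inv_mul_cancel t), hc]
    rfl

/-- The action of the unit fiber on sections. -/
def unitAction : A.fiber 1 →ₗ[ℂ] A.Sections →ₗ[ℂ] A.Sections :=
  LinearMap.mul ℂ A.Sections ∘ₗ A.delta 1

theorem unitAction_apply (c : A.fiber 1) (x : A.Sections) :
    A.unitAction c x = A.unitHom c * x := rfl

theorem isLeftAction_unitAction : IsLeftAction A.unitAction where
  mul c c' x := by simp only [unitAction_apply, map_mul, _root_.mul_assoc]
  star_mul c x y := by
    simp only [unitAction_apply, star_mul, StarHomClass.map_star, _root_.mul_assoc]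

variable {A}

/-- The functional `x ↦ φ (x 1)` on sections. -/
def extendFunctional (φ : A.fiber 1 →ₗ[ℂ] ℂ) : A.Sections →ₗ[ℂ] ℂ := φ ∘ₗ A.value 1

theorem extendFunctional_apply (φ : A.fiber 1 →ₗ[ℂ] ℂ) (x : A.Sections) :
    extendFunctional φ x = φ (A.value 1 x) := rfl

theorem value_star_piece_mul_piece (t : G) (x : A.Sections) :
    ∃ c : A.fiber 1, A.value 1 (star (A.piece t x) * A.piece t x) = star c * c := by
  obtain ⟨c, -, hc⟩ := A.star_delta_mul_self t (A.value t x)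
  refine ⟨c, ?_⟩
  rw [piece, LinearMap.comp_apply, hc, unitHom_apply, value_delta_self]

theorem isPosFunctional_extendFunctional {φ : A.fiber 1 →ₗ[ℂ] ℂ} (hφ : IsPosFunctional φ) :
    IsPosFunctional (extendFunctional φ) := fun x => by
  obtain ⟨T, -, hT⟩ := A.value_one_star_mul_self x
  rw [extendFunctional_apply, hT, map_sum]
  refine Finset.sum_nonneg fun t _ => ?_
  obtain ⟨c, hc⟩ := value_star_piece_mul_piece t x
  rw [hc]
  exact hφ c

/-- Schwarz inequality for the expectation: the left side is one term of the sum of nonnegative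
terms on the right. -/
theorem re_value_one_le {φ : A.fiber 1 →ₗ[ℂ] ℂ} (hφ : IsPosFunctional φ) (x : A.Sections) :
    (φ (star (A.value 1 x) * A.value 1 x)).re ≤ (extendFunctional φ (star x * x)).re := by
  obtain ⟨T, hT0, hT⟩ := A.value_one_star_mul_self x
  have hnn : ∀ t, 0 ≤ (φ (A.value 1 (star (A.piece t x) * A.piece t x))).re := fun t => by
    obtain ⟨c, hc⟩ := value_star_piece_mul_piece t x
    rw [hc]; exact hφ.re_nonneg c
  have h1 : star (A.value 1 x) * A.value 1 x
      = A.value 1 (star (A.piece 1 x) * A.piece 1 x) := by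
    rw [piece, LinearMap.comp_apply, ← unitHom_apply, ← StarHomClass.map_star A.unitHom,
      ← map_mul A.unitHom, unitHom_apply, value_delta_self]
  rw [extendFunctional_apply, hT, map_sum, Complex.re_sum, h1]
  by_cases h : (1 : G) ∈ T
  · exact Finset.single_le_sum (f := fun t => (φ (A.value 1 (star (A.piece t x) *
      A.piece t x))).re) (fun t _ => hnn t) h
  · rw [hT0 1 h]
    simp only [star_zero, MulZeroClass.mul_zero, map_zero, Complex.zero_re]
    exact Finset.sum_nonneg fun t _ => hnn t

/-- By the positivity axiom `a* a = c* c` with `c` in the unit fiber, so `a y` and `c y` have the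
same length, and the unit fiber is already known to act boundedly. -/
theorem gnsLength_delta_mul_le {φ : A.fiber 1 →ₗ[ℂ] ℂ} (hφ : IsPosFunctional φ) (t : G)
    (a : A.fiber t) (y : A.Sections) :
    gnsLength (extendFunctional φ) (A.delta t a * y)
      ≤ ‖a‖ * gnsLength (extendFunctional φ) y := by
  obtain ⟨c, hn, hc⟩ := A.star_delta_mul_self t a
  have h := A.isLeftAction_unitAction.gnsLength_le (isPosFunctional_extendFunctional hφ) c y
  rw [← hn]
  refine le_trans (le_of_eq ?_) h
  have e : star (A.delta t a * y) * (A.delta t a * y)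
      = star (A.unitAction c y) * A.unitAction c y := by
    have e1 : star (A.delta t a * y) * (A.delta t a * y)
        = star y * ((star (A.delta t a) * A.delta t a) * y) := by
      rw [star_mul]; simp only [_root_.mul_assoc]
    rw [e1, hc, unitAction_apply, map_mul, StarHomClass.map_star, star_mul]
    simp only [_root_.mul_assoc]
  rw [gnsLength, gnsLength, e]

/-- This places the GNS seminorm of `φ ∘ E` among the C*-seminorms whose supremum is the universal
one. -/
theorem isGNSBound_l1Norm {φ : A.fiber 1 →ₗ[ℂ] ℂ} (hφ : IsPosFunctional φ) (x : A.Sections) :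
    IsGNSBound {extendFunctional φ} x (A.l1Norm x) := by
  refine ⟨Finset.sum_nonneg fun t _ => norm_nonneg _, ?_⟩
  rintro f rfl y
  have hpos := isPosFunctional_extendFunctional hφ
  have hsum : ∀ (T : Finset G) (z : G → A.Sections), gnsLength (extendFunctional φ) (∑ t ∈ T, z t)
      ≤ ∑ t ∈ T, gnsLength (extendFunctional φ) (z t) := by
    intro T z
    induction T using Finset.induction_on with
    | empty => simp [gnsLength]
    | insert t T ht ih =>
      rw [Finset.sum_insert ht, Finset.sum_insert ht]
      exact (hpos.gnsLength_add_le _ _).trans (by gcongr)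
  have hx : x = ∑ t ∈ DFinsupp.support x, A.delta t (x t) := (DirectSum.sum_support_of x).symm
  conv_lhs => rw [hx, Finset.sum_mul]
  refine (hsum _ _).trans ?_
  rw [l1Norm, Finset.sum_mul]
  exact Finset.sum_le_sum fun t _ => gnsLength_delta_mul_le hφ t _ y

theorem gnsLength_mul_le_universalSeminorm {φ : A.fiber 1 →ₗ[ℂ] ℂ} (hφ : IsPosFunctional φ)
    (x y : A.Sections) : gnsLength (extendFunctional φ) (x * y)
      ≤ A.universalSeminorm x * gnsLength (extendFunctional φ) y := by
  have hpos : ∀ f ∈ ({extendFunctional φ} : Set (A.Sections →ₗ[ℂ] ℂ)), IsPosFunctional f := by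
    rintro f rfl; exact isPosFunctional_extendFunctional hφ
  have hb := fun x => Exists.intro _ (isGNSBound_l1Norm hφ x)
  have h1 := A.le_universalSeminorm (p := gnsSeminorm _ hpos hb)
    ⟨isCStarSeminorm_gnsSeminorm _ _, fun f => gnsSeminorm_le _ _ (isGNSBound_l1Norm hφ f)⟩ x
  exact (gnsLength_mul_le hpos hb (Set.mem_singleton _) x y).trans
    (mul_le_mul_of_nonneg_right h1 (gnsLength_nonneg _ _))

theorem value_one_mul_unitHom (x : A.Sections) (v : A.fiber 1) :
    A.value 1 (x * A.unitHom v) = A.value 1 x * v := by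
  induction x using A.section_induction with
  | h0 => simp
  | h2 x y hx hy => simp only [map_add, _root_.add_mul, hx, hy]
  | h1 t a =>
    rw [unitHom_apply, A.delta_mul_delta (mul_one t)]
    by_cases h : t = 1
    · subst h
      rw [value_delta_self, value_delta_self]; rfl
    · rw [A.value_delta_of_ne h, A.value_delta_of_ne h, MulZeroClass.zero_mul]

/-- Contractivity of the expectation. With `c = x(e)` and `φ` norming `(c c*)* (c c*)`, the Schwarz
inequality applied to `x c*` gives `‖c‖² ≤ ‖x‖ ‖c‖`. -/
theorem norm_value_one_le (x : A.Sections) : ‖A.value 1 x‖ ≤ A.universalSeminorm x := by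
  set c := A.value 1 x with hc
  obtain ⟨φ, hφ, hn, h⟩ := exists_isPosFunctional_star_mul_self (c * star c)
  have h1 := re_value_one_le hφ (x * A.unitHom (star c))
  have h2 := gnsLength_mul_le_universalSeminorm hφ x (A.unitHom (star c))
  have hpos := isPosFunctional_extendFunctional hφ
  rw [value_one_mul_unitHom, ← hc, ContinuousLinearMap.coe_coe, h, Complex.ofReal_re,
    ← hpos.gnsLength_sq, CStarRing.norm_self_mul_star] at h1
  have h3 : gnsLength (extendFunctional (φ : A.fiber 1 →ₗ[ℂ] ℂ)) (A.unitHom (star c)) ≤ ‖c‖ := by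
    refine Real.sqrt_le_iff.2 ⟨norm_nonneg c, ?_⟩
    rw [← StarHomClass.map_star, ← map_mul, unitHom_apply, extendFunctional_apply,
      value_delta_self, star_star, ContinuousLinearMap.coe_coe]
    refine (Complex.re_le_norm _).trans ((φ.le_of_opNorm_le hn _).trans ?_)
    rw [one_mul, CStarRing.norm_self_mul_star, sq]
  rcases (norm_nonneg c).eq_or_lt with h0 | h0
  · rw [← h0]; exact apply_nonneg _ _
  · have h4 : ‖c‖ * ‖c‖ ≤ A.universalSeminorm x * ‖c‖ :=
      (le_of_pow_le_pow_left₀ two_ne_zero (gnsLength_nonneg _ _) h1).trans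
        (h2.trans (mul_le_mul_of_nonneg_left h3 (apply_nonneg _ _)))
    exact le_of_mul_le_mul_right h4 h0

variable (A) in
/-- The canonical homomorphism of the algebra of sections into `C*(A)`. -/
def ofHom : A.Sections →⋆ₙₐ[ℂ] A.FullCStar where
  toFun := CStarCompletion.of _
  map_smul' := CStarCompletion.of_smul _
  map_zero' := CStarCompletion.of_zero _
  map_add' := CStarCompletion.of_add _
  map_mul' := CStarCompletion.of_mul _
  map_star' := CStarCompletion.of_star _

theorem norm_ofHom (x : A.Sections) : ‖A.ofHom x‖ = A.universalSeminorm x :=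
  CStarCompletion.norm_of _ x

variable (A) in
theorem denseRange_ofHom : DenseRange A.ofHom := CStarCompletion.denseRange_of _

theorem norm_ofHom_delta_le (t : G) (a : A.fiber t) : ‖A.ofHom (A.delta t a)‖ ≤ ‖a‖ := by
  rw [norm_ofHom]
  refine A.universalSeminorm_le fun p hp => (hp.2 _).trans ?_
  have h1 : DFinsupp.support (A.delta t a) ⊆ {t} := DFinsupp.support_single_subset
  rw [l1Norm]
  refine (Finset.sum_le_sum_of_subset_of_nonneg h1 fun _ _ _ => norm_nonneg _).trans ?_
  rw [Finset.sum_singleton]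
  have : (A.delta t a) t = a := A.value_delta_self t a
  rw [this]

variable (A) in
theorem exists_expectation :
    ∃ e : A.FullCStar →L[ℂ] A.fiber 1, ∀ x, e (A.ofHom x) = A.value 1 x := by
  let P := PreCStar A.isCStarSeminorm_universalSeminorm
  let f : P →L[ℂ] A.fiber 1 := LinearMap.mkContinuous
    (show P →ₗ[ℂ] A.fiber 1 from A.value 1) 1 fun x => by
      rw [one_mul]; exact norm_value_one_le _
  let j : P →L[ℂ] A.FullCStar := UniformSpace.Completion.toComplL
  have hj : DenseRange j := UniformSpace.Completion.denseRange_coe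
  have hj' : IsUniformInducing j := UniformSpace.Completion.isUniformInducing_coe P
  exact ⟨f.extend j, fun x => f.extend_eq hj hj' x⟩

variable (A) in
/-- The conditional expectation of `C*(A)` onto the unit fiber. -/
def expectation : A.FullCStar →L[ℂ] A.fiber 1 := A.exists_expectation.choose

theorem expectation_ofHom (x : A.Sections) : A.expectation (A.ofHom x) = A.value 1 x :=
  A.exists_expectation.choose_spec x

end FellBundle

/-! ### Positive matrices over C*-algebras -/

section Matrices

variable {A : Type*} [NonUnitalCStarAlgebra A] {n : Type*} [Fintype n]

/-- The negative part of a selfadjoint element. -/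
theorem exists_negPart {M : A} (hM : IsSelfAdjoint M) : ∃ N Q : A, star N = N ∧
    N * M = -(N * N) ∧ N = star Q * Q ∧ (N = 0 → ∃ R, M = star R * R) := by
  let _ := CStarAlgebra.spectralOrder A
  have := CStarAlgebra.spectralOrderedRing A
  have hN : 0 ≤ M⁻ := CFC.negPart_nonneg M
  obtain ⟨Q, hQ⟩ := CStarAlgebra.nonneg_iff_eq_star_mul_self.1 hN
  refine ⟨M⁻, Q, IsSelfAdjoint.of_nonneg hN, ?_, hQ, fun h0 =>
    CStarAlgebra.nonneg_iff_eq_star_mul_self.1 ((CFC.negPart_eq_zero_iff M hM).1 h0)⟩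
  have h := mul_sub M⁻ M⁺ M⁻
  rwa [CFC.posPart_sub_negPart M hM, CFC.negPart_mul_posPart, zero_sub] at h

/-- A hermitian matrix whose compressions to columns are positive is of the form `R* R`. -/
theorem exists_eq_sum_star_mul (P : n → n → A) (hP : ∀ k l, star (P k l) = P l k)
    (h : ∀ c : n → A, ∃ b, ∑ k, ∑ l, star (c k) * P k l * c l = star b * b) :
    ∃ R : n → n → A, ∀ k l, P k l = ∑ m, star (R m k) * R m l := by
  let _ := CStarAlgebra.spectralOrder A
  have := CStarAlgebra.spectralOrderedRing A
  let M : CStarMatrix n n A := CStarMatrix.ofMatrix P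
  have hM : IsSelfAdjoint M := by
    ext k l
    exact hP l k
  have hcomp : ∀ (X : CStarMatrix n n A) (j : n), 0 ≤ (star X * M * X) j j := fun X j => by
    obtain ⟨b, hb⟩ := h fun k => X k j
    have e : (star X * M * X) j j = ∑ k, ∑ l, star (X k j) * P k l * X l j := by
      rw [CStarMatrix.mul_apply, Finset.sum_comm]
      refine Finset.sum_congr rfl fun l _ => ?_
      rw [CStarMatrix.mul_apply, Finset.sum_mul]
      rfl
    rw [e, hb]
    exact star_mul_self_nonneg b
  obtain ⟨N, Q, hNs, e1, hQ, hR⟩ := exists_negPart hM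
  have hW : ∀ Y : CStarMatrix n n A, Q * N * Y = 0 := fun Y => by
    ext m j
    -- Compressing `M` by `N Y` gives minus a square, while the hypothesis makes its diagonal
    -- entries nonnegative; hence the columns of `Q N Y` vanish.
    have h1 := hcomp (N * Y) j
    have e2 : star (N * Y) * M * (N * Y) = -(star (Q * N * Y) * (Q * N * Y)) := by
      have e3 : star (N * Y) * M * (N * Y) = star Y * (N * M) * N * Y := by
        rw [star_mul, hNs]; simp only [mul_assoc]
      have e4 : star (Q * N * Y) * (Q * N * Y) = star Y * N * (star Q * Q) * N * Y := by
        simp only [star_mul, hNs, mul_assoc]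
      rw [e3, e4, ← hQ, e1]
      simp only [mul_neg, neg_mul, mul_assoc]
    rw [e2] at h1
    have h2 : (star (Q * N * Y) * (Q * N * Y)) j j
        = ∑ i, star ((Q * N * Y) i j) * (Q * N * Y) i j := CStarMatrix.mul_apply
    have h3 : ∑ i, star ((Q * N * Y) i j) * (Q * N * Y) i j ≤ 0 := by
      rw [← h2]; exact neg_nonneg.1 h1
    have h4 := (Finset.sum_eq_zero_iff_of_nonneg fun i _ => star_mul_self_nonneg _).1
      (le_antisymm h3 (Finset.sum_nonneg fun i _ => star_mul_self_nonneg _)) m (Finset.mem_univ m)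
    exact (CStarRing.star_mul_self_eq_zero_iff _).1 h4
  -- Take `Y = (Q N)*`, which avoids the unit matrix.
  have hW0 : Q * N = 0 := (CStarRing.mul_star_self_eq_zero_iff _).1 (hW _)
  have hNN : N * N = 0 := by
    nth_rw 1 [hQ]
    rw [mul_assoc, hW0, mul_zero]
  have hN0 : N = 0 := (CStarRing.star_mul_self_eq_zero_iff _).1 (by rw [hNs, hNN])
  obtain ⟨R, hR⟩ := hR hN0
  refine ⟨R, fun k l => ?_⟩
  change M k l = _
  rw [hR, CStarMatrix.mul_apply]
  rfl

end Matrices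

/-! ### Positivity of the matrices `(a_k* a_l)` over a fiber. -/

namespace FellBundle

open scoped Classical
open Filter Topology

variable {G : Type u} [Group G] {A : FellBundle.{u, v} G}

theorem star_delta_mul_delta (t : G) (a b : A.fiber t) :
    star (A.delta t a) * A.delta t b = A.unitHom (A.mul (inv_mul_cancel t) (A.adj rfl a) b) := by
  rw [A.star_delta rfl, A.delta_mul_delta (inv_mul_cancel t)]
  rfl

/-- The matrix of the elements `a k* a l` is of the form `R* R`. -/
theorem exists_star_delta_mul_delta_eq {n : Type*} [Fintype n] (t : G) (a : n → A.fiber t) :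
    ∃ R : n → n → A.fiber 1, ∀ k l,
      star (A.delta t (a k)) * A.delta t (a l) = A.unitHom (∑ m, star (R m k) * R m l) := by
  have hinj : Function.Injective A.unitHom := fun x y h => by
    simpa only [unitHom_apply, value_delta_self] using congrArg (A.value 1) h
  obtain ⟨R, hR⟩ := exists_eq_sum_star_mul
    (fun k l => A.mul (inv_mul_cancel t) (A.adj rfl (a k)) (a l)) (fun k l => hinj (by
      rw [StarHomClass.map_star, ← star_delta_mul_delta, ← star_delta_mul_delta, star_mul,
        star_star])) (fun c => by
      -- The compression by a column `c` is the square of the single fiber element `∑ a_k c_k`, so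
      -- the bundle's positivity axiom for single elements suffices.
      obtain ⟨b, -, hb⟩ := A.star_delta_mul_self t (∑ k, A.mul (mul_one t) (a k) (c k))
      refine ⟨b, hinj ?_⟩
      rw [← hb, map_sum, map_sum, star_sum, Finset.sum_mul]
      refine Finset.sum_congr rfl fun k _ => ?_
      rw [map_sum, Finset.mul_sum]
      refine Finset.sum_congr rfl fun l _ => ?_
      rw [map_mul, map_mul, ← star_delta_mul_delta, ← A.delta_mul_delta (mul_one t),
        ← A.delta_mul_delta (mul_one t), ← unitHom_apply, ← unitHom_apply, star_mul,
        StarHomClass.map_star]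
      simp only [_root_.mul_assoc])
  exact ⟨R, fun k l => by rw [star_delta_mul_delta, hR]⟩

/-! ### Sections with coefficients in a C*-algebra -/

variable {D : Type*} [NonUnitalCStarAlgebra D]

variable (A D) in
/-- The restriction to the point `t`, with coefficients in `D`. -/
def pieceT (t : G) : A.Sections ⊗[ℂ] D →ₗ[ℂ] A.Sections ⊗[ℂ] D :=
  TensorProduct.map (A.piece t) LinearMap.id

@[simp]
theorem pieceT_tmul (t : G) (x : A.Sections) (d : D) :
    A.pieceT D t (x ⊗ₜ d) = A.piece t x ⊗ₜ d := rfl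

variable (A D) in
/-- The value at the unit, with coefficients in `D`. -/
def valueT : A.Sections ⊗[ℂ] D →ₗ[ℂ] A.fiber 1 ⊗[ℂ] D :=
  TensorProduct.map (A.value 1) LinearMap.id

@[simp]
theorem valueT_tmul (x : A.Sections) (d : D) : A.valueT D (x ⊗ₜ d) = A.value 1 x ⊗ₜ d := rfl

theorem valueT_unitHom (z : A.fiber 1 ⊗[ℂ] D) : A.valueT D (tensorMap D A.unitHom z) = z := by
  induction z with
  | zero => simp
  | add x y hx hy => simp only [map_add, hx, hy]
  | tmul a d => simp [unitHom_apply, value_delta_self]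

theorem unitHom_valueT (x : A.Sections ⊗[ℂ] D) :
    tensorMap D A.unitHom (A.valueT D x) = A.pieceT D 1 x := by
  induction x with
  | zero => simp
  | add x y hx hy => simp only [map_add, hx, hy]
  | tmul a d => rfl

theorem valueT_pieceT (x : A.Sections ⊗[ℂ] D) : A.valueT D (A.pieceT D 1 x) = A.valueT D x := by
  rw [← unitHom_valueT, valueT_unitHom]

theorem pieceT_pieceT (t : G) (x : A.Sections ⊗[ℂ] D) :
    A.pieceT D t (A.pieceT D t x) = A.pieceT D t x := by
  induction x with
  | zero => simp
  | add x y hx hy => simp only [map_add, hx, hy]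
  | tmul a d =>
    rw [pieceT_tmul, pieceT_tmul]
    simp only [piece, LinearMap.comp_apply, value_delta_self]

theorem pieceT_star_mul (t w : G) (x y : A.Sections ⊗[ℂ] D) :
    A.pieceT D w (star (A.pieceT D t x) * y) = star (A.pieceT D t x) * A.pieceT D (t * w) y := by
  induction x with
  | zero => simp
  | add x x' hx hx' => simp only [map_add, star_add, _root_.add_mul, hx, hx']
  | tmul a d =>
    induction y with
    | zero => simp
    | add y y' hy hy' => simp only [map_add, _root_.mul_add, hy, hy']
    | tmul b e =>
      simp only [pieceT_tmul, TensorProduct.star_tmul, Algebra.TensorProduct.tmul_mul_tmul]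
      congr 1
      exact A.piece_star_delta_mul t w _ b

theorem pieceT_mul_unitHom (t : G) (x : A.Sections ⊗[ℂ] D) (w : A.fiber 1 ⊗[ℂ] D) :
    A.pieceT D t (x * tensorMap D A.unitHom w) = A.pieceT D t x * tensorMap D A.unitHom w := by
  induction x with
  | zero => simp
  | add x x' hx hx' => simp only [map_add, _root_.add_mul, hx, hx']
  | tmul a d =>
    induction w with
    | zero => simp
    | add y y' hy hy' => simp only [map_add, _root_.mul_add, hy, hy']
    | tmul b e =>
      simp only [pieceT_tmul, tensorMap_tmul, Algebra.TensorProduct.tmul_mul_tmul]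
      congr 1
      induction a using A.section_induction with
      | h0 => simp
      | h2 x y hx hy => simp only [map_add, _root_.add_mul, hx, hy]
      | h1 s a =>
        rw [unitHom_apply, A.delta_mul_delta (mul_one s)]
        by_cases h : s = t
        · subst h
          rw [piece_delta_self, piece_delta_self, A.delta_mul_delta (mul_one s)]
        · rw [A.piece_delta_of_ne h, A.piece_delta_of_ne h, MulZeroClass.zero_mul]

theorem exists_eq_sum_pieceT (x : A.Sections ⊗[ℂ] D) :
    ∃ T : Finset G, ∀ T', T ⊆ T' → x = ∑ t ∈ T', A.pieceT D t x := by
  induction x with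
  | zero => exact ⟨∅, fun T' _ => by simp⟩
  | tmul a d =>
    obtain ⟨T, -, hT⟩ := A.exists_eq_sum_piece a
    refine ⟨T, fun T' hT' => ?_⟩
    simp only [pieceT_tmul, ← TensorProduct.sum_tmul]
    rw [← hT T' hT']
  | add x y hx hy =>
    obtain ⟨T, hT⟩ := hx
    obtain ⟨T₂, hT₂⟩ := hy
    refine ⟨T ∪ T₂, fun T' hT' => ?_⟩
    simp only [map_add, Finset.sum_add_distrib]
    rw [← hT T' (Finset.union_subset_left hT'), ← hT₂ T' (Finset.union_subset_right hT')]

/-- Convolution in coordinates: `(x* y)_w = ∑ x_t* y_{tw}`. Allowing every larger index set lets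
later sums be taken over a common range. -/
theorem exists_pieceT_star_mul_eq (x : A.Sections ⊗[ℂ] D) :
    ∃ T : Finset G, ∀ T', T ⊆ T' → ∀ w y, A.pieceT D w (star x * y)
      = ∑ t ∈ T', star (A.pieceT D t x) * A.pieceT D (t * w) y := by
  obtain ⟨T, hT⟩ := exists_eq_sum_pieceT x
  refine ⟨T, fun T' hT' w y => ?_⟩
  conv_lhs => rw [hT T' hT']
  rw [star_sum, Finset.sum_mul, map_sum]
  exact Finset.sum_congr rfl fun t _ => pieceT_star_mul t w x y

theorem unitHom_valueT_star_mul_self (t : G) (x : A.Sections ⊗[ℂ] D) :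
    tensorMap D A.unitHom (A.valueT D (star (A.pieceT D t x) * A.pieceT D t x))
      = star (A.pieceT D t x) * A.pieceT D t x := by
  rw [unitHom_valueT, pieceT_star_mul, mul_one, pieceT_pieceT]

theorem exists_valueT_star_mul_self_eq (x : A.Sections ⊗[ℂ] D) :
    ∃ T : Finset G, ∀ T', T ⊆ T' → A.valueT D (star x * x)
      = ∑ t ∈ T', A.valueT D (star (A.pieceT D t x) * A.pieceT D t x) := by
  obtain ⟨T, hT⟩ := exists_pieceT_star_mul_eq x
  refine ⟨T, fun T' hT' => ?_⟩
  rw [← valueT_pieceT, hT T' hT', map_sum]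
  simp only [mul_one]

theorem exists_pieceT_eq_sum (t : G) (x : A.Sections ⊗[ℂ] D) :
    ∃ (n : ℕ) (a : Fin n → A.fiber t) (d : Fin n → D),
      A.pieceT D t x = ∑ k, A.delta t (a k) ⊗ₜ d k := by
  induction x with
  | zero => exact ⟨0, Fin.elim0, Fin.elim0, by simp⟩
  | tmul a d => exact ⟨1, fun _ => A.value t a, fun _ => d, by simp [piece]⟩
  | add x y hx hy =>
    obtain ⟨n, a, d, h⟩ := hx
    obtain ⟨m, b, e, h'⟩ := hy
    refine ⟨n + m, Fin.append a b, Fin.append d e, ?_⟩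
    rw [map_add, h, h', Fin.sum_univ_add]
    simp

/-- A positive functional on `A 1 ⊗ D` extends to the sections. -/
theorem isPosFunctional_comp_valueT {g : A.fiber 1 ⊗[ℂ] D →ₗ[ℂ] ℂ} (hg : IsPosFunctional g) :
    IsPosFunctional (g ∘ₗ A.valueT D) := fun x => by
  obtain ⟨T, hT⟩ := exists_valueT_star_mul_self_eq x
  rw [LinearMap.comp_apply, hT T subset_rfl, map_sum]
  refine Finset.sum_nonneg fun t _ => ?_
  obtain ⟨n, a, d, h⟩ := exists_pieceT_eq_sum t x
  obtain ⟨R, hR⟩ := exists_star_delta_mul_delta_eq t a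
  -- Factoring the matrix of the `a_k* a_l` as `R* R` exhibits `x_t* x_t` as a sum of squares in
  -- `A_e ⊙ D`.
  have e : A.valueT D (star (A.pieceT D t x) * A.pieceT D t x)
      = ∑ m, star (∑ k, R m k ⊗ₜ[ℂ] d k) * ∑ l, R m l ⊗ₜ[ℂ] d l := by
    rw [h]
    simp only [star_sum, Finset.sum_mul, Finset.mul_sum, map_sum, TensorProduct.star_tmul,
      Algebra.TensorProduct.tmul_mul_tmul, hR, valueT_tmul, unitHom_apply, value_delta_self,
      TensorProduct.sum_tmul]
    rw [Finset.sum_comm_cycle]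
  rw [e, map_sum]
  exact Finset.sum_nonneg fun m _ => hg _

end FellBundle

namespace FellBundle

open scoped Classical
open Filter Topology

variable {G : Type u} [Group G] {A : FellBundle.{u, v} G} {D : Type*} [NonUnitalCStarAlgebra D]

/-! ### The expectation with coefficients in a C*-algebra -/

variable (A) in
/-- The embedding of the unit fiber in `C*(A)`. -/
def unitInclusion : A.fiber 1 →⋆ₙₐ[ℂ] A.FullCStar := A.ofHom.comp A.unitHom

theorem tensorMap_unitInclusion (z : A.fiber 1 ⊗[ℂ] D) :
    tensorMap D A.unitInclusion z = tensorMap D A.ofHom (tensorMap D A.unitHom z) := by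
  induction z with
  | zero => simp
  | add x y hx hy => simp only [map_add, hx, hy]
  | tmul a d => rfl

variable (A D) in
/-- The conditional expectation with coefficients in `D`. -/
def expectationT : A.FullCStar ⊗[ℂ] D →ₗ[ℂ] A.fiber 1 ⊗[ℂ] D :=
  TensorProduct.map (A.expectation : A.FullCStar →ₗ[ℂ] A.fiber 1) LinearMap.id

@[simp]
theorem expectationT_tmul (c : A.FullCStar) (d : D) :
    A.expectationT D (c ⊗ₜ d) = A.expectation c ⊗ₜ d := rfl

theorem expectationT_ofHom (x : A.Sections ⊗[ℂ] D) :
    A.expectationT D (tensorMap D A.ofHom x) = A.valueT D x := by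
  induction x with
  | zero => simp
  | add x y hx hy => simp only [map_add, hx, hy]
  | tmul a d => simp [expectation_ofHom]

theorem expectationT_unitInclusion (z : A.fiber 1 ⊗[ℂ] D) :
    A.expectationT D (tensorMap D A.unitInclusion z) = z := by
  rw [tensorMap_unitInclusion, expectationT_ofHom, valueT_unitHom]

theorem tensorMap_unitInclusion_injective :
    Function.Injective (tensorMap D A.unitInclusion) := fun x y h => by
  simpa only [expectationT_unitInclusion] using congrArg (A.expectationT D) h

theorem isPosFunctional_comp_expectation {φ : A.fiber 1 →L[ℂ] ℂ}
    (hφ : IsPosFunctional (φ : A.fiber 1 →ₗ[ℂ] ℂ)) :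
    IsPosFunctional ((φ.comp A.expectation : A.FullCStar →L[ℂ] ℂ) : A.FullCStar →ₗ[ℂ] ℂ) := by
  intro c
  refine A.denseRange_ofHom.induction_on
    (p := fun c => 0 ≤ φ (A.expectation (star c * c))) c ?_ fun x => ?_
  · exact isClosed_le continuous_const (by fun_prop)
  · rw [← StarHomClass.map_star A.ofHom, ← map_mul A.ofHom, expectation_ofHom]
    exact isPosFunctional_extendFunctional hφ x

theorem exists_eq_sum_tmul {C : Type*} [AddCommGroup C] [Module ℂ C] (z : C ⊗[ℂ] D) :
    ∃ (n : ℕ) (c : Fin n → C) (d : Fin n → D), z = ∑ k, c k ⊗ₜ d k := by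
  induction z with
  | zero => exact ⟨0, Fin.elim0, Fin.elim0, by simp⟩
  | tmul a d => exact ⟨1, fun _ => a, fun _ => d, by simp⟩
  | add x y hx hy =>
    obtain ⟨n, a, d, h⟩ := hx
    obtain ⟨m, b, e, h'⟩ := hy
    refine ⟨n + m, Fin.append a b, Fin.append d e, ?_⟩
    rw [h, h', Fin.sum_univ_add]
    simp

/-- Positivity is known for sections. The bound by a C*-seminorm makes `g(· ⊗ e)` norm continuous,
so the finitely many coefficients in `C*(A)` can be approximated simultaneously by sections. -/
theorem isPosFunctional_comp_expectationT {g : A.fiber 1 ⊗[ℂ] D →ₗ[ℂ] ℂ}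
    (hg : IsPosFunctional g) {q : Seminorm ℂ (A.fiber 1 ⊗[ℂ] D)} (hq : IsCStarSeminorm q)
    (hgq : ∀ z, ‖g z‖ ≤ q z) : IsPosFunctional (g ∘ₗ A.expectationT D) := fun z => by
  obtain ⟨n, c, d, rfl⟩ := exists_eq_sum_tmul z
  have hcont : ∀ e : D, Continuous fun a : A.fiber 1 => g (a ⊗ₜ e) := fun e =>
    AddMonoidHomClass.continuous_of_bound
      (g ∘ₗ (TensorProduct.mk ℂ (A.fiber 1) D).flip e) ‖e‖ fun a => by
        rw [mul_comm]; exact (hgq _).trans (hq.tmul_le a e)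
  have hform : ∀ c : Fin n → A.FullCStar,
      (g ∘ₗ A.expectationT D) (star (∑ k, c k ⊗ₜ d k) * ∑ k, c k ⊗ₜ d k)
      = ∑ l, ∑ k, g (A.expectation (star (c k) * c l) ⊗ₜ (star (d k) * d l)) := fun c => by
    simp only [star_sum, Finset.sum_mul, Finset.mul_sum, map_sum, TensorProduct.star_tmul,
      Algebra.TensorProduct.tmul_mul_tmul, LinearMap.comp_apply, expectationT_tmul]
  have hd : DenseRange fun (x : Fin n → A.Sections) k => A.ofHom (x k) :=
    DenseRange.piMap fun _ => A.denseRange_ofHom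
  refine hd.induction_on (p := fun c => 0 ≤ (g ∘ₗ A.expectationT D)
    (star (∑ k, c k ⊗ₜ d k) * ∑ k, c k ⊗ₜ d k)) c ?_ fun x => ?_
  · simp only [hform]
    refine isClosed_le continuous_const ?_
    refine continuous_finsetSum _ fun l _ => continuous_finsetSum _ fun k _ => ?_
    refine (hcont _).comp (A.expectation.continuous.comp ?_)
    exact (continuous_apply k).star.mul (continuous_apply l)
  · have e : ∑ k, A.ofHom (x k) ⊗ₜ[ℂ] d k = tensorMap D A.ofHom (∑ k, x k ⊗ₜ d k) := by
      simp only [map_sum, tensorMap_tmul]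
    rw [e, ← StarHomClass.map_star (tensorMap D A.ofHom), ← map_mul (tensorMap D A.ofHom),
      LinearMap.comp_apply, expectationT_ofHom]
    exact isPosFunctional_comp_valueT hg _

/-! ### Restriction of C*-norms to the unit fiber -/

/-- A `q`-contractive functional norming `x x*` extends to a positive functional through `E ⊗ id`.
Its GNS seminorm, tested at the vector `x*`, recovers `q x`. -/
theorem le_maxNorm_unitInclusion {q : Seminorm ℂ (A.fiber 1 ⊗[ℂ] D)} (hq : IsCStarSeminorm q)
    (x : A.fiber 1 ⊗[ℂ] D) :
    q x ≤ maxNorm A.FullCStar D (tensorMap D A.unitInclusion x) := by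
  obtain ⟨g, hg, hgq, h⟩ := hq.exists_isPosFunctional (x * star x)
  set θ := tensorMap D A.unitInclusion with hθ
  have hf := isPosFunctional_comp_expectationT hg hq hgq
  set f := g ∘ₗ A.expectationT D with hfd
  have hfθ : ∀ z, f (θ z) = g z := fun z => by
    rw [hfd, LinearMap.comp_apply, expectationT_unitInclusion]
  have hl : ∀ z, gnsLength f (θ z) = gnsLength g z := fun z => by
    rw [gnsLength, gnsLength, ← StarHomClass.map_star θ, ← map_mul θ, hfθ]
  have h1 : gnsLength f (θ x * θ (star x))
      ≤ maxNorm A.FullCStar D (θ x) * gnsLength f (θ (star x)) :=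
    gnsLength_mul_le _ _ (show f ∈ {f | IsPosFunctional f} from hf) _ _
  have hs : q (x * star x) = q x ^ 2 := by
    have := hq.star_mul_self (star x)
    rwa [star_star, hq.map_star] at this
  have h2 : gnsLength g (x * star x) = q x ^ 2 := by
    rw [gnsLength, h, Complex.ofReal_re, Real.sqrt_sq (apply_nonneg _ _), hs]
  have h3 : gnsLength g (star x) ≤ q x := by
    refine Real.sqrt_le_iff.2 ⟨apply_nonneg _ _, ?_⟩
    rw [star_star, ← hs]
    exact (Complex.re_le_norm _).trans (hgq _)
  rw [← map_mul θ, hl, hl, h2] at h1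
  rcases (apply_nonneg q x).eq_or_lt with h0 | h0
  · rw [← h0]; exact apply_nonneg _ _
  · refine le_of_mul_le_mul_right ?_ h0
    rw [← sq]
    exact h1.trans (mul_le_mul_of_nonneg_left h3 (apply_nonneg _ _))

/-- The unique norm above is at once maximal and spatial; restricted to the unit fiber it dominates
every C*-norm and is dominated by each of them. -/
theorem hasUniqueCStarNorm_fiber_one (h : HasUniqueCStarNorm A.FullCStar D) :
    HasUniqueCStarNorm (A.fiber 1) D := by
  obtain ⟨P, hP, hu⟩ := h
  refine ⟨_, hP.comp tensorMap_unitInclusion_injective, fun q hq => ?_⟩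
  ext x
  change q x = P (tensorMap D A.unitInclusion x)
  refine le_antisymm ?_ ?_
  · rw [← hu _ isCStarNorm_maxNorm]
    exact le_maxNorm_unitInclusion hq.toIsCStarSeminorm x
  · rw [← hu _ isCStarNorm_minNorm]
    exact hq.minNorm_map_le _ x

end FellBundle

namespace FellBundle

open scoped Classical
open Filter Topology

variable {G : Type u} [Group G] {A : FellBundle.{u, v} G} {D : Type*} [NonUnitalCStarAlgebra D]

/-! ### Comparison of norms on the pieces of a section -/

/-- The pieces are mutually orthogonal for `g ∘ valueT`, so each is no longer than the whole. -/
theorem gnsLength_pieceT_le {g : A.fiber 1 ⊗[ℂ] D →ₗ[ℂ] ℂ} (hg : IsPosFunctional g) (t : G)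
    (x : A.Sections ⊗[ℂ] D) :
    gnsLength (g ∘ₗ A.valueT D) (A.pieceT D t x) ≤ gnsLength (g ∘ₗ A.valueT D) x := by
  obtain ⟨T, hT⟩ := exists_valueT_star_mul_self_eq x
  have hpos := isPosFunctional_comp_valueT hg
  refine Real.sqrt_le_sqrt ?_
  rw [LinearMap.comp_apply, LinearMap.comp_apply, hT (insert t T) (Finset.subset_insert _ _),
    map_sum, Complex.re_sum]
  exact Finset.single_le_sum
    (f := fun t => (g (A.valueT D (star (A.pieceT D t x) * A.pieceT D t x))).re)
    (fun s _ => hpos.re_nonneg (A.pieceT D s x)) (Finset.mem_insert_self t T)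

/-- The product functional `φ ⊗ ψ` on `A 1 ⊗ D` extends to a product functional. -/
theorem exists_mem_prodFunctionals {g : A.fiber 1 ⊗[ℂ] D →ₗ[ℂ] ℂ}
    (hg : g ∈ prodFunctionals (A.fiber 1) D) : ∃ f ∈ prodFunctionals A.FullCStar D,
      ∀ x, f (tensorMap D A.ofHom x) = (g ∘ₗ A.valueT D) x := by
  obtain ⟨φ, ψ, hφ, hψ, rfl⟩ := hg
  refine ⟨_, ⟨φ.comp A.expectation, ψ, isPosFunctional_comp_expectation hφ, hψ, rfl⟩, fun x => ?_⟩
  induction x with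
  | zero => simp
  | add x y hx hy => simp only [map_add, hx, hy]
  | tmul a d => simp [expectation_ofHom]

/-- In the GNS space of an extended product functional, `x_t` acts on vectors from the unit fiber as
one orthogonal component of `x`, hence with norm at most that of `x`. The operator `x_t* x_t` then
has at most the squared norm. -/
theorem minNorm_valueT_le (t : G) (x : A.Sections ⊗[ℂ] D) :
    minNorm (A.fiber 1) D (A.valueT D (star (A.pieceT D t x) * A.pieceT D t x))
      ≤ minNorm A.FullCStar D (tensorMap D A.ofHom x) ^ 2 := by
  set z := A.valueT D (star (A.pieceT D t x) * A.pieceT D t x) with hz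
  set N := minNorm A.FullCStar D (tensorMap D A.ofHom x) with hN
  have hN0 : 0 ≤ N := apply_nonneg _ _
  refine gnsSeminorm_le _ _ ⟨sq_nonneg _, fun g hgm w => ?_⟩
  have hg := isPosFunctional_of_mem_prodFunctionals hgm
  obtain ⟨f, hf, hfg⟩ := exists_mem_prodFunctionals hgm
  have hpos := isPosFunctional_comp_valueT hg
  set ι := tensorMap D A.unitHom
  have hlen : ∀ w, gnsLength (g ∘ₗ A.valueT D) (ι w) = gnsLength g w := fun w => by
    rw [gnsLength, gnsLength, ← StarHomClass.map_star ι, ← map_mul ι, LinearMap.comp_apply,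
      valueT_unitHom]
  have hbound : ∀ w, gnsLength (g ∘ₗ A.valueT D) (A.pieceT D t x * ι w) ≤ N * gnsLength g w :=
      fun w => by
    rw [← pieceT_mul_unitHom]
    refine (gnsLength_pieceT_le hg t _).trans ?_
    have h1 : gnsLength f (tensorMap D A.ofHom x * tensorMap D A.ofHom (ι w))
        ≤ N * gnsLength f (tensorMap D A.ofHom (ι w)) := gnsLength_mul_le _ _ hf _ _
    have h2 : ∀ y, gnsLength f (tensorMap D A.ofHom y) = gnsLength (g ∘ₗ A.valueT D) y :=
        fun y => by
      rw [gnsLength, gnsLength, ← StarHomClass.map_star (tensorMap D A.ofHom),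
        ← map_mul (tensorMap D A.ofHom), hfg]
    rwa [← map_mul (tensorMap D A.ofHom), h2, h2, hlen] at h1
  -- Here `‖z w‖² = ⟨x_t z w, x_t w⟩`, because `z` represents `x_t* x_t`.
  have h3 : gnsLength g (z * w) ^ 2 ≤ N * gnsLength g (z * w) * (N * gnsLength g w) := by
    have e : g (star (z * w) * (z * w)) = (g ∘ₗ A.valueT D)
        (star (A.pieceT D t x * ι (z * w)) * (A.pieceT D t x * ι w)) := by
      have e1 : star (A.pieceT D t x * ι (z * w)) * (A.pieceT D t x * ι w)
          = ι (star (z * w) * (z * w)) := by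
        have e2 : ι z = star (A.pieceT D t x) * A.pieceT D t x :=
          unitHom_valueT_star_mul_self t x
        have e3 : ι (star (z * w) * (z * w)) = star (ι (z * w)) * (ι z * ι w) := by
          rw [map_mul ι (star _), StarHomClass.map_star ι, map_mul ι z w]
        rw [e3, e2, star_mul (A.pieceT D t x)]
        simp only [_root_.mul_assoc]
      rw [e1, LinearMap.comp_apply, valueT_unitHom]
    rw [hg.gnsLength_sq, e]
    refine (Complex.re_le_norm _).trans ((hpos.norm_le_gnsLength _ _).trans ?_)
    exact mul_le_mul (hbound _) (hbound _) (gnsLength_nonneg _ _)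
      (mul_nonneg hN0 (gnsLength_nonneg _ _))
  rcases (gnsLength_nonneg g (z * w)).eq_or_lt with h0 | h0
  · rw [← h0]; exact mul_nonneg (sq_nonneg _) (gnsLength_nonneg _ _)
  · refine le_of_mul_le_mul_left ?_ h0
    calc _ = gnsLength g (z * w) ^ 2 := (sq _).symm
      _ ≤ _ := h3
      _ = _ := by ring

/-- The C*-identity moves the question to `x_t* x_t` in `A_e ⊙ D`, where the restriction of `p` is
the spatial norm by uniqueness. -/
theorem norm_pieceT_le (hu : HasUniqueCStarNorm (A.fiber 1) D)
    {p : Seminorm ℂ (A.FullCStar ⊗[ℂ] D)} (hp : IsCStarNorm p) (t : G)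
    (x : A.Sections ⊗[ℂ] D) : p (tensorMap D A.ofHom (A.pieceT D t x))
      ≤ minNorm A.FullCStar D (tensorMap D A.ofHom x) := by
  have h1 := hu.unique (hp.comp (tensorMap_unitInclusion_injective (A := A) (D := D)))
    isCStarNorm_minNorm
  refine le_of_pow_le_pow_left₀ two_ne_zero (apply_nonneg _ _) (le_trans (le_of_eq ?_)
    (minNorm_valueT_le t x))
  rw [← h1]
  change _ = p (tensorMap D A.unitInclusion _)
  rw [tensorMap_unitInclusion, unitHom_valueT_star_mul_self, map_mul (tensorMap D A.ofHom),
    StarHomClass.map_star (tensorMap D A.ofHom), hp.star_mul_self]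

/-! ### The approximation property and C*-norms -/

/-- The compression of the functional `x ↦ f (y* x y)` by the function `a : G → A 1`. -/
def compression (f : A.FullCStar ⊗[ℂ] D →ₗ[ℂ] ℂ) (a : G →₀ A.fiber 1) (y : A.FullCStar ⊗[ℂ] D)
    (x : A.Sections ⊗[ℂ] D) : ℂ :=
  ∑ s ∈ a.support, ∑ r ∈ a.support, f (star (leftMul _ D (A.unitInclusion (a s)) y) *
    (tensorMap D A.ofHom (A.pieceT D (s * r⁻¹) x) * leftMul _ D (A.unitInclusion (a r)) y))

/-- The compression is `⟨ξ, Λ(x) ξ⟩` for `ξ_r = a(r) y` and `(Λ(x) ξ)_v = ∑ x_{v r⁻¹} ξ_r = η_v`, in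
the `ℓ²`-sum over `G` of the GNS space. Its value at `x* x` is `‖Λ(x) ξ‖²`, so this is
Cauchy–Schwarz combined with `‖ξ‖² ≤ ‖∑ a(r)* a(r)‖ f(y* y)`. -/
theorem norm_compression_sq_le {f : A.FullCStar ⊗[ℂ] D →ₗ[ℂ] ℂ} (hf : IsPosFunctional f)
    (a : G →₀ A.fiber 1) (y : A.FullCStar ⊗[ℂ] D) (x : A.Sections ⊗[ℂ] D) :
    ‖compression f a y x‖ ^ 2 ≤ ‖∑ r ∈ a.support, star (a r) * a r‖ * gnsLength f y ^ 2 *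
      ‖compression f a y (star x * x)‖ := by
  set F := a.support with hF
  set ξ := fun r => leftMul _ D (A.unitInclusion (a r)) y with hξ
  set O := tensorMap D A.ofHom with hO
  set η := fun v => ∑ r ∈ F, O (A.pieceT D (v * r⁻¹) x) * ξ r with hη
  have hg : compression f a y x = ∑ s ∈ F, f (star (ξ s) * η s) := by
    refine Finset.sum_congr rfl fun s _ => ?_
    rw [hη, Finset.mul_sum, map_sum]
  obtain ⟨T, hT⟩ := exists_pieceT_star_mul_eq x
  -- `V` contains every `t s` occurring in the convolution formula for `x* x`, and also `F`, so that
  -- dropping indices outside `F` only decreases the sum of squares.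
  let V : Finset G := F ∪ (T ×ˢ F).image fun q => q.1 * q.2
  have hV : compression f a y (star x * x) = ∑ v ∈ V, f (star (η v) * η v) := by
    have h1 : ∀ s ∈ F, ∀ w y', A.pieceT D w (star x * y')
        = ∑ v ∈ V, star (A.pieceT D (v * s⁻¹) x) * A.pieceT D (v * s⁻¹ * w) y' := by
      intro s hs w y'
      rw [hT (V.image fun v => v * s⁻¹) (fun t ht => ?_) w y', Finset.sum_image]
      · exact fun v _ v' _ h => mul_right_cancel h
      · refine Finset.mem_image.2 ⟨t * s, Finset.mem_union_right _
          (Finset.mem_image.2 ⟨(t, s), Finset.mk_mem_product ht hs, rfl⟩), by group⟩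
    have h2 : ∀ s ∈ F, ∀ r ∈ F, f (star (ξ s) * (O (A.pieceT D (s * r⁻¹) (star x * x)) * ξ r))
        = ∑ v ∈ V, f (star (O (A.pieceT D (v * s⁻¹) x) * ξ s) *
          (O (A.pieceT D (v * r⁻¹) x) * ξ r)) := by
      intro s hs r hr
      rw [h1 s hs, map_sum, Finset.sum_mul, Finset.mul_sum, map_sum]
      refine Finset.sum_congr rfl fun v _ => ?_
      have e : v * s⁻¹ * (s * r⁻¹) = v * r⁻¹ := by group
      rw [e, map_mul O, StarHomClass.map_star O, star_mul]
      simp only [_root_.mul_assoc]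
    calc compression f a y (star x * x)
        = ∑ s ∈ F, ∑ r ∈ F, ∑ v ∈ V, f (star (O (A.pieceT D (v * s⁻¹) x) * ξ s) *
          (O (A.pieceT D (v * r⁻¹) x) * ξ r)) :=
          Finset.sum_congr rfl fun s hs => Finset.sum_congr rfl fun r hr => h2 s hs r hr
      _ = ∑ v ∈ V, ∑ s ∈ F, ∑ r ∈ F, f (star (O (A.pieceT D (v * s⁻¹) x) * ξ s) *
          (O (A.pieceT D (v * r⁻¹) x) * ξ r)) := by
          rw [Finset.sum_comm_cycle, Finset.sum_comm_cycle]
      _ = _ := by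
          refine Finset.sum_congr rfl fun v _ => ?_
          rw [hη]
          simp only [star_sum, Finset.sum_mul, Finset.mul_sum, map_sum]
          rw [Finset.sum_comm]
  have hξs : ∑ s ∈ F, gnsLength f (ξ s) ^ 2
      ≤ ‖∑ r ∈ F, star (a r) * a r‖ * gnsLength f y ^ 2 := by
    set c := ∑ r ∈ F, star (a r) * a r with hc
    have e : ∑ s ∈ F, f (star (ξ s) * ξ s) = f (star y * leftMul _ D (A.unitInclusion c) y) := by
      rw [hc, map_sum, map_sum, LinearMap.sum_apply, Finset.mul_sum, map_sum]
      refine Finset.sum_congr rfl fun s _ => ?_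
      rw [map_mul A.unitInclusion, StarHomClass.map_star A.unitInclusion, isLeftAction_leftMul.mul,
        isLeftAction_leftMul.star_mul]
    have e2 : ∑ s ∈ F, gnsLength f (ξ s) ^ 2
        = (f (star y * leftMul _ D (A.unitInclusion c) y)).re := by
      rw [← e, Complex.re_sum]
      exact Finset.sum_congr rfl fun s _ => hf.gnsLength_sq _
    rw [e2]
    refine (Complex.re_le_norm _).trans ((hf.norm_le_gnsLength _ _).trans ?_)
    have h1 := isLeftAction_leftMul.gnsLength_le hf (A.unitInclusion c) y
    have h2 : ‖A.unitInclusion c‖ ≤ ‖c‖ := NonUnitalStarAlgHom.norm_apply_le _ _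
    have h3 := gnsLength_nonneg f y
    calc _ ≤ gnsLength f y * (‖c‖ * gnsLength f y) := by
          refine mul_le_mul_of_nonneg_left (h1.trans ?_) h3
          exact mul_le_mul_of_nonneg_right h2 h3
      _ = _ := by ring
  have hηs : ∑ s ∈ F, gnsLength f (η s) ^ 2 ≤ ‖compression f a y (star x * x)‖ := by
    refine le_trans ?_ (Complex.re_le_norm _)
    rw [hV, Complex.re_sum]
    simp only [hf.gnsLength_sq]
    exact Finset.sum_le_sum_of_subset_of_nonneg Finset.subset_union_left
      fun v _ _ => hf.re_nonneg _
  rw [hg]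
  calc ‖∑ s ∈ F, f (star (ξ s) * η s)‖ ^ 2
      ≤ (∑ s ∈ F, gnsLength f (ξ s) * gnsLength f (η s)) ^ 2 := by
        refine pow_le_pow_left₀ (norm_nonneg _) ((norm_sum_le _ _).trans ?_) 2
        exact Finset.sum_le_sum fun s _ => hf.norm_le_gnsLength _ _
    _ ≤ (∑ s ∈ F, gnsLength f (ξ s) ^ 2) * ∑ s ∈ F, gnsLength f (η s) ^ 2 :=
        Finset.sum_mul_sq_le_sq_mul_sq _ _ _
    _ ≤ _ := mul_le_mul hξs hηs (Finset.sum_nonneg fun _ _ => sq_nonneg _) (by positivity)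

/-- The pieces are bounded by the spatial norm, which gives a crude bound depending on `a` and `y`.
The Cauchy–Schwarz inequality lets repeated squaring replace it by a constant that is uniform along
the net. -/
theorem norm_compression_le (hu : HasUniqueCStarNorm (A.fiber 1) D)
    {f : A.FullCStar ⊗[ℂ] D →ₗ[ℂ] ℂ} (hf : IsPosFunctional f)
    {p : Seminorm ℂ (A.FullCStar ⊗[ℂ] D)} (hp : IsCStarNorm p) (hfp : ∀ z, ‖f z‖ ≤ p z)
    (a : G →₀ A.fiber 1) (y : A.FullCStar ⊗[ℂ] D) (x : A.Sections ⊗[ℂ] D) :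
    ‖compression f a y x‖ ≤ ‖∑ r ∈ a.support, star (a r) * a r‖ * gnsLength f y ^ 2 *
      minNorm A.FullCStar D (tensorMap D A.ofHom x) := by
  refine (isCStarSeminorm_minNorm.comp (tensorMap D A.ofHom)).norm_le_of_norm_sq_le
    (g := compression f a y) (K := ∑ s ∈ a.support, ∑ r ∈ a.support,
      p (leftMul _ D (A.unitInclusion (a s)) y) * p (leftMul _ D (A.unitInclusion (a r)) y))
    (by positivity) (norm_compression_sq_le hf a y) (fun z => ?_) x
  change _ ≤ _ * minNorm A.FullCStar D (tensorMap D A.ofHom z)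
  rw [Finset.sum_mul]
  refine (norm_sum_le _ _).trans (Finset.sum_le_sum fun s _ => ?_)
  rw [Finset.sum_mul]
  refine (norm_sum_le _ _).trans (Finset.sum_le_sum fun r _ => ?_)
  refine (hfp _).trans ((hp.mul_le _ _).trans ?_)
  rw [hp.map_star, _root_.mul_assoc]
  refine mul_le_mul_of_nonneg_left ((hp.mul_le _ _).trans ?_) (apply_nonneg _ _)
  rw [mul_comm]
  exact mul_le_mul_of_nonneg_left (norm_pieceT_le hu hp _ z) (apply_nonneg _ _)

theorem compression_add (f : A.FullCStar ⊗[ℂ] D →ₗ[ℂ] ℂ) (a : G →₀ A.fiber 1)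
    (y : A.FullCStar ⊗[ℂ] D) (x x' : A.Sections ⊗[ℂ] D) :
    compression f a y (x + x') = compression f a y x + compression f a y x' := by
  simp only [compression, map_add, _root_.add_mul, _root_.mul_add, Finset.sum_add_distrib]

/-- For a section supported at `t` only the pairs with `s = t r` contribute, which produces exactly
the sum in the approximation property. -/
theorem compression_delta_tmul (f : A.FullCStar ⊗[ℂ] D →ₗ[ℂ] ℂ) (a : G →₀ A.fiber 1)
    (y : A.FullCStar ⊗[ℂ] D) (t : G) (b : A.fiber t) (e : D) :
    compression f a y (A.delta t b ⊗ₜ e) = f (star y * ((A.ofHom (A.delta t (∑ r ∈ a.support,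
      A.mul (mul_one t) (A.mul (one_mul t) (star (a (t * r))) b) (a r))) ⊗ₜ e) * y)) := by
  rw [compression, Finset.sum_comm, map_sum, map_sum, TensorProduct.sum_tmul, Finset.sum_mul,
    Finset.mul_sum, map_sum]
  refine Finset.sum_congr rfl fun r _ => ?_
  rw [Finset.sum_eq_single (t * r)]
  · rw [mul_inv_cancel_right, pieceT_tmul, piece_delta_self, tensorMap_tmul,
      isLeftAction_leftMul.star_mul]
    have e1 : ∀ (c c' : A.FullCStar) (z : A.FullCStar ⊗[ℂ] D),
        (c ⊗ₜ e) * leftMul _ D c' z = ((c * c') ⊗ₜ e) * z := fun c c' z => by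
      induction z with
      | zero => simp
      | add x y hx hy => simp only [map_add, _root_.mul_add, hx, hy]
      | tmul a b => simp [_root_.mul_assoc]
    have e2 : ∀ (c c' : A.FullCStar) (z : A.FullCStar ⊗[ℂ] D),
        leftMul _ D c ((c' ⊗ₜ e) * z) = ((c * c') ⊗ₜ e) * z := fun c c' z => by
      induction z with
      | zero => simp
      | add x y hx hy => simp only [map_add, _root_.mul_add, hx, hy]
      | tmul a b => simp [_root_.mul_assoc]
    rw [e1, e2, ← StarHomClass.map_star A.unitInclusion]
    have e3 : A.unitInclusion (star (a (t * r))) *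
        (A.ofHom (A.delta t b) * A.unitInclusion (a r))
        = A.ofHom (A.delta t (A.mul (mul_one t) (A.mul (one_mul t) (star (a (t * r))) b)
          (a r))) := by
      rw [← A.delta_mul_delta (mul_one t), ← A.delta_mul_delta (one_mul t), map_mul A.ofHom,
        map_mul A.ofHom, _root_.mul_assoc]
      rfl
    rw [e3]
  · intro s _ hs
    rw [pieceT_tmul, A.piece_delta_of_ne]
    · simp
    · rintro rfl
      exact hs (by group)
  -- If `t r` is outside the support, then `a (t r) = 0` and the corresponding summand on the right
  -- vanishes too.
  · intro h
    rw [Finsupp.notMem_support_iff.1 h]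
    simp

theorem tendsto_compression {I : Type*} {l : Filter I} {a : I → (G →₀ A.fiber 1)}
    (ha : ∀ (t : G) (b : A.fiber t), Tendsto (fun i => ∑ r ∈ (a i).support,
      A.mul (mul_one t) (A.mul (one_mul t) (star (a i (t * r))) b) (a i r)) l (𝓝 b))
    {f : A.FullCStar ⊗[ℂ] D →ₗ[ℂ] ℂ} {p : Seminorm ℂ (A.FullCStar ⊗[ℂ] D)}
    (hp : IsCStarSeminorm p) (hfp : ∀ z, ‖f z‖ ≤ p z) (y : A.FullCStar ⊗[ℂ] D)
    (x : A.Sections ⊗[ℂ] D) : Tendsto (fun i => compression f (a i) y x) l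
      (𝓝 (f (star y * (tensorMap D A.ofHom x * y)))) := by
  induction x with
  | zero => simpa [compression] using tendsto_const_nhds
  | add x x' hx hx' =>
    simp only [compression_add, map_add, _root_.add_mul, _root_.mul_add]
    exact hx.add hx'
  | tmul x e =>
    induction x using A.section_induction with
    | h0 => simpa [compression] using tendsto_const_nhds
    | h2 x x' hx hx' =>
      simp only [TensorProduct.add_tmul, compression_add, map_add, _root_.add_mul,
        _root_.mul_add] at hx hx' ⊢
      exact hx.add hx'
    | h1 t b =>
      simp only [compression_delta_tmul, tensorMap_tmul]
      let ψ : A.fiber t →ₗ[ℂ] ℂ := f ∘ₗ LinearMap.mulLeft ℂ (star y) ∘ₗ LinearMap.mulRight ℂ y ∘ₗ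
        (TensorProduct.mk ℂ A.FullCStar D).flip e ∘ₗ (A.ofHom : A.Sections →ₗ[ℂ] A.FullCStar) ∘ₗ
        A.delta t
      have hψ : Continuous ψ := AddMonoidHomClass.continuous_of_bound ψ
        (p (star y) * (‖e‖ * p y)) fun c => by
          refine (hfp _).trans ((hp.mul_le _ _).trans ?_)
          rw [_root_.mul_assoc]
          refine mul_le_mul_of_nonneg_left ((hp.mul_le _ _).trans ?_) (apply_nonneg _ _)
          rw [mul_right_comm]
          refine mul_le_mul_of_nonneg_right ((hp.tmul_le _ _).trans ?_) (apply_nonneg _ _)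
          rw [mul_comm]
          exact mul_le_mul_of_nonneg_left (norm_ofHom_delta_le t c) (norm_nonneg _)
      exact (hψ.tendsto b).comp (ha t b)

/-- The uniform bound on compressions survives the limit along the net and gives `|f(y* x y)| ≤ M
f(y* y) min(x)`. A norming `f` turns this into `p ≤ √M · min`, and comparable C*-seminorms compare
with constant `1`. -/
theorem norm_ofHom_le_minNorm (hA : A.HasApproximationProperty)
    (hu : HasUniqueCStarNorm (A.fiber 1) D) {p : Seminorm ℂ (A.FullCStar ⊗[ℂ] D)}
    (hp : IsCStarNorm p) (x : A.Sections ⊗[ℂ] D) :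
    p (tensorMap D A.ofHom x) ≤ minNorm A.FullCStar D (tensorMap D A.ofHom x) := by
  obtain ⟨I, _, _, _, a, ⟨M, hM⟩, ha⟩ := hA
  have hM0 : 0 ≤ M := (norm_nonneg _).trans (hM (Classical.arbitrary I))
  set O := tensorMap D A.ofHom with hO
  refine (hp.toIsCStarSeminorm.comp O).le_of_le_mul (isCStarSeminorm_minNorm.comp O) (K := √M)
    (fun x => ?_) x
  change p (O x) ≤ √M * minNorm A.FullCStar D (O x)
  have key : ∀ (f : A.FullCStar ⊗[ℂ] D →ₗ[ℂ] ℂ), IsPosFunctional f → (∀ z, ‖f z‖ ≤ p z) →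
      ∀ y x, ‖f (star y * (O x * y))‖ ≤ M * gnsLength f y ^ 2 * minNorm A.FullCStar D (O x) := by
    intro f hf hfp y x
    refine le_of_tendsto (tendsto_compression ha hp.toIsCStarSeminorm hfp y x).norm
      (Eventually.of_forall fun i => (norm_compression_le hu hf hp hfp (a i) y x).trans ?_)
    gcongr
    exact hM i
  obtain ⟨f, hf, hfp, h⟩ := hp.toIsCStarSeminorm.exists_isPosFunctional (O x * star (O x))
  have hs : p (O x * star (O x)) = p (O x) ^ 2 := by
    have := hp.star_mul_self (star (O x))
    rwa [star_star, hp.map_star] at this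
  -- With `y = x*` and `x* x` in place of `x`, the left side is `f((x x*)* (x x*)) = p(x)⁴`, while
  -- the right side is at most `M p(x)² min(x)²`.
  have h1 := key f hf hfp (star (O x)) (star x * x)
  have e : star (star (O x)) * (O (star x * x) * star (O x))
      = star (O x * star (O x)) * (O x * star (O x)) := by
    rw [map_mul O, StarHomClass.map_star O, star_mul]
    simp only [_root_.mul_assoc]
  have h2 : gnsLength f (star (O x)) ^ 2 ≤ p (O x) ^ 2 := by
    rw [hf.gnsLength_sq, star_star, ← hs]
    exact (Complex.re_le_norm _).trans (hfp _)
  rw [e, h, Complex.norm_real, Real.norm_of_nonneg (sq_nonneg _), hs, map_mul O,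
    StarHomClass.map_star O, isCStarSeminorm_minNorm.star_mul_self] at h1
  rcases (apply_nonneg p (O x)).eq_or_lt with h0 | h0
  · rw [← h0]; exact mul_nonneg (Real.sqrt_nonneg _) (apply_nonneg _ _)
  · refine le_of_pow_le_pow_left₀ two_ne_zero
      (mul_nonneg (Real.sqrt_nonneg _) (apply_nonneg _ _)) ?_
    rw [mul_pow, Real.sq_sqrt hM0]
    refine le_of_mul_le_mul_left ?_ (pow_pos h0 2)
    calc p (O x) ^ 2 * p (O x) ^ 2 = (p (O x) ^ 2) ^ 2 := (sq _).symm
      _ ≤ _ := h1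
      _ ≤ M * p (O x) ^ 2 * minNorm A.FullCStar D (O x) ^ 2 := by gcongr
      _ = _ := by ring

/-- One approximant serves all C*-seminorms at once, because each is bounded by `‖c‖ ‖d‖` on
elementary tensors. -/
theorem exists_seminorm_sub_ofHom_le (z : A.FullCStar ⊗[ℂ] D) {ε : ℝ} (hε : 0 < ε) :
    ∃ x : A.Sections ⊗[ℂ] D, ∀ q : Seminorm ℂ (A.FullCStar ⊗[ℂ] D), IsCStarSeminorm q →
      q (z - tensorMap D A.ofHom x) ≤ ε := by
  induction z generalizing ε with
  | zero => exact ⟨0, fun q _ => by simpa using hε.le⟩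
  | add z z' hz hz' =>
    obtain ⟨x, hx⟩ := hz (half_pos hε)
    obtain ⟨x', hx'⟩ := hz' (half_pos hε)
    refine ⟨x + x', fun q hq => ?_⟩
    rw [map_add, add_sub_add_comm]
    exact (map_add_le_add q _ _).trans (by linarith [hx q hq, hx' q hq])
  | tmul c d =>
    obtain ⟨x, hx⟩ := A.denseRange_ofHom.exists_dist_lt c (div_pos hε (by positivity : 0 < ‖d‖ + 1))
    refine ⟨x ⊗ₜ d, fun q hq => ?_⟩
    rw [tensorMap_tmul, ← TensorProduct.sub_tmul]
    rw [dist_eq_norm, lt_div_iff₀ (by positivity)] at hx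
    refine (hq.tmul_le _ _).trans (le_trans ?_ hx.le)
    gcongr
    linarith

theorem hasUniqueCStarNorm_fullCStar (hA : A.HasApproximationProperty)
    (hu : HasUniqueCStarNorm (A.fiber 1) D) : HasUniqueCStarNorm A.FullCStar D := by
  refine ⟨minNorm A.FullCStar D, isCStarNorm_minNorm, fun p hp => ?_⟩
  ext z
  refine le_antisymm (le_of_forall_pos_le_add fun ε hε => ?_) (hp.minNorm_le z)
  obtain ⟨x, hx⟩ := exists_seminorm_sub_ofHom_le z (half_pos hε)
  have h1 := hx p hp.toIsCStarSeminorm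
  have h2 := hx (minNorm A.FullCStar D) isCStarSeminorm_minNorm
  have h3 := norm_ofHom_le_minNorm hA hu hp x
  have h4 := map_add_le_add p (z - tensorMap D A.ofHom x) (tensorMap D A.ofHom x)
  have h5 := map_sub_le_add (minNorm A.FullCStar D) z (z - tensorMap D A.ofHom x)
  rw [sub_add_cancel] at h4
  rw [sub_sub_cancel] at h5
  linarith

end FellBundle

end

theorem mainTheorem1 :
    (∀ {G : Type u₁} {H : Type u₂} [Group G] [Group H]
      (A : FellBundle.{u₁, v₁} G) (B : FellBundle.{u₂, v₂} H),
      A.HasApproximationProperty → B.HasApproximationProperty →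
        (HasUniqueCStarNorm (A.fiber 1) (B.fiber 1) ↔
          HasUniqueCStarNorm A.FullCStar B.FullCStar)) ∧
    (∀ {G : Type u₁} [Group G] (A : FellBundle.{u₁, v₁} G),
      A.HasApproximationProperty →
        IsNuclear.{v₁, w} (A.fiber 1) → IsNuclear.{max u₁ v₁, w} A.FullCStar) :=
  ⟨fun _ _ hA hB =>
    -- Both directions pass through a mixed product of one unit fiber with the other cross-sectional
    -- algebra: `A_e ⊙ C*(B)` here, `C*(A) ⊙ B_e` in the converse, up to flips.
    ⟨fun h => FellBundle.hasUniqueCStarNorm_fullCStar hA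
        (FellBundle.hasUniqueCStarNorm_fullCStar hB h.symm).symm,
      fun h => FellBundle.hasUniqueCStarNorm_fiber_one
        (FellBundle.hasUniqueCStarNorm_fiber_one h.symm).symm⟩,
    fun _ hA h D _ => FellBundle.hasUniqueCStarNorm_fullCStar hA (h D)⟩
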